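/- Let $\nu>0$ and let $\xi:\mathbb R\to(0,1)$ be the solution of $\xi'=\xi^{\nu+1}(1-\xi)$ with $\xi(0)=\frac{\nu+1}{\nu+2}$. For $\alpha,\beta>0$, $\gamma\in\mathbb C$ put $$M_0(\xi)=\begin{pmatrix}0&0&\alpha\beta\xi&\alpha\gamma\xi^{\nu+2}&0\\ \alpha\gamma&0&-\alpha\beta&\frac{\alpha}{\beta}\xi^{\nu+2}&0\\ \frac{2\alpha\beta}{\xi}&\alpha\beta&-\alpha\gamma\xi&\alpha\beta\xi^{\nu}&0\\ \frac1\xi&0&0&\xi^\nu&-1\\ 0&0&\alpha\beta&-\alpha^2\beta^2&0\end{pmatrix},$$ and let $M_0^{(2)}$ be the derivation induced on $\Lambda^2(\mathbb C^5)$, $M_0^{(2)}(u\wedge v)=M_0u\wedge v+u\wedge M_0v$. Let $T^{(2)}=\Lambda^2T$, where $T(\xi)$ is the linear map $$TX=\left(x_1-\alpha\gamma\xi x_4,\ x_2-\tfrac{\alpha}{\beta}\xi x_4,\ x_3-\alpha\beta x_4,\ \tfrac{\xi}{1-\xi}\alpha\beta x_4,\ x_5\right).$$ Let $\lambda_-(1)=-\frac12-\sqrt{\frac14+\alpha\gamma+\alpha^2\beta^2}$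 (principal root) and $\mu(\alpha)=-\beta+\frac{\gamma+\alpha\beta^2}{\lambda_-(1)}$, so that $\lambda_-(1)-\alpha\beta=-1+\alpha\mu(\alpha)$. Let $F_-(1)$ be the eigenvector of $-M_0(1)$ for $\lambda_-(1)$ whose fourth coordinate is $1$, let $E_{a,-}(1)=(-\beta,\beta-\gamma,-\beta,0,-\beta)$ (an eigenvector of $-M_0(1)$ for $-\alpha\beta$), and let $C_0=\lim_{y\to+\infty}(1-\xi(y))e^{y}$. With $(i_1,\dots,i_5)$ the canonical basis, put $f_1=i_1\wedge i_4$, $f_2=i_2\wedge i_4$, $f_3=i_3\wedge i_4$, $f_4=i_4\wedge i_5$, $g_1=i_1\wedge i_2$, $g_2=i_1\wedge i_3$, $g_3=i_1\wedge i_5$, $g_4=i_2\wedge i_3$, $g_5=i_2\wedge i_5$, $g_6=i_3\wedge i_5$. Put $(W_{+,1},\dots,W_{+,4})=(\beta,\gamma-\beta,\beta,-\beta)$, the $f$-coordinates of $F_-(1)\wedge E_{a,-}(1)$. Put $\delta_1=0$, $\delta_2=\delta_3=\delta_4=1$, $d_1=d_2=d_3=1$, $d_4=d_5=d_6=2$.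 For $\xi_0\in(0,1)$, a normalized decaying solution is a solution $w_+^{(2)}$ of $\frac{dw}{dy}+M_0^{(2)}(\xi(y))w=0$ in $\Lambda^2(\mathbb C^5)$ on $\{y:\xi(y)\ge\xi_0\}$ such that $$w_+^{(2)}(y)\,e^{(\alpha\beta-\lambda_-(1))y}\to\frac{C_0}{\alpha\beta}\,F_-(1)\wedge E_{a,-}(1)\qquad(y\to+\infty).$$ Its coefficients $z_k,m_l$ are defined by $T^{(2)}w_+^{(2)}(y)=e^{\alpha\mu(\alpha)y}\left(\sum_{k=1}^4z_kf_k+\sum_{l=1}^6m_lg_l\right)$. Theorem. There are functions $a_{k,j}(\xi)=a_{k,j}(\xi;\beta,\gamma)$ ($1\le k\le4$) and $b_{l,j}(\xi)=b_{l,j}(\xi;\beta,\gamma)$ ($1\le l\le6$), $j\ge1$, $\xi\in(0,1]$, independent of $\alpha$, such that for every compact $K\subset(0,\infty)\times\mathbb C$ there is $R>0$ with the following properties. 1. For all $(\beta,\gamma)\in K$, $j\ge1$, $\xi\in(0,1]$ and all $k,l$: $|a_{k,j}(\xi)|\le R^j(1-\xi)$ and $|b_{l,j}(\xi)|\le R^j(1-\xi)$;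 the functions $a_{k,j}/\xi^{\nu j+\delta_k}$ and $b_{l,j}/\xi^{\nu j+d_l}$ are differentiable (one-sidedly at $\xi=1$), and $$\left|\frac{d}{d\xi}\left(\frac{a_{k,j}(\xi)}{\xi^{\nu j+\delta_k}}\right)\right|\le\frac{R^j}{\xi^{\nu j+\delta_k+1}},\qquad\left|\frac{d}{d\xi}\left(\frac{b_{l,j}(\xi)}{\xi^{\nu j+d_l}}\right)\right|\le\frac{R^j}{\xi^{\nu j+d_l+1}}.$$ 2. For every $\xi_0\in(0,1)$ there is $\alpha_1>0$ such that for all $\alpha\in(0,\alpha_1)$ and $(\beta,\gamma)\in K$ there is a normalized decaying solution, which is the only one if $\Re\gamma>-\beta$ (in particular if $\Re\gamma\ge0$), and whose coefficients satisfy, for all $y$ with $\xi=\xi(y)\ge\xi_0$, $$z_k=W_{+,k}+\sum_{j\ge1}\frac{\alpha^j}{\xi^{\nu j+\delta_k}}a_{k,j}(\xi)\ (1\le k\le4),\qquad m_l=\sum_{j\ge1}\frac{\alpha^j}{\xi^{\nu j+d_l}}b_{l,j}(\xi)\ (1\le l\le6).$$ These series converge normally: their $j$-th terms are bounded in modulus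 by $u_j$ with $\sum_ju_j<\infty$, for all $\xi\in[\xi_0,1]$, $\alpha\in(0,\alpha_1)$, $(\beta,\gamma)\in K$. -/

import Mathlib

open Set Filter Topology Matrix

noncomputable section

namespace KullAnisimov

/-- The normalized density profile: the solution of `ξ' = ξ^(ν+1) (1 - ξ)` on the whole line, with
values in `(0, 1)` and `ξ 0 = (ν + 1) / (ν + 2)`. -/
structure IsProfile (ν : ℝ) (ξ : ℝ → ℝ) : Prop where
  mem_Ioo : ∀ y, ξ y ∈ Ioo (0 : ℝ) 1
  hasDerivAt : ∀ y, HasDerivAt ξ (ξ y ^ (ν + 1) * (1 - ξ y)) y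
  init : ξ 0 = (ν + 1) / (ν + 2)

/-- The matrix `M₀(ξ, α, β, γ)` of the linearized system `X' + M₀(ξ(y)) X = 0`; here `x` is the
value of `ξ`. -/
def M0 (ν x α β : ℝ) (γ : ℂ) : Matrix (Fin 5) (Fin 5) ℂ :=
  !![0, 0, α * β * x, α * γ * ((x ^ (ν + 2) : ℝ) : ℂ), 0;
     α * γ, 0, -(α * β), α / β * ((x ^ (ν + 2) : ℝ) : ℂ), 0;
     2 * α * β / x, α * β, -(α * γ * x), α * β * ((x ^ ν : ℝ) : ℂ), 0;
     1 / x, 0, 0, ((x ^ ν : ℝ) : ℂ), -1;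
     0, 0, α * β, -((α : ℂ) ^ 2 * (β : ℂ) ^ 2), 0]

/-- The change of unknowns `Y = T X`, that is `y₁ = x₁ - αγξ x₄`, `y₂ = x₂ - (α/β)ξ x₄`,
`y₃ = x₃ - αβ x₄`, `y₄ = αβ ξ/(1-ξ) x₄`, `y₅ = x₅`. -/
def changeT (x α β : ℝ) (γ : ℂ) : Matrix (Fin 5) (Fin 5) ℂ :=
  !![1, 0, 0, -(α * γ * x), 0;
     0, 1, 0, -(α / β * x), 0;
     0, 0, 1, -(α * β), 0;
     0, 0, 0, x / (1 - x) * (α * β), 0;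
     0, 0, 0, 0, 1]

/-- `Λ²(ℂ⁵)` is realized as the space of antisymmetric `5 × 5` matrices: the entry `(i, j)`, `i < j`,
of a matrix is its coefficient along `eᵢ ∧ eⱼ`. This is the exterior product of two vectors. -/
def wedge (u v : Fin 5 → ℂ) : Matrix (Fin 5) (Fin 5) ℂ :=
  vecMulVec u v - vecMulVec v u

/-- The derivation `A⁽²⁾` that `A` induces on `Λ²(ℂ⁵)`. -/
def derivTwo (A X : Matrix (Fin 5) (Fin 5) ℂ) : Matrix (Fin 5) (Fin 5) ℂ :=
  A * X + X * Aᵀ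

/-- The map `Λ²T` that `T` induces on `Λ²(ℂ⁵)`. -/
def mapTwo (T X : Matrix (Fin 5) (Fin 5) ℂ) : Matrix (Fin 5) (Fin 5) ℂ :=
  T * X * Tᵀ

theorem derivTwo_wedge (A : Matrix (Fin 5) (Fin 5) ℂ) (u v : Fin 5 → ℂ) :
    derivTwo A (wedge u v) = wedge (A *ᵥ u) v + wedge u (A *ᵥ v) := by
  simp only [derivTwo, wedge, mul_sub, sub_mul, mul_vecMulVec, vecMulVec_mul, vecMul_transpose]
  abel

theorem mapTwo_wedge (T : Matrix (Fin 5) (Fin 5) ℂ) (u v : Fin 5 → ℂ) :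
    mapTwo T (wedge u v) = wedge (T *ᵥ u) (T *ᵥ v) := by
  simp only [mapTwo, wedge, mul_sub, sub_mul, mul_vecMulVec, vecMulVec_mul, vecMul_transpose]

/-- The thermal eigenvalue `λ₋(1)` of `-M₀(1)` (principal square root). -/
def lambdaMinus (α β : ℝ) (γ : ℂ) : ℂ :=
  -(1 / 2) - (1 / 4 + α * γ + (α : ℂ) ^ 2 * (β : ℂ) ^ 2) ^ (1 / 2 : ℂ)

/-- `μ(α) = -β + (γ + αβ²) / λ₋(1)`, for which `λ₋(1) - αβ = -1 + α μ(α)`. -/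
def mu (α β : ℝ) (γ : ℂ) : ℂ :=
  -β + (γ + α * (β : ℂ) ^ 2) / lambdaMinus α β γ

/-- The hydrodynamic eigenvector `E_{a,-}(1)` of `-M₀(1)`, of eigenvalue `-αβ`. -/
def vecE (β : ℝ) (γ : ℂ) : Fin 5 → ℂ :=
  ![-β, β - γ, -β, 0, -β]

theorem M0_mulVec_vecE (ν α β : ℝ) (γ : ℂ) :
    M0 ν 1 α β γ *ᵥ vecE β γ = ((α : ℂ) * β) • vecE β γ := by
  ext i
  fin_cases i <;> simp [M0, vecE, Matrix.mulVec, dotProduct, Fin.sum_univ_succ] <;> ring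

/-- `F` is the thermal eigenvector `F₋(1)` of `-M₀(1)`: its eigenvalue is `λ₋(1)` and its fourth
coordinate is `1`. -/
def IsVecF (ν α β : ℝ) (γ : ℂ) (F : Fin 5 → ℂ) : Prop :=
  (-(M0 ν 1 α β γ)) *ᵥ F = lambdaMinus α β γ • F ∧ F 3 = 1

/-- The part of the line where `ξ(y) ∈ [ξ₀, 1)`. -/
def region (ξ : ℝ → ℝ) (ξ₀ : ℝ) : Set ℝ := {y | ξ₀ ≤ ξ y}

/-- `w` is a solution on the region `ξ(y) ≥ ξ₀` of the system `w' + M₀⁽²⁾ w = 0` in `Λ²(ℂ⁵)`, with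
`w(y) exp((αβ - λ₋(1)) y) → (C₀ / (αβ)) F₋(1) ∧ E_{a,-}(1)` as `y → +∞`, where `C₀` is the limit of
`(1 - ξ(y)) exp y`. -/
structure IsDecayingSolution (ν : ℝ) (ξ : ℝ → ℝ) (ξ₀ α β : ℝ) (γ : ℂ)
    (w : ℝ → Matrix (Fin 5) (Fin 5) ℂ) : Prop where
  antisymm : ∀ y ∈ region ξ ξ₀, (w y)ᵀ = -w y
  ode : ∀ y ∈ region ξ ξ₀, ∀ i j, HasDerivWithinAt (fun s => w s i j)
    (-(derivTwo (M0 ν (ξ y) α β γ) (w y) i j)) (region ξ ξ₀) y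
  limit : ∃ C₀ : ℝ, Tendsto (fun y => (1 - ξ y) * Real.exp y) atTop (𝓝 C₀) ∧
    ∃ F : Fin 5 → ℂ, IsVecF ν α β γ F ∧
      ∀ i j, Tendsto (fun y : ℝ => w y i j * Complex.exp ((α * β - lambdaMinus α β γ) * y)) atTop
        (𝓝 ((C₀ : ℂ) / (α * β) * wedge F (vecE β γ) i j))

/-- The pairs `(i, j)` with `f_k = eᵢ ∧ eⱼ`: `f₁ = e₁∧e₄`, `f₂ = e₂∧e₄`, `f₃ = e₃∧e₄`,
`f₄ = e₄∧e₅`. -/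
def fIdx : Fin 4 → Fin 5 × Fin 5 := ![(0, 3), (1, 3), (2, 3), (3, 4)]

/-- The pairs `(i, j)` with `g_l = eᵢ ∧ eⱼ`: `g₁ = e₁∧e₂`, `g₂ = e₁∧e₃`, `g₃ = e₁∧e₅`,
`g₄ = e₂∧e₃`, `g₅ = e₂∧e₅`, `g₆ = e₃∧e₅`. -/
def gIdx : Fin 6 → Fin 5 × Fin 5 := ![(0, 1), (0, 2), (0, 4), (1, 2), (1, 4), (2, 4)]

/-- `T⁽²⁾ w(y) exp(-α μ(α) y)`, whose coordinates are the `z_k` and the `m_l`. -/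
def scaled (ξ : ℝ → ℝ) (α β : ℝ) (γ : ℂ) (w : ℝ → Matrix (Fin 5) (Fin 5) ℂ) (y : ℝ) :
    Matrix (Fin 5) (Fin 5) ℂ :=
  Complex.exp (-(α * mu α β γ * y)) • mapTwo (changeT (ξ y) α β γ) (w y)

/-- The coordinate of `T⁽²⁾ w(y) exp(-α μ(α) y)` along `f_k`. -/
def zCoord (ξ : ℝ → ℝ) (α β : ℝ) (γ : ℂ) (w : ℝ → Matrix (Fin 5) (Fin 5) ℂ) (k : Fin 4) (y : ℝ) :
    ℂ :=
  scaled ξ α β γ w y (fIdx k).1 (fIdx k).2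

/-- The coordinate of `T⁽²⁾ w(y) exp(-α μ(α) y)` along `g_l`. -/
def mCoord (ξ : ℝ → ℝ) (α β : ℝ) (γ : ℂ) (w : ℝ → Matrix (Fin 5) (Fin 5) ℂ) (l : Fin 6) (y : ℝ) :
    ℂ :=
  scaled ξ α β γ w y (gIdx l).1 (gIdx l).2

/-- The limits `W_{+,k}` of the `z_k`. -/
def Wplus (β : ℝ) (γ : ℂ) : Fin 4 → ℂ := ![β, γ - β, β, -β]

/-- The coordinates of `F₋(1) ∧ E_{a,-}(1)` along `f₁, …, f₄` are `W_{+,1}, …, W_{+,4}`. -/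
theorem wedge_vecE_fIdx (F : Fin 5 → ℂ) (hF : F 3 = 1) (β : ℝ) (γ : ℂ) (k : Fin 4) :
    wedge F (vecE β γ) (fIdx k).1 (fIdx k).2 = Wplus β γ k := by
  fin_cases k <;> simp [wedge, vecE, fIdx, Wplus, vecMulVec, hF]

/-- The weights `δ_k` of the `z_k`. -/
def deltaExp : Fin 4 → ℝ := ![0, 1, 1, 1]

/-- The weights `d_l` of the `m_l`. -/
def dExp : Fin 6 → ℝ := ![1, 1, 1, 2, 2, 2]

/-- The term `α^j c(x) / x^(νj + e)` of an expansion. -/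
def term (ν α e : ℝ) (j : ℕ) (c : ℝ → ℂ) (x : ℝ) : ℂ :=
  ((α ^ j / x ^ (ν * j + e) : ℝ) : ℂ) * c x

/-- At the point `x ∈ (0, 1]`: `|c(x)| ≤ R^j (1 - x)`, the function `c(ξ) / ξ^(νj + e)` is
differentiable (from the left if `x = 1`) and its derivative is at most `R^j / x^(νj + e + 1)` in
modulus. -/
def CoeffBound (ν R e : ℝ) (j : ℕ) (c : ℝ → ℂ) (x : ℝ) : Prop :=
  ‖c x‖ ≤ R ^ j * (1 - x) ∧
    ∃ c' : ℂ, HasDerivWithinAt (fun t : ℝ => c t / ((t ^ (ν * j + e) : ℝ) : ℂ)) c' (Ioc 0 1) x ∧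
      ‖c'‖ ≤ R ^ j / x ^ (ν * j + e + 1)

end KullAnisimov

end

/-!
The proof is constructive. With the coordinates `Ŷ = diag(1, 1, 1, 1 - ξ, 1) T X` the system
becomes `Ŷ' = (α N(ξ) - ξ^(ν+1) e₄₄) Ŷ` (`coordS_intertwining`, `coordQ_intertwining`), where `N`
(`opN`) is a Laurent polynomial in `ξ` that does not depend on `α`. In these coordinates the
rescaled decaying solution is `(1 - ξ) U`, where `U(ξ)` is an antisymmetric matrix which has the
`z_k` as entries with an index `4` and the `m_l / (1 - ξ)` as other entries. The power series
`U = ∑ αʲ Uⱼ` solves the system if the entries of each coefficient `Uⱼ₊₁` solve scalar equations with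
the right-hand side `N Uⱼ + Uⱼ Nᵀ - ∑ μₙ Uⱼ₋ₙ`, where `μ(α) = ∑ μₙ αⁿ`. These equations are
singular at `ξ = 1`; the operators `intF` (entries with an index `4`; the right-hand side has to
vanish at `ξ = 1`) and `intG` (other entries) give solutions that are regular there. The
compatibility condition at `ξ = 1` holds because `∑ αʲ Uⱼ(1)` is the exterior product of the
formal eigenvector series (`vecHat`) with `E_{a,-}(1)` (`coeffU_one_and_numer_one`).

The functions `Uⱼ` are holomorphic in the disc `|z - 1| < 1`, which disposes of all questions of
regularity at `ξ = 1`. They are estimated by `‖Uⱼ‖ ≤ A Lʲ ξ^(-νj - e)` and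
`‖Uⱼ'‖ ≤ A Lʲ ξ^(-νj - e - 1)` (`IsSymbol`, `isSymbol_coeffU`): both operators preserve this class of functions, raise
the exponent by `ν` and lose only a constant factor, while `|μₙ|` grows geometrically by
comparison with Catalan numbers. So the series converges for `α L ξ^(-ν) < 1`. Its sum is a
solution with the required behaviour at infinity (`isDecayingSolution_solW`) and its coefficients
are the required expansions.

For uniqueness, the difference of two normalized solutions, multiplied by `exp ((αβ - λ₋(1)) y)`,
solves in the coordinates `Ŷ` a linear system for antisymmetric matrices whose coefficients
converge to those at `ξ = 1` at the rate `exp (-y)`, and it tends to `0`. The limit matrix is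
lower triangular in a suitable basis (`flagP_mul_opB`), with eigenvalues `λ₋(1)`, `-1 - λ₋(1)`,
`αβ`, `-αβ`, `αγ`; no diagonal entry of the induced system has a negative real part if `Re γ > -β`
(`re_flagT_nonneg`), and this forces the difference to vanish for large `y`
(`eventually_eq_zero_of_lower`), hence everywhere.

Indices in the comments are those of the mathematical notation and start from `1`; so the index
`4` is `3 : Fin 5` in the code.
-/

open Finset.HasAntidiagonal (antidiagonal)

noncomputable section

namespace KullAnisimov

/-! ### Functions of power type on `(0, 1]` -/

/-- The disc `|z - 1| < 1`, which contains `(0, 1]`. -/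
abbrev unitDisc : Set ℂ := Metric.ball 1 1

theorem ofReal_mem_unitDisc {x : ℝ} (hx : x ∈ Ioc (0 : ℝ) 1) : (x : ℂ) ∈ unitDisc := by
  have : ((x : ℂ) - 1) = ((x - 1 : ℝ) : ℂ) := by push_cast; ring
  rw [unitDisc, Metric.mem_ball, dist_eq_norm, this, Complex.norm_real, Real.norm_eq_abs, abs_lt]
  constructor <;> linarith [hx.1, hx.2]

theorem one_mem_unitDisc : (1 : ℂ) ∈ unitDisc := by simp [unitDisc]

theorem unitDisc_subset_slitPlane : unitDisc ⊆ Complex.slitPlane := by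
  intro z hz
  left
  have h : |(z - 1).re| < 1 :=
    (Complex.abs_re_le_norm _).trans_lt (by simpa [dist_eq_norm] using hz)
  rw [abs_lt] at h
  simp at h
  linarith [h.1]

theorem hasDerivAt_of_diffOn {f : ℂ → ℂ} (hf : DifferentiableOn ℂ f unitDisc) {z : ℂ}
    (hz : z ∈ unitDisc) : HasDerivAt f (deriv f z) z :=
  (hf.differentiableAt (Metric.isOpen_ball.mem_nhds hz)).hasDerivAt

theorem diffOn_deriv {f : ℂ → ℂ} (hf : DifferentiableOn ℂ f unitDisc) :
    DifferentiableOn ℂ (deriv f) unitDisc :=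
  hf.deriv Metric.isOpen_ball

/-- The function `f` is holomorphic on the disc `|z - 1| < 1`; on `(0, 1]` it is at most `A x⁻ᵖ` in
modulus, and its derivative at most `A x⁻ᵖ⁻¹`. -/
structure IsSymbol (A p : ℝ) (f : ℂ → ℂ) : Prop where
  diffOn : DifferentiableOn ℂ f unitDisc
  norm_le : ∀ x ∈ Ioc (0 : ℝ) 1, ‖f x‖ ≤ A * x ^ (-p)
  norm_deriv_le : ∀ x ∈ Ioc (0 : ℝ) 1, ‖deriv f x‖ ≤ A * x ^ (-p - 1)

/-- A bound by a power on `(0, 1)` extends to `x = 1` by continuity. -/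
theorem norm_le_rpow_of_Ioo {f : ℂ → ℂ} (hf : DifferentiableOn ℂ f unitDisc) {A p : ℝ}
    (h : ∀ x ∈ Ioo (0 : ℝ) 1, ‖f x‖ ≤ A * x ^ p) : ∀ x ∈ Ioc (0 : ℝ) 1, ‖f x‖ ≤ A * x ^ p := by
  intro x hx
  rcases hx.2.lt_or_eq with h1 | rfl
  · exact h x ⟨hx.1, h1⟩
  have c1 : ContinuousAt (fun t : ℝ => ‖f t‖) 1 := by
    have : ContinuousAt f ((1 : ℝ) : ℂ) := by
      simpa using (hasDerivAt_of_diffOn hf one_mem_unitDisc).continuousAt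
    exact (ContinuousAt.comp this Complex.continuous_ofReal.continuousAt).norm
  have c2 : ContinuousAt (fun t : ℝ => A * t ^ p) 1 :=
    continuousAt_const.mul (Real.continuousAt_rpow_const _ _ (Or.inl one_ne_zero))
  refine le_of_tendsto_of_tendsto (b := 𝓝[<] (1 : ℝ)) (c1.mono_left nhdsWithin_le_nhds)
    (c2.mono_left nhdsWithin_le_nhds) ?_
  filter_upwards [Ioo_mem_nhdsLT (zero_lt_one' ℝ)] with t ht using h t ht

/-- Integration from `1`: a bound of the derivative on `[x, 1]` gives one of the function at `x`. -/
theorem norm_le_of_norm_deriv_le {F f : ℂ → ℂ} {B b : ℝ → ℝ} {x : ℝ} (hx : x ∈ Ioc (0 : ℝ) 1)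
    (hF : ∀ t ∈ Ioc (0 : ℝ) 1, HasDerivAt F (f t) (t : ℂ)) (hF1 : F 1 = 0) (hB1 : 0 ≤ B 1)
    (hB : ∀ t ∈ Ioc (0 : ℝ) 1, HasDerivAt B (b t) t)
    (hb : ∀ t ∈ Icc x 1, ‖f t‖ ≤ -b t) : ‖F x‖ ≤ B x := by
  have mem : ∀ s ∈ Icc (-1 : ℝ) (-x), -s ∈ Ioc (0 : ℝ) 1 := fun s hs =>
    ⟨by linarith [hs.2, hx.1], by linarith [hs.1]⟩
  have d1 : ∀ s ∈ Icc (-1 : ℝ) (-x),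
      HasDerivAt (fun s : ℝ => F ((-s : ℝ) : ℂ)) (-f ((-s : ℝ) : ℂ)) s := by
    intro s hs
    have := (hF _ (mem s hs)).comp_ofReal.scomp s (hasDerivAt_neg s)
    rw [neg_one_smul] at this
    exact this
  have d2 : ∀ s ∈ Icc (-1 : ℝ) (-x), HasDerivAt (fun s : ℝ => B (-s)) (-b (-s)) s := by
    intro s hs
    have := (hB _ (mem s hs)).comp s (hasDerivAt_neg s)
    rw [mul_neg_one] at this
    exact this
  have key := image_norm_le_of_norm_deriv_right_le_deriv_boundary'
    (f := fun s : ℝ => F ((-s : ℝ) : ℂ)) (f' := fun s => -f ((-s : ℝ) : ℂ)) (a := -1) (b := -x)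
    (B := fun s => B (-s)) (B' := fun s => -b (-s))
    (fun s hs => (d1 s hs).continuousAt.continuousWithinAt)
    (fun s hs => (d1 s (Ico_subset_Icc_self hs)).hasDerivWithinAt) (by simpa [hF1] using hB1)
    (fun s hs => (d2 s hs).continuousAt.continuousWithinAt)
    (fun s hs => (d2 s (Ico_subset_Icc_self hs)).hasDerivWithinAt)
    (fun s hs => by
      rw [norm_neg]
      exact hb _ ⟨by linarith [hs.2], by linarith [hs.1]⟩)
    (x := -x) ⟨by linarith [hx.2], le_rfl⟩
  simpa using key

/-- A bound `C` of the derivative on `[x, 1]` gives the bound `C (1 - x)` of the function. -/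
theorem norm_le_mul_one_sub {F f : ℂ → ℂ} {C x : ℝ} (hx : x ∈ Ioc (0 : ℝ) 1)
    (hF : ∀ t ∈ Ioc (0 : ℝ) 1, HasDerivAt F (f t) (t : ℂ)) (hF1 : F 1 = 0)
    (hb : ∀ t ∈ Icc x 1, ‖f t‖ ≤ C) : ‖F x‖ ≤ C * (1 - x) := by
  refine norm_le_of_norm_deriv_le (B := fun t => C * (1 - t)) (b := fun _ => -C) hx hF hF1 (by simp)
    (fun t _ => ?_) (by simpa using hb)
  simpa using ((hasDerivAt_id t).const_sub 1).const_mul C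

theorem one_sub_rpow_le {x p : ℝ} (hx : x ∈ Ioc (0 : ℝ) 1) :
    1 - x ^ p ≤ max 1 p * (1 - x) := by
  rcases le_total 1 p with h | h
  · have := one_add_mul_self_le_rpow_one_add (s := x - 1) (by linarith [hx.1]) h
    rw [add_sub_cancel] at this
    rw [max_eq_right h]
    linarith
  · have : x ^ (1 : ℝ) ≤ x ^ p := Real.rpow_le_rpow_of_exponent_ge hx.1 hx.2 h
    rw [Real.rpow_one] at this
    rw [max_eq_left h]
    linarith

/-- The constant that bounds the integration of powers `t ^ (-p - 1)` over `[x, 1]`, `p ≥ ν`. -/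
def intConst (ν : ℝ) : ℝ := max 1 ν⁻¹

theorem one_le_intConst (ν : ℝ) : 1 ≤ intConst ν := le_max_left _ _

theorem norm_le_of_deriv_rpow {ν : ℝ} (hν : 0 < ν) {F f : ℂ → ℂ} {A p x : ℝ} (hp : ν ≤ p)
    (hA : 0 ≤ A) (hx : x ∈ Ioc (0 : ℝ) 1)
    (hF : ∀ t ∈ Ioc (0 : ℝ) 1, HasDerivAt F (f t) (t : ℂ)) (hF1 : F 1 = 0)
    (hf : ∀ t ∈ Ioc (0 : ℝ) 1, ‖f t‖ ≤ A * t ^ (-p - 1)) :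
    ‖F x‖ ≤ A * intConst ν * ((1 - x) * x ^ (-p)) := by
  have p0 : 0 < p := hν.trans_le hp
  have h1 : ‖F x‖ ≤ A * (x ^ (-p) - 1) / p := by
    refine norm_le_of_norm_deriv_le (B := fun t => A * (t ^ (-p) - 1) / p)
      (b := fun t => A * (-p * t ^ (-p - 1)) / p) hx hF hF1 (by simp) (fun t ht => ?_)
      (fun t ht => ?_)
    · exact (((Real.hasDerivAt_rpow_const (Or.inl ht.1.ne')).sub_const 1).const_mul A).div_const p
    · refine (hf t ⟨hx.1.trans_le ht.1, ht.2⟩).trans_eq ?_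
      field_simp
  have h2 : (x ^ (-p) - 1) = x ^ (-p) * (1 - x ^ p) := by
    rw [mul_sub, ← Real.rpow_add hx.1]; simp
  have xp : 0 < x ^ (-p) := Real.rpow_pos_of_pos hx.1 _
  have h3 : max 1 p / p ≤ intConst ν := by
    rw [div_le_iff₀ p0]
    refine max_le ?_ ?_
    · calc 1 = ν⁻¹ * ν := by field_simp
        _ ≤ intConst ν * p := by
          apply mul_le_mul (le_max_right _ _) hp hν.le
          exact zero_le_one.trans (one_le_intConst ν)
    · exact le_mul_of_one_le_left p0.le (one_le_intConst ν)
  have h4 := one_sub_rpow_le (p := p) hx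
  calc ‖F x‖ ≤ A * (x ^ (-p) - 1) / p := h1
    _ = A * x ^ (-p) * (1 - x ^ p) / p := by rw [h2]; ring
    _ ≤ A * x ^ (-p) * (max 1 p * (1 - x)) / p := by gcongr
    _ = A * x ^ (-p) * (1 - x) * (max 1 p / p) := by ring
    _ ≤ A * x ^ (-p) * (1 - x) * intConst ν := by
      have := hx.2
      have : 0 ≤ 1 - x := by linarith
      gcongr
    _ = _ := by ring

theorem rpow_neg_sub_one_le {x p : ℝ} (hx : 1 / 2 ≤ x) :
    x ^ (-p - 1) ≤ 2 * x ^ (-p) := by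
  have x0 : 0 < x := by linarith
  rw [Real.rpow_sub_one x0.ne', div_le_iff₀ x0]
  have := Real.rpow_pos_of_pos x0 (-p)
  nlinarith

namespace IsSymbol

variable {A B p q : ℝ} {f g : ℂ → ℂ}

theorem nonneg (hf : IsSymbol A p f) : 0 ≤ A := by
  have := (norm_nonneg _).trans (hf.norm_le 1 (by simp))
  simpa using this

theorem mono (hf : IsSymbol A p f) (hAB : A ≤ B) (hpq : p ≤ q) : IsSymbol B q f where
  diffOn := hf.diffOn
  norm_le x hx := (hf.norm_le x hx).trans <| mul_le_mul hAB
    (Real.rpow_le_rpow_of_exponent_ge hx.1 hx.2 (by linarith)) (Real.rpow_nonneg hx.1.le _)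
    (hf.nonneg.trans hAB)
  norm_deriv_le x hx := (hf.norm_deriv_le x hx).trans <| mul_le_mul hAB
    (Real.rpow_le_rpow_of_exponent_ge hx.1 hx.2 (by linarith)) (Real.rpow_nonneg hx.1.le _)
    (hf.nonneg.trans hAB)

theorem of_Ioo (hd : DifferentiableOn ℂ f unitDisc)
    (h : ∀ x ∈ Ioo (0 : ℝ) 1, ‖f x‖ ≤ A * x ^ (-p))
    (h' : ∀ x ∈ Ioo (0 : ℝ) 1, ‖deriv f x‖ ≤ A * x ^ (-p - 1)) : IsSymbol A p f :=
  ⟨hd, norm_le_rpow_of_Ioo hd h, norm_le_rpow_of_Ioo (diffOn_deriv hd) h'⟩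

theorem const {c : ℂ} (hc : ‖c‖ ≤ A) (hp : 0 ≤ p) : IsSymbol A p (fun _ => c) := by
  have : IsSymbol A 0 (fun _ => c) :=
    ⟨differentiableOn_const _, fun x _ => by simpa using hc, fun x hx => by
      simpa using mul_nonneg ((norm_nonneg _).trans hc) (Real.rpow_nonneg hx.1.le _)⟩
  exact this.mono le_rfl hp

theorem zero (hA : 0 ≤ A) : IsSymbol A p (fun _ => 0) :=
  ⟨differentiableOn_const _, fun x hx => by
      simpa using mul_nonneg hA (Real.rpow_nonneg hx.1.le _), fun x hx => by
      simpa using mul_nonneg hA (Real.rpow_nonneg hx.1.le _)⟩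

theorem hasDerivAt (hf : IsSymbol A p f) {x : ℝ} (hx : x ∈ Ioc (0 : ℝ) 1) :
    HasDerivAt f (deriv f x) x :=
  hasDerivAt_of_diffOn hf.diffOn (ofReal_mem_unitDisc hx)

theorem add (hf : IsSymbol A p f) (hg : IsSymbol B p g) :
    IsSymbol (A + B) p (fun z => f z + g z) where
  diffOn := hf.diffOn.add hg.diffOn
  norm_le x hx := by
    rw [add_mul]
    exact (norm_add_le _ _).trans (add_le_add (hf.norm_le x hx) (hg.norm_le x hx))
  norm_deriv_le x hx := by
    rw [((hf.hasDerivAt hx).fun_add (hg.hasDerivAt hx)).deriv, add_mul]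
    exact (norm_add_le _ _).trans (add_le_add (hf.norm_deriv_le x hx) (hg.norm_deriv_le x hx))

theorem sum {ι : Type*} (s : Finset ι) {A : ι → ℝ} {f : ι → ℂ → ℂ}
    (hf : ∀ i ∈ s, IsSymbol (A i) p (f i)) :
    IsSymbol (∑ i ∈ s, A i) p (fun z => ∑ i ∈ s, f i z) := by
  classical
  induction s using Finset.induction_on with
  | empty => simpa using zero le_rfl
  | insert a s ha ih =>
    simp only [Finset.sum_insert ha]
    exact (hf a (Finset.mem_insert_self _ _)).add
      (ih fun i hi => hf i (Finset.mem_insert_of_mem hi))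

theorem const_mul (hf : IsSymbol A p f) (c : ℂ) : IsSymbol (‖c‖ * A) p (fun z => c * f z) where
  diffOn := hf.diffOn.const_mul c
  norm_le x hx := by
    rw [norm_mul, mul_assoc]
    exact mul_le_mul_of_nonneg_left (hf.norm_le x hx) (norm_nonneg _)
  norm_deriv_le x hx := by
    rw [((hf.hasDerivAt hx).const_mul c).deriv, norm_mul, mul_assoc]
    exact mul_le_mul_of_nonneg_left (hf.norm_deriv_le x hx) (norm_nonneg _)

theorem neg (hf : IsSymbol A p f) : IsSymbol A p (fun z => -f z) := by
  simpa using hf.const_mul (-1)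

theorem mul (hf : IsSymbol A p f) (hg : IsSymbol B q g) :
    IsSymbol (2 * (A * B)) (p + q) (fun z => f z * g z) where
  diffOn := hf.diffOn.mul hg.diffOn
  norm_le x hx := by
    have e : x ^ (-(p + q)) = x ^ (-p) * x ^ (-q) := by
      rw [← Real.rpow_add hx.1]; ring_nf
    have h := mul_le_mul (hf.norm_le x hx) (hg.norm_le x hx) (norm_nonneg _)
      ((norm_nonneg _).trans (hf.norm_le x hx))
    have h0 := (mul_nonneg (norm_nonneg (f x)) (norm_nonneg (g x))).trans h
    rw [norm_mul, e]
    linarith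
  norm_deriv_le x hx := by
    have e1 : x ^ (-(p + q) - 1) = x ^ (-p - 1) * x ^ (-q) := by
      rw [← Real.rpow_add hx.1]; ring_nf
    have e2 : x ^ (-(p + q) - 1) = x ^ (-p) * x ^ (-q - 1) := by
      rw [← Real.rpow_add hx.1]; ring_nf
    have h1 := mul_le_mul (hf.norm_deriv_le x hx) (hg.norm_le x hx) (norm_nonneg _)
      ((norm_nonneg _).trans (hf.norm_deriv_le x hx))
    have h2 := mul_le_mul (hf.norm_le x hx) (hg.norm_deriv_le x hx) (norm_nonneg _)
      ((norm_nonneg _).trans (hf.norm_le x hx))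
    rw [((hf.hasDerivAt hx).fun_mul (hg.hasDerivAt hx)).deriv]
    refine (norm_add_le _ _).trans ?_
    rw [norm_mul, norm_mul]
    calc _ ≤ A * x ^ (-p - 1) * (B * x ^ (-q)) + A * x ^ (-p) * (B * x ^ (-q - 1)) :=
          add_le_add h1 h2
      _ = A * B * (x ^ (-p - 1) * x ^ (-q)) + A * B * (x ^ (-p) * x ^ (-q - 1)) := by ring
      _ = _ := by rw [← e1, ← e2]; ring

/-- If `f(1) = 0`, the quotient `f(x) / (1 - x)` is no worse than `f`: away from `1` trivially, and
near `1` by the mean value theorem. -/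
theorem norm_dslope_le (hf : IsSymbol A p f) (hp : 0 ≤ p) (h1 : f 1 = 0) :
    ∀ x ∈ Ioc (0 : ℝ) 1, ‖dslope f 1 x‖ ≤ 2 * A * x ^ (-p) := by
  refine norm_le_rpow_of_Ioo ((Complex.differentiableOn_dslope
    (Metric.isOpen_ball.mem_nhds one_mem_unitDisc)).2 hf.diffOn) fun x hx => ?_
  have hx' : x ∈ Ioc (0 : ℝ) 1 := ⟨hx.1, hx.2.le⟩
  have ne : (x : ℂ) ≠ 1 := by exact_mod_cast hx.2.ne
  have pos : 0 < 1 - x := by linarith [hx.2]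
  have e : ‖((x : ℂ) - 1)‖ = 1 - x := by
    rw [← Complex.ofReal_one, ← Complex.ofReal_sub, Complex.norm_real, Real.norm_eq_abs,
      abs_sub_comm, abs_of_pos pos]
  rw [dslope_of_ne _ ne, slope_def_field, h1, sub_zero, norm_div, e, div_le_iff₀ pos]
  have xp : 0 < x ^ (-p) := Real.rpow_pos_of_pos hx.1 _
  rcases le_total x (1 / 2) with h | h
  · have := hf.norm_le x hx'
    have h2 : 0 ≤ A * x ^ (-p) := mul_nonneg hf.nonneg xp.le
    nlinarith
  · calc ‖f x‖ ≤ A * x ^ (-p - 1) * (1 - x) :=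
        norm_le_mul_one_sub hx' (fun t ht => hf.hasDerivAt ht) h1 fun t ht =>
          (hf.norm_deriv_le t ⟨hx.1.trans_le ht.1, ht.2⟩).trans <|
            mul_le_mul_of_nonneg_left
              (Real.rpow_le_rpow_of_nonpos hx.1 ht.1 (by linarith)) hf.nonneg
      _ ≤ A * (2 * x ^ (-p)) * (1 - x) := by
        have := rpow_neg_sub_one_le (p := p) h
        have := hf.nonneg
        gcongr
      _ = _ := by ring

end IsSymbol

/-! ### The two integrations of the recursion -/

/-- The primitive on the disc `|z - 1| < 1` that vanishes at `1`. -/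
def prim (f : ℂ → ℂ) : ℂ → ℂ :=
  open Classical in
  if h : DifferentiableOn ℂ f unitDisc then (h.isExactOn_ball.with_val_at 1 0).choose else 0

theorem prim_one (f : ℂ → ℂ) : prim f 1 = 0 := by
  unfold prim
  split_ifs with h
  · exact (h.isExactOn_ball.with_val_at 1 0).choose_spec.1
  · rfl

theorem hasDerivAt_prim {f : ℂ → ℂ} (h : DifferentiableOn ℂ f unitDisc) {z : ℂ}
    (hz : z ∈ unitDisc) : HasDerivAt (prim f) (f z) z := by
  unfold prim
  rw [dif_pos h]
  exact (h.isExactOn_ball.with_val_at 1 0).choose_spec.2 z hz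

theorem diffOn_prim {f : ℂ → ℂ} (h : DifferentiableOn ℂ f unitDisc) :
    DifferentiableOn ℂ (prim f) unitDisc :=
  fun _ hz => (hasDerivAt_prim h hz).differentiableAt.differentiableWithinAt

theorem diffOn_dslope {f : ℂ → ℂ} (h : DifferentiableOn ℂ f unitDisc) :
    DifferentiableOn ℂ (dslope f 1) unitDisc :=
  (Complex.differentiableOn_dslope (Metric.isOpen_ball.mem_nhds one_mem_unitDisc)).2 h

/-- The factor `z ^ (-(ν + 1))`, the inverse of the factor of `ξ' = ξ ^ (ν + 1) (1 - ξ)`. -/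
def powFactor (ν : ℝ) (z : ℂ) : ℂ := z ^ (((-(ν + 1) : ℝ)) : ℂ)

theorem powFactor_ofReal (ν : ℝ) {x : ℝ} (hx : 0 < x) :
    powFactor ν x = ((x ^ (-(ν + 1)) : ℝ) : ℂ) := by
  rw [powFactor, Complex.ofReal_cpow hx.le]

theorem powFactor_one (ν : ℝ) : powFactor ν 1 = 1 := by simp [powFactor]

theorem rpow_mul_powFactor (ν : ℝ) {x : ℝ} (hx : 0 < x) :
    ((x ^ (ν + 1) : ℝ) : ℂ) * powFactor ν x = 1 := by
  rw [powFactor_ofReal ν hx, ← Complex.ofReal_mul, ← Real.rpow_add hx]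
  simp

theorem hasDerivAt_powFactor (ν : ℝ) {z : ℂ} (hz : z ∈ unitDisc) :
    HasDerivAt (powFactor ν) (((-(ν + 1) : ℝ) : ℂ) * z ^ (((-(ν + 1) : ℝ) : ℂ) - 1)) z := by
  have := (hasDerivAt_id z).cpow_const (c := ((-(ν + 1) : ℝ) : ℂ)) (unitDisc_subset_slitPlane hz)
  rw [mul_one] at this
  exact this

theorem isSymbol_powFactor {ν : ℝ} (hν : 0 < ν) : IsSymbol (ν + 1) (ν + 1) (powFactor ν) where
  diffOn _ hz := (hasDerivAt_powFactor ν hz).differentiableAt.differentiableWithinAt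
  norm_le x hx := by
    have := Real.rpow_pos_of_pos hx.1 (-(ν + 1))
    rw [powFactor_ofReal ν hx.1, Complex.norm_real, Real.norm_eq_abs, abs_of_pos this]
    nlinarith
  norm_deriv_le x hx := by
    have e : (x : ℂ) ^ (((-(ν + 1) : ℝ) : ℂ) - 1) = ((x ^ (-(ν + 1) - 1) : ℝ) : ℂ) := by
      rw [Complex.ofReal_cpow hx.1.le]; push_cast; rfl
    rw [(hasDerivAt_powFactor ν (ofReal_mem_unitDisc hx)).deriv, e, norm_mul, Complex.norm_real,
      Complex.norm_real, Real.norm_eq_abs, Real.norm_eq_abs, abs_neg, abs_of_pos (by linarith),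
      abs_of_pos (Real.rpow_pos_of_pos hx.1 _)]

/-- The solution `u` of `z ^ (ν + 1) (1 - z) u' = H` with `u(1) = 0`, if `H(1) = 0`. -/
def intF (ν : ℝ) (H : ℂ → ℂ) (z : ℂ) : ℂ :=
  -prim (fun z => powFactor ν z * dslope H 1 z) z

/-- The solution `u`, regular at `z = 1`, of `z ^ (ν + 1) ((1 - z) u)' = H`. -/
def intG (ν : ℝ) (H : ℂ → ℂ) (z : ℂ) : ℂ :=
  -dslope (prim fun z => powFactor ν z * H z) 1 z

/-- The constant of the estimates of `intF` and `intG`. -/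
def stepConst (ν : ℝ) : ℝ := 8 * (ν + 1) * intConst ν

theorem intF_one (ν : ℝ) (H : ℂ → ℂ) : intF ν H 1 = 0 := by simp [intF, prim_one]

section

variable {ν : ℝ} {H : ℂ → ℂ}

theorem diffOn_powFactor_mul (hν : 0 < ν) (hH : DifferentiableOn ℂ H unitDisc) :
    DifferentiableOn ℂ (fun z => powFactor ν z * H z) unitDisc :=
  (isSymbol_powFactor hν).diffOn.mul hH

theorem hasDerivAt_intF (hν : 0 < ν) (hH : DifferentiableOn ℂ H unitDisc) {z : ℂ}
    (hz : z ∈ unitDisc) : HasDerivAt (intF ν H) (-(powFactor ν z * dslope H 1 z)) z :=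
  (hasDerivAt_prim (diffOn_powFactor_mul hν (diffOn_dslope hH)) hz).fun_neg

theorem intF_ode (hν : 0 < ν) (hH : DifferentiableOn ℂ H unitDisc) (h1 : H 1 = 0) {x : ℝ}
    (hx : x ∈ Ioc (0 : ℝ) 1) :
    ((x ^ (ν + 1) : ℝ) : ℂ) * ((1 - x) * deriv (intF ν H) x) = H x := by
  have e := sub_smul_dslope H 1 (x : ℂ)
  rw [h1, sub_zero, smul_eq_mul] at e
  rw [(hasDerivAt_intF hν hH (ofReal_mem_unitDisc hx)).deriv, ← e]
  linear_combination (((x : ℂ) - 1) * dslope H 1 x) * rpow_mul_powFactor ν hx.1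

theorem one_sub_mul_intG (ν : ℝ) (H : ℂ → ℂ) (z : ℂ) :
    (1 - z) * intG ν H z = prim (fun z => powFactor ν z * H z) z := by
  have e := sub_smul_dslope (prim fun z => powFactor ν z * H z) 1 z
  rw [prim_one, sub_zero, smul_eq_mul] at e
  rw [intG, ← e]
  ring

theorem diffOn_intG (hν : 0 < ν) (hH : DifferentiableOn ℂ H unitDisc) :
    DifferentiableOn ℂ (intG ν H) unitDisc :=
  (diffOn_dslope (diffOn_prim (diffOn_powFactor_mul hν hH))).neg

theorem deriv_intG (hν : 0 < ν) (hH : DifferentiableOn ℂ H unitDisc) {z : ℂ}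
    (hz : z ∈ unitDisc) :
    (1 - z) * deriv (intG ν H) z - intG ν H z = powFactor ν z * H z := by
  have d1 := hasDerivAt_prim (diffOn_powFactor_mul hν hH) hz
  have d2 := ((hasDerivAt_id z).const_sub 1).fun_mul (hasDerivAt_of_diffOn (diffOn_intG hν hH) hz)
  have e : (fun y => (1 - id y) * intG ν H y) = prim (fun z => powFactor ν z * H z) :=
    funext fun y => one_sub_mul_intG ν H y
  rw [e] at d2
  have := d2.unique d1
  simp only [id] at this
  linear_combination this

theorem intG_one (hν : 0 < ν) (hH : DifferentiableOn ℂ H unitDisc) : intG ν H 1 = -H 1 := by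
  have := deriv_intG hν hH one_mem_unitDisc
  rw [powFactor_one] at this
  linear_combination -this

theorem intG_ode (hν : 0 < ν) (hH : DifferentiableOn ℂ H unitDisc) {x : ℝ}
    (hx : x ∈ Ioc (0 : ℝ) 1) :
    ((x ^ (ν + 1) : ℝ) : ℂ) * ((1 - x) * deriv (intG ν H) x) =
      H x + ((x ^ (ν + 1) : ℝ) : ℂ) * intG ν H x := by
  linear_combination ((x ^ (ν + 1) : ℝ) : ℂ) * deriv_intG hν hH (ofReal_mem_unitDisc hx)
    + H x * rpow_mul_powFactor ν hx.1

variable {B r : ℝ}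

theorem norm_intF_deriv_le (hr : 0 ≤ r) (hH : IsSymbol B r H) (h1 : H 1 = 0) {x : ℝ}
    (hx : x ∈ Ioc (0 : ℝ) 1) :
    ‖-(powFactor ν x * dslope H 1 x)‖ ≤ 2 * B * x ^ (-(r + ν) - 1) := by
  have xp := Real.rpow_pos_of_pos hx.1 (-(ν + 1))
  have e : x ^ (-(r + ν) - 1) = x ^ (-(ν + 1)) * x ^ (-r) := by
    rw [← Real.rpow_add hx.1]; ring_nf
  rw [norm_neg, norm_mul, powFactor_ofReal ν hx.1, Complex.norm_real, Real.norm_eq_abs,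
    abs_of_pos xp, e]
  have := mul_le_mul_of_nonneg_left (hH.norm_dslope_le hr h1 x hx) xp.le
  linarith

theorem norm_intF_le (hν : 0 < ν) (hr : 0 ≤ r) (hH : IsSymbol B r H) (h1 : H 1 = 0) {x : ℝ}
    (hx : x ∈ Ioc (0 : ℝ) 1) :
    ‖intF ν H x‖ ≤ 2 * B * intConst ν * ((1 - x) * x ^ (-(r + ν))) :=
  norm_le_of_deriv_rpow (f := fun z => -(powFactor ν z * dslope H 1 z)) hν (by linarith)
    (by linarith [hH.nonneg]) hx
    (fun _ ht => hasDerivAt_intF hν hH.diffOn (ofReal_mem_unitDisc ht)) (intF_one ν H)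
    (fun _ ht => norm_intF_deriv_le hr hH h1 ht)

theorem le_stepConst (hν : 0 < ν) (hB : 0 ≤ B) :
    2 * B * intConst ν ≤ stepConst ν * B := by
  have h := one_le_intConst ν
  have : 0 ≤ B * intConst ν := by positivity
  unfold stepConst
  nlinarith [mul_nonneg this hν.le]

theorem isSymbol_intF (hν : 0 < ν) (hr : 0 ≤ r) (hH : IsSymbol B r H) (h1 : H 1 = 0) :
    IsSymbol (stepConst ν * B) (r + ν) (intF ν H) := by
  have c1 := one_le_intConst ν
  have h : IsSymbol (2 * B * intConst ν) (r + ν) (intF ν H) := by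
    have hB := hH.nonneg
    refine ⟨fun z hz =>
      (hasDerivAt_intF hν hH.diffOn hz).differentiableAt.differentiableWithinAt,
      fun x hx => (norm_intF_le hν hr hH h1 hx).trans ?_, fun x hx => ?_⟩
    · have xp := Real.rpow_pos_of_pos hx.1 (-(r + ν))
      have : (1 - x) * x ^ (-(r + ν)) ≤ x ^ (-(r + ν)) := by nlinarith [hx.1]
      gcongr
    · rw [(hasDerivAt_intF hν hH.diffOn (ofReal_mem_unitDisc hx)).deriv]
      refine (norm_intF_deriv_le hr hH h1 hx).trans ?_
      have xp := Real.rpow_pos_of_pos hx.1 (-(r + ν) - 1)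
      have : 2 * B ≤ 2 * B * intConst ν := le_mul_of_one_le_right (by linarith) c1
      gcongr
  exact h.mono (le_stepConst hν hH.nonneg) le_rfl

theorem isSymbol_intG (hν : 0 < ν) (hr : 0 ≤ r) (hH : IsSymbol B r H) :
    IsSymbol (stepConst ν * B) (r + ν) (intG ν H) := by
  have c1 := one_le_intConst ν
  have hB := hH.nonneg
  set p := r + ν with hp
  set c := intConst ν
  set B' := 2 * ((ν + 1) * B) with hB'
  have B'0 : 0 ≤ B' := by positivity
  have eC : stepConst ν * B = 4 * c * B' := by simp only [stepConst, hB', c]; ring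
  have hg : IsSymbol B' (p + 1) (fun z => powFactor ν z * H z) :=
    ((isSymbol_powFactor hν).mul hH).mono le_rfl (by linarith)
  have hM : ∀ x ∈ Ioc (0 : ℝ) 1, ‖prim (fun z => powFactor ν z * H z) x‖ ≤
      B' * c * ((1 - x) * x ^ (-p)) := fun x hx =>
    norm_le_of_deriv_rpow (f := fun z => powFactor ν z * H z) (p := p) hν (by linarith) B'0 hx
      (fun t ht => hasDerivAt_prim hg.diffOn (ofReal_mem_unitDisc ht)) (prim_one _)
      fun t ht => (hg.norm_le t ht).trans_eq (by ring_nf)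
  have nrm : ∀ x ∈ Ioo (0 : ℝ) 1, ‖(1 - (x : ℂ))‖ = 1 - x := fun x hx => by
    rw [← Complex.ofReal_one, ← Complex.ofReal_sub, Complex.norm_real, Real.norm_eq_abs,
      abs_of_pos (by linarith [hx.2])]
  have hm : ∀ x ∈ Ioo (0 : ℝ) 1, ‖intG ν H x‖ ≤ B' * c * x ^ (-p) := fun x hx => by
    have pos : 0 < 1 - x := by linarith [hx.2]
    have h := hM x ⟨hx.1, hx.2.le⟩
    rw [← one_sub_mul_intG, norm_mul, nrm x hx] at h
    refine le_of_mul_le_mul_left ?_ pos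
    linarith
  rw [eC]
  refine IsSymbol.of_Ioo (diffOn_intG hν hH.diffOn) (fun x hx => (hm x hx).trans ?_) fun x hx => ?_
  · have xp := Real.rpow_pos_of_pos hx.1 (-p)
    have : 0 ≤ c * B' := by positivity
    exact mul_le_mul_of_nonneg_right (by linarith) xp.le
  have hx' : x ∈ Ioc (0 : ℝ) 1 := ⟨hx.1, hx.2.le⟩
  have pos : 0 < 1 - x := by linarith [hx.2]
  have xp := Real.rpow_pos_of_pos hx.1 (-p - 1)
  have der := deriv_intG hν hH.diffOn (ofReal_mem_unitDisc hx')
  have cB : B' ≤ c * B' := le_mul_of_one_le_left B'0 c1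
  rcases le_total x (1 / 2) with h | h
  · have e1 : (1 - (x : ℂ)) * deriv (intG ν H) x = powFactor ν x * H x + intG ν H x := by
      linear_combination der
    have e2 := congrArg norm e1
    rw [norm_mul, nrm x hx] at e2
    have h1 := norm_add_le (powFactor ν x * H x) (intG ν H x)
    have h2 := (hg.norm_le x hx').trans_eq (b := B' * x ^ (-(p + 1))) rfl
    have h3 := hm x hx
    have e3 : -(p + 1) = -p - 1 := by ring
    rw [e3] at h2
    have h4 : x ^ (-p) ≤ x ^ (-p - 1) :=
      Real.rpow_le_rpow_of_exponent_ge hx.1 hx.2.le (by linarith)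
    have h5 : B' * c * x ^ (-p) ≤ B' * c * x ^ (-p - 1) := by gcongr
    have h6 : B' * x ^ (-p - 1) ≤ c * B' * x ^ (-p - 1) := by gcongr
    have h7 : (1 / 2) * ‖deriv (intG ν H) x‖ ≤ (1 - x) * ‖deriv (intG ν H) x‖ := by
      gcongr; linarith
    linarith
  · -- with `u = intG ν H`, `g = powFactor ν * H` and `M` the primitive of `g`, the function
    -- `Q = (1 - x) g + M = (1 - x)² u'` satisfies `Q(1) = 0` and `Q' = (1 - x) g'`
    have hQ : ‖(1 - (x : ℂ)) * (powFactor ν x * H x) + prim (fun z => powFactor ν z * H z) x‖ ≤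
        (1 - x) * (B' * x ^ (-(p + 1) - 1)) * (1 - x) := by
      refine norm_le_mul_one_sub
        (F := fun z => (1 - z) * (powFactor ν z * H z) + prim (fun z => powFactor ν z * H z) z)
        (f := fun z => (1 - z) * deriv (fun z => powFactor ν z * H z) z) hx' (fun t ht => ?_)
        (by simp [prim_one]) fun t ht => ?_
      · have d := (((hasDerivAt_id (t : ℂ)).const_sub 1).fun_mul (hg.hasDerivAt ht)).fun_add
          (hasDerivAt_prim hg.diffOn (ofReal_mem_unitDisc ht))
        simp only [id] at d
        refine d.congr_deriv ?_
        ring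
      · have ht' : t ∈ Ioc (0 : ℝ) 1 := ⟨hx.1.trans_le ht.1, ht.2⟩
        rw [norm_mul, ← Complex.ofReal_one, ← Complex.ofReal_sub, Complex.norm_real,
          Real.norm_eq_abs, abs_of_nonneg (by linarith [ht.2])]
        refine mul_le_mul (by linarith [ht.1]) ((hg.norm_deriv_le t ht').trans ?_) (norm_nonneg _)
          pos.le
        exact mul_le_mul_of_nonneg_left
          (Real.rpow_le_rpow_of_nonpos hx.1 ht.1 (by linarith)) B'0
    have e : (1 - (x : ℂ)) * (powFactor ν x * H x) + prim (fun z => powFactor ν z * H z) x =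
        (1 - (x : ℂ)) * (1 - (x : ℂ)) * deriv (intG ν H) x := by
      rw [← one_sub_mul_intG, ← der]; ring
    rw [e, norm_mul, norm_mul, nrm x hx] at hQ
    have h1 : ‖deriv (intG ν H) x‖ ≤ B' * x ^ (-(p + 1) - 1) := by
      refine le_of_mul_le_mul_left ?_ (mul_pos pos pos)
      linarith
    have h2 := rpow_neg_sub_one_le (p := p + 1) h
    have e3 : -(p + 1) = -p - 1 := by ring
    rw [e3] at h1 h2
    calc _ ≤ B' * x ^ (-p - 1 - 1) := h1
      _ ≤ B' * (2 * x ^ (-p - 1)) := by gcongr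
      _ ≤ _ := by nlinarith

end

/-! ### The system in the regular coordinates and its formal expansion -/

/-- The weights of the coordinates `x₁, …, x₅`: the `i`-th one is of size `ξ ^ (-wt i)`. -/
def wt : Fin 5 → ℤ := ![0, 1, 1, 0, 1]

/-- The constant part of the coefficients of `opN`, up to the weights. -/
def coeffA (β : ℝ) (γ : ℂ) : Matrix (Fin 5) (Fin 5) ℂ :=
  !![γ, 0, -β, (γ ^ 2 - β ^ 2) / β, -γ;
     0, 0, β, β, 0;
     -β, -β, 0, -γ, -β;
     -β, 0, 0, -γ, β;
     0, 0, -β, 0, 0]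

/-- The part linear in `ξ` of the coefficients of `opN`, up to the weights. -/
def coeffB (β : ℝ) (γ : ℂ) : Matrix (Fin 5) (Fin 5) ℂ :=
  !![0, 0, 0, 0, 0;
     1 / β - γ, 0, 0, (1 / β - γ) * γ / β, -(1 / β);
     0, 0, γ, γ - 1 / β, 0;
     0, 0, 0, 0, 0;
     0, 0, 0, 0, 0]

/-- The matrix `N(ξ)`, independent of `α`, for which the coordinates
`Ŷ = diag(1, 1, 1, 1 - ξ, 1) T X` satisfy `Ŷ' = (α N(ξ) - ξ ^ (ν + 1) e₄₄) Ŷ`. -/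
def opN (β : ℝ) (γ : ℂ) (z : ℂ) : Matrix (Fin 5) (Fin 5) ℂ :=
  of fun i k => z ^ (wt k - wt i) * (coeffA β γ i k + z * coeffB β γ i k)

/-- The Taylor coefficients in `α` of `η(α) = -(λ₋(1) + 1) / α`, the solution of
`η = γ + α β² - α η²`. -/
def etaCoeff (β : ℝ) (γ : ℂ) : ℕ → ℂ
  | 0 => γ
  | n + 1 => (if n = 0 then (β : ℂ) ^ 2 else 0) -
      ∑ i : Fin (n + 1), etaCoeff β γ i * etaCoeff β γ (n - i)
decreasing_by all_goals omega

/-- The Taylor coefficients in `α` of `μ(α) = -β - η(α)`. -/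
def muCoeff (β : ℝ) (γ : ℂ) (n : ℕ) : ℂ := (if n = 0 then -(β : ℂ) else 0) - etaCoeff β γ n

/-- The coefficients `Uⱼ(ξ)` of the expansion of the solution: `U = ∑ αʲ Uⱼ` has the `z_k` as
entries with an index `4`, and the `m_l / (1 - ξ)` as other entries. -/
def coeffU (ν β : ℝ) (γ : ℂ) : ℕ → ℂ → Matrix (Fin 5) (Fin 5) ℂ
  | 0 => fun _ => wedge (Pi.single 3 1) (vecE β γ)
  | n + 1 => fun z => of fun i k =>
      if i = 3 ∨ k = 3 then
        intF ν (fun z => (derivTwo (opN β γ z) (coeffU ν β γ n z) -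
          ∑ i : Fin (n + 1), muCoeff β γ i • coeffU ν β γ (n - i) z) i k) z
      else
        intG ν (fun z => (derivTwo (opN β γ z) (coeffU ν β γ n z) -
          ∑ i : Fin (n + 1), muCoeff β γ i • coeffU ν β γ (n - i) z) i k) z
decreasing_by all_goals omega

/-- The right-hand side `N Uⱼ + Uⱼ Nᵀ - ∑ μₙ Uⱼ₋ₙ` of the equation of `Uⱼ₊₁`. -/
def numer (ν β : ℝ) (γ : ℂ) (n : ℕ) (z : ℂ) : Matrix (Fin 5) (Fin 5) ℂ :=
  derivTwo (opN β γ z) (coeffU ν β γ n z) -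
    ∑ p ∈ antidiagonal n, muCoeff β γ p.1 • coeffU ν β γ p.2 z

theorem snd_le_of_mem_antidiagonal {n : ℕ} {p : ℕ × ℕ} (hp : p ∈ antidiagonal n) : p.2 ≤ n := by
  rw [Finset.HasAntidiagonal.mem_antidiagonal] at hp
  omega

theorem sum_fin_eq_sum_antidiagonal {M : Type*} [AddCommMonoid M] (f : ℕ → ℕ → M) (n : ℕ) :
    ∑ i : Fin (n + 1), f i (n - i) = ∑ p ∈ antidiagonal n, f p.1 p.2 := by
  rw [Finset.Nat.sum_antidiagonal_eq_sum_range_succ f n, Finset.sum_range]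

section

variable {ν β : ℝ} {γ : ℂ}

theorem etaCoeff_zero : etaCoeff β γ 0 = γ := by rw [etaCoeff]

theorem etaCoeff_succ (n : ℕ) : etaCoeff β γ (n + 1) = (if n = 0 then (β : ℂ) ^ 2 else 0) -
    ∑ p ∈ antidiagonal n, etaCoeff β γ p.1 * etaCoeff β γ p.2 := by
  rw [etaCoeff, sum_fin_eq_sum_antidiagonal fun i j => etaCoeff β γ i * etaCoeff β γ j]

theorem coeffU_zero (z : ℂ) : coeffU ν β γ 0 z = wedge (Pi.single 3 1) (vecE β γ) := by
  rw [coeffU]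

theorem coeffU_succ_of_three {n : ℕ} {i k : Fin 5} (h : i = 3 ∨ k = 3) :
    (fun z => coeffU ν β γ (n + 1) z i k) = intF ν fun z => numer ν β γ n z i k := by
  funext z
  rw [coeffU]
  simp only [of_apply, if_pos h]
  congr 1
  funext z
  rw [numer, ← sum_fin_eq_sum_antidiagonal fun i j => muCoeff β γ i • coeffU ν β γ j z]

theorem coeffU_succ_of_ne {n : ℕ} {i k : Fin 5} (h : ¬(i = 3 ∨ k = 3)) :
    (fun z => coeffU ν β γ (n + 1) z i k) = intG ν fun z => numer ν β γ n z i k := by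
  funext z
  rw [coeffU]
  simp only [of_apply, if_neg h]
  congr 1
  funext z
  rw [numer, ← sum_fin_eq_sum_antidiagonal fun i j => muCoeff β γ i • coeffU ν β γ j z]

theorem numer_apply (n : ℕ) (z : ℂ) (i k : Fin 5) :
    numer ν β γ n z i k =
      ∑ j, (opN β γ z i j * coeffU ν β γ n z j k + opN β γ z k j * coeffU ν β γ n z i j) -
      ∑ p ∈ antidiagonal n, muCoeff β γ p.1 * coeffU ν β γ p.2 z i k := by
  simp only [numer, derivTwo, Matrix.sub_apply, Matrix.add_apply, Matrix.mul_apply, transpose_apply,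
    Matrix.sum_apply, Matrix.smul_apply, smul_eq_mul, Finset.sum_add_distrib]
  congr 2
  exact Finset.sum_congr rfl fun j _ => mul_comm _ _

theorem abs_wt_sub_le (i k : Fin 5) : |wt k - wt i| ≤ 1 := by
  revert i k
  decide

theorem isSymbol_opN {c : ℝ} (hA : ∀ i k, ‖coeffA β γ i k‖ ≤ c) (hB : ∀ i k, ‖coeffB β γ i k‖ ≤ c)
    (i k : Fin 5) : IsSymbol (3 * c) (wt i - wt k) (fun z => opN β γ z i k) := by
  have d : ∀ z ∈ unitDisc, HasDerivAt (fun z => opN β γ z i k)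
      (((wt k - wt i : ℤ) : ℂ) * z ^ (wt k - wt i - 1) * (coeffA β γ i k + z * coeffB β γ i k) +
        z ^ (wt k - wt i) * coeffB β γ i k) z := by
    intro z hz
    have z0 : z ≠ 0 := Complex.slitPlane_ne_zero (unitDisc_subset_slitPlane hz)
    have := (hasDerivAt_zpow (wt k - wt i) z (Or.inl z0)).fun_mul
      (((hasDerivAt_id z).mul_const (coeffB β γ i k)).const_add (coeffA β γ i k))
    simpa [opN] using this
  have c0 : 0 ≤ c := (norm_nonneg _).trans (hA 0 0)
  have n1 : ∀ x ∈ Ioc (0 : ℝ) 1, ‖coeffA β γ i k + (x : ℂ) * coeffB β γ i k‖ ≤ 2 * c := by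
    intro x hx
    refine (norm_add_le _ _).trans ?_
    rw [norm_mul, Complex.norm_real, Real.norm_eq_abs, abs_of_pos hx.1]
    have := mul_le_mul hx.2 (hB i k) (norm_nonneg _) zero_le_one
    linarith [hA i k]
  have n2 : ∀ x ∈ Ioc (0 : ℝ) 1, ∀ e : ℤ, ‖(x : ℂ) ^ e‖ = x ^ (e : ℝ) := by
    intro x hx e
    rw [norm_zpow, Complex.norm_real, Real.norm_eq_abs, abs_of_pos hx.1, Real.rpow_intCast]
  have e1 : (((wt k - wt i : ℤ)) : ℝ) = -((wt i : ℝ) - wt k) := by push_cast; ring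
  have e2 : (((wt k - wt i - 1 : ℤ)) : ℝ) = -((wt i : ℝ) - wt k) - 1 := by push_cast; ring
  refine ⟨fun z hz => (d z hz).differentiableAt.differentiableWithinAt, fun x hx => ?_,
    fun x hx => ?_⟩
  · have xp := Real.rpow_pos_of_pos hx.1 (-((wt i : ℝ) - wt k))
    have e : opN β γ x i k = (x : ℂ) ^ (wt k - wt i) * (coeffA β γ i k + x * coeffB β γ i k) := rfl
    rw [e, norm_mul, n2 x hx, e1]
    nlinarith [n1 x hx]
  · rw [(d x (ofReal_mem_unitDisc hx)).deriv]
    refine (norm_add_le _ _).trans ?_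
    rw [norm_mul, norm_mul, norm_mul, n2 x hx, n2 x hx, e1, e2]
    have xp := Real.rpow_pos_of_pos hx.1 (-((wt i : ℝ) - wt k) - 1)
    have xp' := Real.rpow_pos_of_pos hx.1 (-((wt i : ℝ) - wt k))
    have h1 : x ^ (-((wt i : ℝ) - wt k)) ≤ x ^ (-((wt i : ℝ) - wt k) - 1) :=
      Real.rpow_le_rpow_of_exponent_ge hx.1 hx.2 (by linarith)
    have h2 : ‖((wt k - wt i : ℤ) : ℂ)‖ ≤ 1 := by
      rw [Complex.norm_intCast]
      exact_mod_cast abs_wt_sub_le i k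
    have h3 : ‖((wt k - wt i : ℤ) : ℂ)‖ * x ^ (-((wt i : ℝ) - wt k) - 1) *
        ‖coeffA β γ i k + (x : ℂ) * coeffB β γ i k‖ ≤
        1 * x ^ (-((wt i : ℝ) - wt k) - 1) * (2 * c) := by
      have := n1 x hx
      gcongr
    have h4 : x ^ (-((wt i : ℝ) - wt k)) * ‖coeffB β γ i k‖ ≤
        x ^ (-((wt i : ℝ) - wt k) - 1) * c := by
      have := hB i k
      gcongr
    linarith

theorem diffOn_opN (i k : Fin 5) : DifferentiableOn ℂ (fun z => opN β γ z i k) unitDisc := by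
  refine (isSymbol_opN (c := ∑ i, ∑ k, (‖coeffA β γ i k‖ + ‖coeffB β γ i k‖)) (fun i k => ?_)
    (fun i k => ?_) i k).diffOn
  all_goals
    refine le_trans ?_ (Finset.single_le_sum (f := fun i => ∑ k, (‖coeffA β γ i k‖ +
      ‖coeffB β γ i k‖)) (fun _ _ => by positivity) (Finset.mem_univ i))
    refine le_trans ?_ (Finset.single_le_sum (f := fun k => (‖coeffA β γ i k‖ +
      ‖coeffB β γ i k‖)) (fun _ _ => by positivity) (Finset.mem_univ k))
    simp

theorem diffOn_numer_of {n : ℕ}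
    (h : ∀ m ≤ n, ∀ i k, DifferentiableOn ℂ (fun z => coeffU ν β γ m z i k) unitDisc)
    (i k : Fin 5) : DifferentiableOn ℂ (fun z => numer ν β γ n z i k) unitDisc := by
  simp only [numer_apply]
  refine DifferentiableOn.sub (DifferentiableOn.fun_sum fun j _ => DifferentiableOn.add
    ((diffOn_opN i j).mul (h n le_rfl j k)) ((diffOn_opN k j).mul (h n le_rfl i j)))
    (DifferentiableOn.fun_sum fun p hp => (h p.2 ?_ i k).const_mul _)
  exact snd_le_of_mem_antidiagonal hp

theorem diffOn_coeffU (hν : 0 < ν) (n : ℕ) :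
    ∀ i k, DifferentiableOn ℂ (fun z => coeffU ν β γ n z i k) unitDisc := by
  induction n using Nat.strong_induction_on with
  | _ n ih =>
    intro i k
    cases n with
    | zero => simp only [coeffU_zero]; exact differentiableOn_const _
    | succ n =>
      have hn := diffOn_numer_of (fun m hm => ih m (Nat.lt_succ_of_le hm)) i k
      by_cases h : i = 3 ∨ k = 3
      · rw [coeffU_succ_of_three h]
        exact fun z hz => (hasDerivAt_intF hν hn hz).differentiableAt.differentiableWithinAt
      · rw [coeffU_succ_of_ne h]
        exact diffOn_intG hν hn

theorem diffOn_numer (hν : 0 < ν) (n : ℕ) (i k : Fin 5) :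
    DifferentiableOn ℂ (fun z => numer ν β γ n z i k) unitDisc :=
  diffOn_numer_of (fun m _ => diffOn_coeffU hν m) i k

theorem wedge_apply (u v : Fin 5 → ℂ) (i k : Fin 5) : wedge u v i k = u i * v k - v i * u k := by
  simp [wedge, vecMulVec_apply]

theorem transpose_wedge (u v : Fin 5 → ℂ) : (wedge u v)ᵀ = -wedge u v := by
  ext i k
  simp only [transpose_apply, Matrix.neg_apply, wedge_apply]
  ring

theorem prim_neg_of_eqOn {f g : ℂ → ℂ} (hf : DifferentiableOn ℂ f unitDisc)
    (hg : DifferentiableOn ℂ g unitDisc) (h : ∀ z ∈ unitDisc, g z = -f z) {z : ℂ}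
    (hz : z ∈ unitDisc) : prim g z = -prim f z := by
  refine Metric.isOpen_ball.eqOn_of_deriv_eq (convex_ball _ _).isPreconnected (diffOn_prim hg)
    (diffOn_prim hf).neg (fun w hw => ?_) one_mem_unitDisc (by simp [prim_one]) hz
  rw [(hasDerivAt_prim hg hw).deriv, (hasDerivAt_prim hf hw).neg.deriv, h w hw]

theorem dslope_neg_of_eqOn {f g : ℂ → ℂ} (h : ∀ z ∈ unitDisc, g z = -f z) {z : ℂ}
    (hz : z ∈ unitDisc) : dslope g 1 z = -dslope f 1 z := by
  rcases eq_or_ne z 1 with rfl | hne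
  · have : g =ᶠ[𝓝 1] fun z => -f z :=
      (Metric.isOpen_ball.eventually_mem one_mem_unitDisc).mono fun w hw => h w hw
    rw [dslope_same, dslope_same, this.deriv_eq, deriv.fun_neg]
  · rw [dslope_of_ne _ hne, dslope_of_ne _ hne, slope_def_field, slope_def_field, h z hz,
      h 1 one_mem_unitDisc]
    ring

theorem intF_neg_of_eqOn (hν : 0 < ν) {H H' : ℂ → ℂ} (hH : DifferentiableOn ℂ H unitDisc)
    (hH' : DifferentiableOn ℂ H' unitDisc) (h : ∀ z ∈ unitDisc, H' z = -H z) {z : ℂ}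
    (hz : z ∈ unitDisc) : intF ν H' z = -intF ν H z := by
  rw [intF, intF, prim_neg_of_eqOn (diffOn_powFactor_mul hν (diffOn_dslope hH))
    (diffOn_powFactor_mul hν (diffOn_dslope hH')) (fun w hw => ?_) hz]
  rw [dslope_neg_of_eqOn h hw, mul_neg]

theorem intG_neg_of_eqOn (hν : 0 < ν) {H H' : ℂ → ℂ} (hH : DifferentiableOn ℂ H unitDisc)
    (hH' : DifferentiableOn ℂ H' unitDisc) (h : ∀ z ∈ unitDisc, H' z = -H z) {z : ℂ}
    (hz : z ∈ unitDisc) : intG ν H' z = -intG ν H z := by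
  rw [intG, intG, dslope_neg_of_eqOn (fun w hw => prim_neg_of_eqOn (diffOn_powFactor_mul hν hH)
    (diffOn_powFactor_mul hν hH') (fun v hv => ?_) hw) hz]
  rw [h v hv, mul_neg]

theorem transpose_derivTwo (A X : Matrix (Fin 5) (Fin 5) ℂ) (hX : Xᵀ = -X) :
    (derivTwo A X)ᵀ = -derivTwo A X := by
  simp only [derivTwo, transpose_add, transpose_mul, transpose_transpose, hX]
  simp only [neg_mul, mul_neg]
  abel

theorem transpose_coeffU (hν : 0 < ν) (n : ℕ) :
    ∀ z ∈ unitDisc, (coeffU ν β γ n z)ᵀ = -coeffU ν β γ n z := by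
  induction n using Nat.strong_induction_on with
  | _ n ih =>
    cases n with
    | zero => intro z _; rw [coeffU_zero, transpose_wedge]
    | succ n =>
      have hn : ∀ i k, ∀ z ∈ unitDisc, numer ν β γ n z k i = -numer ν β γ n z i k := by
        intro i k z hz
        have e : (numer ν β γ n z)ᵀ = -numer ν β γ n z := by
          have hs : ∀ p ∈ antidiagonal n, (coeffU ν β γ p.2 z)ᵀ = -coeffU ν β γ p.2 z :=
            fun p hp => ih p.2 (Nat.lt_succ_of_le (snd_le_of_mem_antidiagonal hp)) z hz
          rw [numer, transpose_sub, transpose_derivTwo _ _ (ih n n.lt_succ_self z hz),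
            transpose_sum]
          simp only [transpose_smul]
          rw [Finset.sum_congr rfl fun p hp => by rw [hs p hp, smul_neg], Finset.sum_neg_distrib]
          abel
        exact congrFun (congrFun e i) k
      intro z hz
      ext i k
      have dn := diffOn_numer (β := β) (γ := γ) hν n
      rw [transpose_apply, Matrix.neg_apply]
      by_cases h : i = 3 ∨ k = 3
      · exact (congrFun (coeffU_succ_of_three h.symm) z).trans
          ((intF_neg_of_eqOn hν (dn i k) (dn k i) (hn i k) hz).trans
            (congrArg Neg.neg (congrFun (coeffU_succ_of_three h) z).symm))
      · exact (congrFun (coeffU_succ_of_ne fun h' => h h'.symm) z).trans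
          ((intG_neg_of_eqOn hν (dn i k) (dn k i) (hn i k) hz).trans
            (congrArg Neg.neg (congrFun (coeffU_succ_of_ne h) z).symm))

end

/-! ### The values at `ξ = 1` -/

/-- The Taylor coefficients in `α` of the eigenvector of `α N(1) - e₄₄` for `λ₋(1)` whose fourth
coordinate is `1`. -/
def vecHat (β : ℝ) (γ : ℂ) : ℕ → Fin 5 → ℂ
  | 0 => Pi.single 3 1
  | n + 1 => -(opN β γ 1 *ᵥ vecHat β γ n +
      ∑ i : Fin (n + 1), etaCoeff β γ i • vecHat β γ (n - i))
decreasing_by all_goals omega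

section

variable {ν β : ℝ} {γ : ℂ}

theorem vecHat_zero : vecHat β γ 0 = Pi.single 3 1 := by rw [vecHat]

theorem vecHat_succ (n : ℕ) : vecHat β γ (n + 1) = -(opN β γ 1 *ᵥ vecHat β γ n +
    ∑ p ∈ antidiagonal n, etaCoeff β γ p.1 • vecHat β γ p.2) := by
  rw [vecHat, sum_fin_eq_sum_antidiagonal fun i j => etaCoeff β γ i • vecHat β γ j]

theorem opN_one : opN β γ 1 = coeffA β γ + coeffB β γ := by
  ext i k
  simp [opN]

theorem opN_one_mulVec_vecE (hβ : 0 < β) : opN β γ 1 *ᵥ vecE β γ = -(β : ℂ) • vecE β γ := by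
  have : (β : ℂ) ≠ 0 := by exact_mod_cast hβ.ne'
  rw [opN_one]
  ext i
  fin_cases i <;>
    simp [coeffA, coeffB, vecE, Matrix.mulVec, dotProduct, Fin.sum_univ_succ] <;>
    field_simp <;> ring

theorem sum_antidiagonal_mul_ite (g : ℕ → ℂ) (c : ℂ) (n : ℕ) :
    ∑ p ∈ antidiagonal n, g p.1 * (if p.2 = 0 then c else 0) = g n * c := by
  rw [Finset.sum_eq_single (n, 0)]
  · simp
  · rintro ⟨a, b⟩ hab hne
    have hab' : a + b = n := by simpa using hab
    have : b ≠ 0 := by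
      rintro rfl
      exact hne (by simp at hab'; simp [hab'])
    simp [this]
  · intro h
    simp at h

theorem sum_antidiagonal_ite_mul (g : ℕ → ℂ) (c : ℂ) (n : ℕ) :
    ∑ p ∈ antidiagonal n, (if p.1 = 0 then c else 0) * g p.2 = c * g n := by
  rw [Finset.sum_eq_single (0, n)]
  · simp
  · rintro ⟨a, b⟩ hab hne
    have hab' : a + b = n := by simpa using hab
    have : a ≠ 0 := by
      rintro rfl
      exact hne (by simp at hab'; simp [hab'])
    simp [this]
  · intro h
    simp at h

/-- The normalization of the eigenvector is consistent: the fourth row of the eigenvector equation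
determines the coefficients `ηₙ`, and they satisfy the recursion of `etaCoeff`. -/
theorem vecHat_three_and_eta (hβ : 0 < β) (n : ℕ) :
    vecHat β γ n 3 = (if n = 0 then 1 else 0) ∧
      etaCoeff β γ n = β * (vecHat β γ n 0 - vecHat β γ n 4) + (if n = 0 then γ else 0) := by
  have hβ' : (β : ℂ) ≠ 0 := by exact_mod_cast hβ.ne'
  induction n using Nat.strong_induction_on with
  | _ n ih =>
    cases n with
    | zero => simp [vecHat_zero, etaCoeff_zero]
    | succ n =>
      have lt : ∀ p ∈ antidiagonal n, p.2 < n + 1 := fun p hp =>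
        Nat.lt_succ_of_le (snd_le_of_mem_antidiagonal hp)
      have s3 : ∑ p ∈ antidiagonal n, etaCoeff β γ p.1 * vecHat β γ p.2 3 =
          etaCoeff β γ n := by
        rw [← mul_one (etaCoeff β γ n), ← sum_antidiagonal_mul_ite (etaCoeff β γ) 1 n]
        exact Finset.sum_congr rfl fun p hp => by rw [(ih p.2 (lt p hp)).1]
      have s4 : ∑ p ∈ antidiagonal n, etaCoeff β γ p.1 *
          (β * (vecHat β γ p.2 0 - vecHat β γ p.2 4)) =
          ∑ p ∈ antidiagonal n, etaCoeff β γ p.1 * etaCoeff β γ p.2 -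
            etaCoeff β γ n * γ := by
        rw [← sum_antidiagonal_mul_ite (etaCoeff β γ) γ n, ← Finset.sum_sub_distrib]
        refine Finset.sum_congr rfl fun p hp => ?_
        rw [(ih p.2 (lt p hp)).2]
        ring
      have s5 : ∑ p ∈ antidiagonal n, etaCoeff β γ p.1 *
          (β * (vecHat β γ p.2 0 - vecHat β γ p.2 4)) = β *
          (∑ p ∈ antidiagonal n, etaCoeff β γ p.1 * vecHat β γ p.2 0 -
          ∑ p ∈ antidiagonal n, etaCoeff β γ p.1 * vecHat β γ p.2 4) := by
        rw [← Finset.sum_sub_distrib, Finset.mul_sum]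
        exact Finset.sum_congr rfl fun p _ => by ring
      obtain ⟨h1, h2⟩ := ih n n.lt_succ_self
      have row : ∀ i, vecHat β γ (n + 1) i = -((opN β γ 1 *ᵥ vecHat β γ n) i +
          ∑ p ∈ antidiagonal n, etaCoeff β γ p.1 * vecHat β γ p.2 i) := fun i => by
        rw [vecHat_succ]; simp
      have r3 : (opN β γ 1 *ᵥ vecHat β γ n) 3 = -β * (vecHat β γ n 0 - vecHat β γ n 4) -
          γ * vecHat β γ n 3 := by
        rw [opN_one]
        simp [coeffA, coeffB, Matrix.mulVec, dotProduct, Fin.sum_univ_succ]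
        ring
      have r04 : β * ((opN β γ 1 *ᵥ vecHat β γ n) 0 - (opN β γ 1 *ᵥ vecHat β γ n) 4) =
          γ * (β * (vecHat β γ n 0 - vecHat β γ n 4)) + (γ ^ 2 - β ^ 2) * vecHat β γ n 3 := by
        rw [opN_one]
        simp [coeffA, coeffB, Matrix.mulVec, dotProduct, Fin.sum_univ_succ]
        field_simp
        ring
      refine ⟨?_, ?_⟩
      · rw [row 3, s3, r3, h1, h2]
        rcases n with _ | n <;> simp
      · rw [row 0, row 4, etaCoeff_succ]
        have e := s5.symm.trans s4
        have hd : β * (vecHat β γ n 0 - vecHat β γ n 4) =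
          etaCoeff β γ n - (if n = 0 then γ else 0) := by rw [h2]; ring
        rw [hd, h1] at r04
        rcases n with _ | n
        · simp at r04 e ⊢
          linear_combination r04 + e
        · simp at r04 e ⊢
          linear_combination r04 + e

/-- At `ξ = 1` the coefficients `Uⱼ` are those of `V ∧ E_{a,-}(1)`, with `V` the eigenvector
series. As the fourth coordinates of `E_{a,-}(1)` and of `vecHat β γ (n + 1)` vanish, the
right-hand sides of the equations of the entries with an index `4` vanish there. -/
theorem coeffU_one_and_numer_one (hν : 0 < ν) (hβ : 0 < β) (n : ℕ) :
    coeffU ν β γ n 1 = wedge (vecHat β γ n) (vecE β γ) ∧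
      numer ν β γ n 1 = -wedge (vecHat β γ (n + 1)) (vecE β γ) := by
  induction n using Nat.strong_induction_on with
  | _ n ih =>
    have hU : coeffU ν β γ n 1 = wedge (vecHat β γ n) (vecE β γ) := by
      cases n with
      | zero => rw [coeffU_zero, vecHat_zero]
      | succ n =>
        ext i k
        have e := (ih n n.lt_succ_self).2
        have h3 := (vecHat_three_and_eta (γ := γ) hβ (n + 1)).1
        by_cases h : i = 3 ∨ k = 3
        · have := congrFun (coeffU_succ_of_three (ν := ν) (β := β) (γ := γ) (n := n) h) 1
          rw [intF_one] at this
          rw [this, wedge_apply]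
          rcases h with rfl | rfl <;> simp [h3, vecE]
        · have := congrFun (coeffU_succ_of_ne (ν := ν) (β := β) (γ := γ) (n := n) h) 1
          rw [intG_one hν (diffOn_numer hν n i k), e] at this
          simpa using this
    refine ⟨hU, ?_⟩
    have hs : ∑ p ∈ antidiagonal n, muCoeff β γ p.1 • coeffU ν β γ p.2 1 =
        -wedge ((β : ℂ) • vecHat β γ n +
          ∑ p ∈ antidiagonal n, etaCoeff β γ p.1 • vecHat β γ p.2) (vecE β γ) := by
      have hU' : ∀ p ∈ antidiagonal n, muCoeff β γ p.1 • coeffU ν β γ p.2 1 =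
          muCoeff β γ p.1 • wedge (vecHat β γ p.2) (vecE β γ) := by
        intro p hp
        rcases (snd_le_of_mem_antidiagonal hp).lt_or_eq with h | h
        · rw [(ih p.2 h).1]
        · rw [h, hU]
      rw [Finset.sum_congr rfl hU']
      ext i k
      simp only [Matrix.sum_apply, Matrix.smul_apply, smul_eq_mul, Matrix.neg_apply, wedge_apply,
        Pi.add_apply, Pi.smul_apply, Finset.sum_apply]
      have s : ∀ i, ∑ p ∈ antidiagonal n, muCoeff β γ p.1 * vecHat β γ p.2 i =
          -(β * vecHat β γ n i + ∑ p ∈ antidiagonal n, etaCoeff β γ p.1 * vecHat β γ p.2 i)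
          := by
        intro i
        simp only [muCoeff, sub_mul, Finset.sum_sub_distrib]
        rw [sum_antidiagonal_ite_mul (fun m => vecHat β γ m i)]
        ring
      have e : ∑ p ∈ antidiagonal n, muCoeff β γ p.1 *
          (vecHat β γ p.2 i * vecE β γ k - vecE β γ i * vecHat β γ p.2 k) =
          (∑ p ∈ antidiagonal n, muCoeff β γ p.1 * vecHat β γ p.2 i) * vecE β γ k -
          vecE β γ i * ∑ p ∈ antidiagonal n, muCoeff β γ p.1 * vecHat β γ p.2 k := by
        rw [Finset.sum_mul, Finset.mul_sum, ← Finset.sum_sub_distrib]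
        exact Finset.sum_congr rfl fun p _ => by ring
      rw [e, s i, s k]
      ring
    rw [numer, hU, derivTwo_wedge, hs, opN_one_mulVec_vecE hβ, vecHat_succ]
    ext i k
    simp only [Matrix.add_apply, Matrix.sub_apply, Matrix.neg_apply, wedge_apply, Pi.add_apply,
      Pi.smul_apply, Pi.neg_apply, smul_eq_mul]
    ring

end

/-! ### Growth of the coefficients -/

theorem catalan_le_four_pow (n : ℕ) : catalan n ≤ 4 ^ n := by
  rw [catalan_eq_centralBinom_div]
  exact (Nat.div_le_self _ _).trans (Nat.centralBinom_le_four_pow n)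

section

variable {ν β : ℝ} {γ : ℂ}

/-- The recursion of the `ηₙ` is dominated by that of the Catalan numbers. -/
theorem norm_etaCoeff_le_catalan {c : ℝ} (hβ : 0 < β) (hc : β + ‖γ‖ ≤ c) (n : ℕ) :
    ‖etaCoeff β γ n‖ ≤ c ^ (n + 1) * catalan n := by
  have c0 : 0 ≤ c := by linarith [norm_nonneg γ]
  induction n using Nat.strong_induction_on with
  | _ n ih =>
    cases n with
    | zero => simpa [etaCoeff_zero] using by linarith
    | succ n =>
      have hs : ‖∑ p ∈ antidiagonal n, etaCoeff β γ p.1 * etaCoeff β γ p.2‖ ≤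
          c ^ (n + 2) * catalan (n + 1) := by
        rw [catalan_succ', Nat.cast_sum, Finset.mul_sum]
        refine norm_sum_le_of_le _ fun p hp => ?_
        have hp' := Finset.HasAntidiagonal.mem_antidiagonal.1 hp
        have h1 := ih p.1 (by omega)
        have h2 := ih p.2 (by omega)
        rw [norm_mul]
        refine (mul_le_mul h1 h2 (norm_nonneg _) (by positivity)).trans_eq ?_
        rw [← hp']
        push_cast
        ring
      rw [etaCoeff_succ]
      rcases n with _ | n
      · have : ‖(β : ℂ) ^ 2 - γ * γ‖ ≤ β ^ 2 + ‖γ‖ ^ 2 := by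
          refine (norm_sub_le _ _).trans_eq ?_
          rw [norm_pow, norm_mul, Complex.norm_real, Real.norm_eq_abs, sq_abs]
          ring
        have h2 : (β + ‖γ‖) ^ 2 ≤ c ^ 2 := by gcongr
        simp [etaCoeff_zero] at this ⊢
        nlinarith [norm_nonneg γ, mul_nonneg hβ.le (norm_nonneg γ)]
      · simpa using hs

theorem norm_etaCoeff_le {c : ℝ} (hβ : 0 < β) (hc : β + ‖γ‖ ≤ c) (n : ℕ) :
    ‖etaCoeff β γ n‖ ≤ c * (4 * c) ^ n := by
  have c0 : 0 ≤ c := by linarith [norm_nonneg γ]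
  refine (norm_etaCoeff_le_catalan hβ hc n).trans ?_
  have : (catalan n : ℝ) ≤ 4 ^ n := by exact_mod_cast catalan_le_four_pow n
  calc c ^ (n + 1) * catalan n ≤ c ^ (n + 1) * 4 ^ n := by gcongr
    _ = _ := by rw [mul_pow]; ring

theorem norm_muCoeff_le {c : ℝ} (hβ : 0 < β) (hc : β + ‖γ‖ ≤ c) (n : ℕ) :
    ‖muCoeff β γ n‖ ≤ 2 * c * (4 * c) ^ n := by
  have c0 : 0 ≤ c := by linarith [norm_nonneg γ]
  have h := norm_etaCoeff_le hβ hc n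
  have h1 : ‖(if n = 0 then -(β : ℂ) else 0)‖ ≤ c * (4 * c) ^ n := by
    split_ifs with hn
    · subst hn
      simp [abs_of_pos hβ]
      linarith [norm_nonneg γ]
    · simpa using by positivity
  refine (norm_sub_le _ _).trans ?_
  linarith

/-- The exponent of the bound of the entry `(i, k)` of the `n`-th coefficient. -/
def expo (ν : ℝ) (n : ℕ) (i k : Fin 5) : ℝ := ν * n + (wt i + wt k)

theorem wt_nonneg (i : Fin 5) : (0 : ℝ) ≤ wt i := by
  have : 0 ≤ wt i := by revert i; decide
  exact_mod_cast this

theorem expo_nonneg (hν : 0 < ν) (n : ℕ) (i k : Fin 5) : 0 ≤ expo ν n i k := by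
  have := wt_nonneg i
  have := wt_nonneg k
  unfold expo
  positivity

theorem expo_succ (n : ℕ) (i k : Fin 5) : expo ν (n + 1) i k = expo ν n i k + ν := by
  unfold expo
  push_cast
  ring

theorem expo_mono (hν : 0 < ν) {m n : ℕ} (h : m ≤ n) (i k : Fin 5) :
    expo ν m i k ≤ expo ν n i k := by
  unfold expo
  have : (m : ℝ) ≤ n := by exact_mod_cast h
  gcongr

theorem sum_geometric_le {ρ L : ℝ} (hρ : 0 ≤ ρ) (hL : 2 * ρ ≤ L) (n : ℕ) :
    ∑ p ∈ antidiagonal n, ρ ^ p.1 * L ^ p.2 ≤ 2 * L ^ n := by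
  rw [Finset.Nat.sum_antidiagonal_eq_sum_range_succ (fun i j => ρ ^ i * L ^ j)]
  have L0 : 0 ≤ L := by linarith
  have h : ∀ i ∈ Finset.range n.succ, ρ ^ i * L ^ (n - i) ≤ (1 / 2) ^ i * L ^ n := by
    intro i hi
    have hi' : i ≤ n := Nat.lt_succ_iff.1 (Finset.mem_range.1 hi)
    calc ρ ^ i * L ^ (n - i) ≤ (1 / 2 * L) ^ i * L ^ (n - i) := by gcongr; linarith
      _ = (1 / 2) ^ i * (L ^ i * L ^ (n - i)) := by rw [mul_pow]; ring
      _ = _ := by rw [← pow_add, Nat.add_sub_cancel' hi']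
  refine (Finset.sum_le_sum h).trans ?_
  rw [← Finset.sum_mul]
  have := sum_geometric_two_le n.succ
  gcongr

/-- Geometric growth of the numerators, given that of the coefficients. -/
theorem isSymbol_numer {c A L : ℝ} (hν : 0 < ν) (hβ : 0 < β) (hc : β + ‖γ‖ ≤ c)
    (hA : ∀ i k, ‖coeffA β γ i k‖ ≤ c) (hB : ∀ i k, ‖coeffB β γ i k‖ ≤ c) (hA0 : 0 ≤ A)
    (hL : 8 * c ≤ L) {n : ℕ}
    (h : ∀ m ≤ n, ∀ i k,
      IsSymbol (A * L ^ m) (expo ν m i k) (fun z => coeffU ν β γ m z i k)) (i k : Fin 5) :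
    IsSymbol (64 * c * (A * L ^ n)) (expo ν n i k) (fun z => numer ν β γ n z i k) := by
  have c0 : 0 ≤ c := by linarith [norm_nonneg γ]
  have L0 : 0 ≤ L := by linarith
  have h1 : ∀ j ∈ (Finset.univ : Finset (Fin 5)), IsSymbol (12 * c * (A * L ^ n)) (expo ν n i k)
      (fun z => opN β γ z i j * coeffU ν β γ n z j k + opN β γ z k j * coeffU ν β γ n z i j) := by
    intro j _
    have a := (isSymbol_opN hA hB i j).mul (h n le_rfl j k)
    have b := (isSymbol_opN hA hB k j).mul (h n le_rfl i j)
    have ea : (wt i : ℝ) - wt j + expo ν n j k = expo ν n i k := by unfold expo; ring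
    have eb : (wt k : ℝ) - wt j + expo ν n i j = expo ν n i k := by unfold expo; ring
    rw [ea] at a
    rw [eb] at b
    exact (a.add b).mono (by linarith) le_rfl
  have h2 : ∀ p ∈ antidiagonal n, IsSymbol (2 * c * A * ((4 * c) ^ p.1 * L ^ p.2)) (expo ν n i k)
      (fun z => -(muCoeff β γ p.1 * coeffU ν β γ p.2 z i k)) := by
    intro p hp
    have hp' := snd_le_of_mem_antidiagonal hp
    refine (((h p.2 hp' i k).const_mul (muCoeff β γ p.1)).neg).mono ?_ (expo_mono hν hp' i k)
    have := norm_muCoeff_le hβ hc p.1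
    calc _ ≤ 2 * c * (4 * c) ^ p.1 * (A * L ^ p.2) := by gcongr
      _ = _ := by ring
  have h3 := (IsSymbol.sum _ h1).add (IsSymbol.sum _ h2)
  simp only [Finset.sum_neg_distrib, ← sub_eq_add_neg] at h3
  have e : (fun z => numer ν β γ n z i k) = _ := funext fun z => numer_apply n z i k
  rw [e]
  refine h3.mono ?_ le_rfl
  rw [Finset.sum_const, Finset.card_univ, Fintype.card_fin, ← Finset.mul_sum]
  have g := mul_le_mul_of_nonneg_left
    (sum_geometric_le (ρ := 4 * c) (L := L) (by positivity) (by linarith) n)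
    (by positivity : 0 ≤ 2 * c * A)
  simp only [nsmul_eq_mul]
  push_cast
  linarith

theorem numer_one_eq_zero (hν : 0 < ν) (hβ : 0 < β) (n : ℕ) {i k : Fin 5} (h : i = 3 ∨ k = 3) :
    numer ν β γ n 1 i k = 0 := by
  have h3 := (vecHat_three_and_eta (γ := γ) hβ (n + 1)).1
  rw [(coeffU_one_and_numer_one hν hβ n).2, Matrix.neg_apply, wedge_apply]
  rcases h with rfl | rfl <;> simp [h3, vecE]

theorem isSymbol_coeffU {c A L : ℝ} (hν : 0 < ν) (hβ : 0 < β) (hc : β + ‖γ‖ ≤ c)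
    (hA : ∀ i k, ‖coeffA β γ i k‖ ≤ c) (hB : ∀ i k, ‖coeffB β γ i k‖ ≤ c)
    (hE : ∀ i k, ‖wedge (Pi.single 3 1) (vecE β γ) i k‖ ≤ A)
    (hL : 8 * c ≤ L) (hL' : stepConst ν * (64 * c) ≤ L) (n : ℕ) :
    ∀ i k, IsSymbol (A * L ^ n) (expo ν n i k) (fun z => coeffU ν β γ n z i k) := by
  have c0 : 0 ≤ c := by linarith [norm_nonneg γ]
  have L0 : 0 ≤ L := by linarith
  have A0 : 0 ≤ A := (norm_nonneg _).trans (hE 0 0)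
  induction n using Nat.strong_induction_on with
  | _ n ih =>
    intro i k
    cases n with
    | zero =>
      simp only [coeffU_zero, pow_zero, mul_one]
      exact IsSymbol.const (hE i k) (expo_nonneg hν 0 i k)
    | succ n =>
      have hn := isSymbol_numer hν hβ hc hA hB A0 hL (fun m hm => ih m (Nat.lt_succ_of_le hm)) i k
      have le : stepConst ν * (64 * c * (A * L ^ n)) ≤ A * L ^ (n + 1) := by
        have := mul_le_mul_of_nonneg_right hL' (by positivity : 0 ≤ A * L ^ n)
        calc _ = stepConst ν * (64 * c) * (A * L ^ n) := by ring
          _ ≤ L * (A * L ^ n) := this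
          _ = _ := by ring
      rw [expo_succ]
      by_cases h : i = 3 ∨ k = 3
      · rw [coeffU_succ_of_three h]
        exact (isSymbol_intF hν (expo_nonneg hν n i k) hn (numer_one_eq_zero hν hβ n h)).mono le
          le_rfl
      · rw [coeffU_succ_of_ne h]
        exact (isSymbol_intG hν (expo_nonneg hν n i k) hn).mono le le_rfl

theorem norm_coeffU_three_le {c A L : ℝ} (hν : 0 < ν) (hβ : 0 < β) (hc : β + ‖γ‖ ≤ c)
    (hA : ∀ i k, ‖coeffA β γ i k‖ ≤ c) (hB : ∀ i k, ‖coeffB β γ i k‖ ≤ c)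
    (hE : ∀ i k, ‖wedge (Pi.single 3 1) (vecE β γ) i k‖ ≤ A)
    (hL : 8 * c ≤ L) (hL' : stepConst ν * (64 * c) ≤ L) (n : ℕ) {i k : Fin 5}
    (h : i = 3 ∨ k = 3) {x : ℝ} (hx : x ∈ Ioc (0 : ℝ) 1) :
    ‖coeffU ν β γ (n + 1) x i k‖ ≤ A * L ^ (n + 1) * ((1 - x) * x ^ (-expo ν (n + 1) i k)) := by
  have c0 : 0 ≤ c := by linarith [norm_nonneg γ]
  have L0 : 0 ≤ L := by linarith
  have A0 : 0 ≤ A := (norm_nonneg _).trans (hE 0 0)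
  have hn := isSymbol_numer hν hβ hc hA hB A0 hL
    (fun m _ => isSymbol_coeffU hν hβ hc hA hB hE hL hL' m) (n := n) i k
  have h1 := norm_intF_le hν (expo_nonneg hν n i k) hn (numer_one_eq_zero hν hβ n h) hx
  have e : coeffU ν β γ (n + 1) x i k = intF ν (fun z => numer ν β γ n z i k) x :=
    congrFun (coeffU_succ_of_three h) x
  have xp := Real.rpow_pos_of_pos hx.1 (-expo ν (n + 1) i k)
  have x1 : 0 ≤ 1 - x := by linarith [hx.2]
  rw [e]
  rw [← expo_succ] at h1
  refine h1.trans (mul_le_mul_of_nonneg_right ?_ (by positivity))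
  refine (le_stepConst hν hn.nonneg).trans ?_
  have := mul_le_mul_of_nonneg_right hL' (by positivity : 0 ≤ A * L ^ n)
  calc _ = stepConst ν * (64 * c) * (A * L ^ n) := by ring
    _ ≤ L * (A * L ^ n) := this
    _ = _ := by ring

/-- The differential equation of the coefficients. -/
theorem coeffU_ode (hν : 0 < ν) (hβ : 0 < β) (n : ℕ) (i k : Fin 5) {x : ℝ}
    (hx : x ∈ Ioc (0 : ℝ) 1) :
    ((x ^ (ν + 1) : ℝ) : ℂ) * ((1 - x) * deriv (fun z => coeffU ν β γ (n + 1) z i k) x) =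
      numer ν β γ n x i k +
        if i = 3 ∨ k = 3 then 0 else ((x ^ (ν + 1) : ℝ) : ℂ) * coeffU ν β γ (n + 1) x i k := by
  have dn := diffOn_numer (β := β) (γ := γ) hν n i k
  split_ifs with h
  · rw [coeffU_succ_of_three h, intF_ode hν dn (numer_one_eq_zero hν hβ n h) hx, add_zero]
  · have e : coeffU ν β γ (n + 1) x i k = intG ν (fun z => numer ν β γ n z i k) x :=
      congrFun (coeffU_succ_of_ne h) x
    rw [coeffU_succ_of_ne h, intG_ode hν dn hx, e]

end

/-! ### The coefficients of the expansion and their estimates -/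

/-- Constants for which `Uⱼ` is of size `A Lʲ`: `c` bounds the parameters and the coefficients of
`N`, `A` bounds `U₀`, and `L` is larger than the factor that is lost in each step of the
recursion. -/
structure ParamBound (ν β : ℝ) (γ : ℂ) (c A L : ℝ) : Prop where
  pos : 0 < β
  le : β + ‖γ‖ ≤ c
  coeffA_le : ∀ i k, ‖coeffA β γ i k‖ ≤ c
  coeffB_le : ∀ i k, ‖coeffB β γ i k‖ ≤ c
  wedge_le : ∀ i k, ‖wedge (Pi.single 3 1) (vecE β γ) i k‖ ≤ A
  le_ratio : 16 * c ≤ L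
  le_ratio' : stepConst ν * (64 * c) ≤ L

theorem continuousOn_coeff {K : Set (ℝ × ℂ)} (hK : ∀ p ∈ K, 0 < p.1) (i k : Fin 5) :
    ContinuousOn (fun p : ℝ × ℂ => coeffA p.1 p.2 i k) K ∧
      ContinuousOn (fun p : ℝ × ℂ => coeffB p.1 p.2 i k) K ∧
      ContinuousOn (fun p : ℝ × ℂ => wedge (Pi.single 3 1) (vecE p.1 p.2) i k) K := by
  have ne : ∀ p ∈ K, (p.1 : ℂ) ≠ 0 := fun p hp => by exact_mod_cast (hK p hp).ne'
  refine ⟨?_, ?_, ?_⟩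
  · fin_cases i <;> fin_cases k <;> simp [coeffA] <;> fun_prop (disch := assumption)
  · fin_cases i <;> fin_cases k <;> simp [coeffB] <;> fun_prop (disch := assumption)
  · have h : ∀ i, ContinuousOn (fun p : ℝ × ℂ => vecE p.1 p.2 i) K := by
      intro i
      fin_cases i <;> simp [vecE] <;> fun_prop
    simp only [wedge_apply]
    exact (continuousOn_const.mul (h k)).sub ((h i).mul continuousOn_const)

theorem exists_paramBound (ν : ℝ) {K : Set (ℝ × ℂ)} (hKc : IsCompact K)
    (hK : ∀ p ∈ K, 0 < p.1) :
    ∃ c A L : ℝ, 0 ≤ c ∧ 0 ≤ A ∧ 0 < L ∧ ∀ β γ, (β, γ) ∈ K → ParamBound ν β γ c A L := by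
  have bdd : ∀ f : ℝ × ℂ → ℂ, ContinuousOn f K → ∃ C, 0 ≤ C ∧ ∀ p ∈ K, ‖f p‖ ≤ C := by
    intro f hf
    obtain ⟨C, hC⟩ := hKc.exists_bound_of_continuousOn hf
    exact ⟨max C 0, le_max_right _ _, fun p hp => (hC p hp).trans (le_max_left _ _)⟩
  choose CA hA0 hA using fun i k => bdd _ (continuousOn_coeff hK i k).1
  choose CB hB0 hB using fun i k => bdd _ (continuousOn_coeff hK i k).2.1
  choose CE hE0 hE using fun i k => bdd _ (continuousOn_coeff hK i k).2.2
  obtain ⟨C1, h10, h1⟩ := bdd (fun p => (p.1 : ℂ)) (by fun_prop)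
  obtain ⟨C2, h20, h2⟩ := bdd (fun p => p.2) (by fun_prop)
  have single : ∀ C : Fin 5 → Fin 5 → ℝ, (∀ i k, 0 ≤ C i k) → ∀ i k, C i k ≤ ∑ i, ∑ k, C i k :=
    fun C h i k =>
      (Finset.single_le_sum (f := fun k => C i k) (fun k _ => h i k) (Finset.mem_univ k)).trans
      (Finset.single_le_sum (f := fun i => ∑ k, C i k)
        (fun i _ => Finset.sum_nonneg fun k _ => h i k) (Finset.mem_univ i))
  have sA : 0 ≤ ∑ i, ∑ k, CA i k :=
    Finset.sum_nonneg fun i _ => Finset.sum_nonneg fun k _ => hA0 i k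
  have sB : 0 ≤ ∑ i, ∑ k, CB i k :=
    Finset.sum_nonneg fun i _ => Finset.sum_nonneg fun k _ => hB0 i k
  have sE : 0 ≤ ∑ i, ∑ k, CE i k :=
    Finset.sum_nonneg fun i _ => Finset.sum_nonneg fun k _ => hE0 i k
  set c := C1 + C2 + ∑ i, ∑ k, CA i k + ∑ i, ∑ k, CB i k with hc
  refine ⟨c, ∑ i, ∑ k, CE i k, max (16 * c) (stepConst ν * (64 * c)) + 1, by linarith, sE, ?_, ?_⟩
  · have := le_max_left (16 * c) (stepConst ν * (64 * c))
    linarith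
  · intro β γ hp
    have p0 : 0 < β := hK _ hp
    refine ⟨p0, ?_, fun i k => ?_, fun i k => ?_, fun i k => ?_, ?_, ?_⟩
    · have a := h1 _ hp
      have b := h2 _ hp
      simp only [Complex.norm_real, Real.norm_eq_abs, abs_of_pos p0] at a b
      linarith
    · have a := hA i k _ hp
      have := single CA hA0 i k
      simp only at a
      linarith
    · have a := hB i k _ hp
      have := single CB hB0 i k
      simp only at a
      linarith
    · exact (hE i k _ hp).trans (single CE hE0 i k)
    · have := le_max_left (16 * c) (stepConst ν * (64 * c))
      linarith
    · have := le_max_right (16 * c) (stepConst ν * (64 * c))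
      linarith

theorem ParamBound.nonneg {ν β c A L : ℝ} {γ : ℂ} (h : ParamBound ν β γ c A L) : 0 ≤ c := by
  linarith [norm_nonneg γ, h.le, h.pos]

theorem ParamBound.isSymbol {ν β c A L : ℝ} {γ : ℂ} (h : ParamBound ν β γ c A L) (hν : 0 < ν)
    (n : ℕ) (i k : Fin 5) :
    IsSymbol (A * L ^ n) (expo ν n i k) (fun z => coeffU ν β γ n z i k) :=
  isSymbol_coeffU hν h.pos h.le h.coeffA_le h.coeffB_le h.wedge_le
    (by linarith [h.le_ratio, h.nonneg]) h.le_ratio' n i k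

/-- The coefficient `a_{k,j}`, which makes the `j`-th term of the expansion equal to `αʲ
(Uⱼ)_{i4}` or `αʲ (Uⱼ)_{4i}`. -/
def coeffFnA (ν : ℝ) (k : Fin 4) (j : ℕ) (β : ℝ) (γ : ℂ) (x : ℝ) : ℂ :=
  ((x ^ (ν * j + deltaExp k) : ℝ) : ℂ) * coeffU ν β γ j x (fIdx k).1 (fIdx k).2

/-- The coefficient `b_{l,j}`, which makes the `j`-th term of the expansion equal to
`αʲ (1 - ξ) (Uⱼ)_{ik}`. -/
def coeffFnB (ν : ℝ) (l : Fin 6) (j : ℕ) (β : ℝ) (γ : ℂ) (x : ℝ) : ℂ :=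
  ((x ^ (ν * j + dExp l) : ℝ) : ℂ) * ((1 - (x : ℂ)) * coeffU ν β γ j x (gIdx l).1 (gIdx l).2)

theorem fIdx_three (k : Fin 4) : (fIdx k).1 = 3 ∨ (fIdx k).2 = 3 := by
  revert k; decide

theorem gIdx_ne_three (l : Fin 6) : ¬((gIdx l).1 = 3 ∨ (gIdx l).2 = 3) := by
  revert l; decide

theorem expo_fIdx (ν : ℝ) (j : ℕ) (k : Fin 4) :
    expo ν j (fIdx k).1 (fIdx k).2 = ν * j + deltaExp k := by
  fin_cases k <;> simp [expo, fIdx, deltaExp, wt]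

theorem expo_gIdx (ν : ℝ) (j : ℕ) (l : Fin 6) :
    expo ν j (gIdx l).1 (gIdx l).2 = ν * j + dExp l := by
  have h0 : wt 0 = 0 := rfl
  have h1 : wt 1 = 1 := rfl
  have h2 : wt 2 = 1 := rfl
  have h4 : wt 4 = 1 := rfl
  fin_cases l <;> norm_num [expo, gIdx, dExp, h0, h1, h2, h4]

theorem coeffBound_of_hasDerivAt {ν R e : ℝ} {j : ℕ} {u : ℂ → ℂ} {u' : ℂ} {x : ℝ}
    (hx : x ∈ Ioc (0 : ℝ) 1) (hu : HasDerivAt u u' x)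
    (h : ‖u x‖ ≤ R ^ j * ((1 - x) * x ^ (-(ν * j + e))))
    (h' : ‖u'‖ ≤ R ^ j * x ^ (-(ν * j + e) - 1)) :
    CoeffBound ν R e j (fun t : ℝ => ((t ^ (ν * j + e) : ℝ) : ℂ) * u t) x := by
  have xp := Real.rpow_pos_of_pos hx.1 (ν * j + e)
  refine ⟨?_, u', ?_, ?_⟩
  · rw [norm_mul, Complex.norm_real, Real.norm_eq_abs, abs_of_pos xp]
    calc _ ≤ x ^ (ν * j + e) * (R ^ j * ((1 - x) * x ^ (-(ν * j + e)))) := by gcongr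
      _ = R ^ j * (1 - x) * (x ^ (ν * j + e) * x ^ (-(ν * j + e))) := by ring
      _ = _ := by rw [← Real.rpow_add hx.1]; simp
  · refine (hu.comp_ofReal.hasDerivWithinAt (s := Ioc 0 1)).congr_of_mem (fun t ht => ?_) hx
    have : ((t ^ (ν * j + e) : ℝ) : ℂ) ≠ 0 := by
      exact_mod_cast (Real.rpow_pos_of_pos ht.1 _).ne'
    field_simp
  · refine h'.trans_eq ?_
    rw [← neg_add', Real.rpow_neg hx.1.le, div_eq_mul_inv]

theorem mul_pow_le_ratio_pow {A L : ℝ} (hA : 0 ≤ A) (hL : 0 < L) {j : ℕ} (hj : 1 ≤ j) :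
    2 * (A * L ^ j) ≤ (2 * (A + 1) * L) ^ j := by
  rw [mul_pow]
  have : (2 * (A + 1)) ^ 1 ≤ (2 * (A + 1)) ^ j := pow_le_pow_right₀ (by linarith) hj
  have hL' := pow_pos hL j
  nlinarith

section

variable {ν β c A L : ℝ} {γ : ℂ}

theorem coeffBound_coeffFnA (h : ParamBound ν β γ c A L) (hν : 0 < ν) (hL : 0 < L) {j : ℕ}
    (hj : 1 ≤ j) {x : ℝ} (hx : x ∈ Ioc (0 : ℝ) 1) (k : Fin 4) :
    CoeffBound ν (2 * (A + 1) * L) (deltaExp k) j (coeffFnA ν k j β γ) x := by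
  have hA : 0 ≤ A := (norm_nonneg _).trans (h.wedge_le 0 0)
  have s := h.isSymbol hν j (fIdx k).1 (fIdx k).2
  have le := mul_pow_le_ratio_pow hA hL hj
  have le' : A * L ^ j ≤ (2 * (A + 1) * L) ^ j := by nlinarith [mul_nonneg hA (pow_pos hL j).le]
  have x1 : 0 ≤ 1 - x := by linarith [hx.2]
  obtain ⟨n, rfl⟩ : ∃ n, j = n + 1 := ⟨j - 1, by omega⟩
  have b := norm_coeffU_three_le hν h.pos h.le h.coeffA_le h.coeffB_le h.wedge_le
    (by linarith [h.le_ratio, h.nonneg]) h.le_ratio' n (fIdx_three k) hx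
  have b' := s.norm_deriv_le x hx
  rw [expo_fIdx] at b b'
  refine coeffBound_of_hasDerivAt (u := fun z => coeffU ν β γ (n + 1) z (fIdx k).1 (fIdx k).2) hx
    (s.hasDerivAt hx) (b.trans ?_) (b'.trans ?_)
  · exact mul_le_mul_of_nonneg_right le' (mul_nonneg x1 (Real.rpow_nonneg hx.1.le _))
  · exact mul_le_mul_of_nonneg_right le' (Real.rpow_nonneg hx.1.le _)

theorem coeffBound_coeffFnB (h : ParamBound ν β γ c A L) (hν : 0 < ν) (hL : 0 < L) {j : ℕ}
    (hj : 1 ≤ j) {x : ℝ} (hx : x ∈ Ioc (0 : ℝ) 1) (l : Fin 6) :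
    CoeffBound ν (2 * (A + 1) * L) (dExp l) j (coeffFnB ν l j β γ) x := by
  have hA : 0 ≤ A := (norm_nonneg _).trans (h.wedge_le 0 0)
  have s := h.isSymbol hν j (gIdx l).1 (gIdx l).2
  have le := mul_pow_le_ratio_pow hA hL hj
  have le' : A * L ^ j ≤ (2 * (A + 1) * L) ^ j := by nlinarith [mul_nonneg hA (pow_pos hL j).le]
  have x1 : 0 ≤ 1 - x := by linarith [hx.2]
  have b := s.norm_le x hx
  have b' := s.norm_deriv_le x hx
  rw [expo_gIdx] at b b'
  have n1 : ‖(1 - (x : ℂ))‖ = 1 - x := by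
    rw [← Complex.ofReal_one, ← Complex.ofReal_sub, Complex.norm_real, Real.norm_eq_abs,
      abs_of_nonneg x1]
  have d := ((hasDerivAt_id (x : ℂ)).const_sub 1).fun_mul (s.hasDerivAt hx)
  simp only [id] at d
  refine coeffBound_of_hasDerivAt
    (u := fun z => (1 - z) * coeffU ν β γ j z (gIdx l).1 (gIdx l).2) hx d ?_ ?_
  · rw [norm_mul, n1]
    calc _ ≤ (1 - x) * (A * L ^ j * x ^ (-(ν * j + dExp l))) := by gcongr
      _ = A * L ^ j * ((1 - x) * x ^ (-(ν * j + dExp l))) := by ring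
      _ ≤ _ := mul_le_mul_of_nonneg_right le' (mul_nonneg x1 (Real.rpow_nonneg hx.1.le _))
  · have p1 : x ^ (-(ν * j + dExp l)) ≤ x ^ (-(ν * j + dExp l) - 1) :=
      Real.rpow_le_rpow_of_exponent_ge hx.1 hx.2 (by linarith)
    have p2 := Real.rpow_nonneg hx.1.le (-(ν * j + dExp l) - 1)
    have AL : 0 ≤ A * L ^ j := by positivity
    refine (norm_add_le _ _).trans ?_
    rw [norm_mul, norm_mul, n1, norm_neg, norm_one, one_mul]
    have t1 : A * L ^ j * x ^ (-(ν * j + dExp l)) ≤ A * L ^ j * x ^ (-(ν * j + dExp l) - 1) := by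
      gcongr
    have t2 : (1 - x) * ‖deriv (fun z => coeffU ν β γ j z (gIdx l).1 (gIdx l).2) x‖ ≤
        1 * (A * L ^ j * x ^ (-(ν * j + dExp l) - 1)) :=
      mul_le_mul (by linarith [hx.1]) b' (norm_nonneg _) zero_le_one
    have t3 := mul_le_mul_of_nonneg_right le p2
    linarith

end

/-- Bound of the terms of the series by a geometric sequence, for `ξ ≥ ξ₀` and small `α`. -/
theorem norm_term_le {ν R e α x ξ₀ : ℝ} {j : ℕ} {f : ℝ → ℂ} (hν : 0 < ν) (he : e ≤ 2)
    (he0 : 0 ≤ e) (hR : 0 < R) (hα : 0 < α) (h0 : 0 < ξ₀) (hx : x ∈ Icc ξ₀ 1)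
    (hα1 : α * R * ξ₀ ^ (-ν) ≤ 1 / 2) (hf : ‖f x‖ ≤ R ^ j * (1 - x)) :
    ‖term ν α e j f x‖ ≤ ξ₀ ^ (-2 : ℝ) * (1 / 2) ^ j := by
  have x0 : 0 < x := h0.trans_le hx.1
  have xp := Real.rpow_pos_of_pos x0 (ν * j + e)
  have z0 := Real.rpow_pos_of_pos h0 (-(2 : ℝ))
  have hf' : ‖f x‖ ≤ R ^ j := hf.trans (mul_le_of_le_one_right (by positivity) (by linarith))
  rw [term, norm_mul, Complex.norm_real, Real.norm_eq_abs, abs_of_pos (by positivity),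
    div_eq_mul_inv, ← Real.rpow_neg x0.le]
  have h1 : x ^ (-(ν * j + e)) ≤ ξ₀ ^ (-(ν * j + e)) :=
    Real.rpow_le_rpow_of_nonpos h0 hx.1 (by have : 0 ≤ ν * j := by positivity
                                            linarith)
  have h2 : ξ₀ ^ (-(ν * j + e)) ≤ ξ₀ ^ (-2 : ℝ) * (ξ₀ ^ (-ν)) ^ j := by
    rw [← Real.rpow_natCast, ← Real.rpow_mul h0.le, ← Real.rpow_add h0]
    exact Real.rpow_le_rpow_of_exponent_ge h0 (hx.1.trans hx.2) (by linarith)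
  calc _ ≤ α ^ j * (ξ₀ ^ (-2 : ℝ) * (ξ₀ ^ (-ν)) ^ j) * R ^ j := by
        have := h1.trans h2
        gcongr
    _ = ξ₀ ^ (-2 : ℝ) * (α * R * ξ₀ ^ (-ν)) ^ j := by rw [mul_pow, mul_pow]; ring
    _ ≤ _ := by
      have := Real.rpow_nonneg h0.le (-ν)
      gcongr

theorem term_coeffFnA {ν α β : ℝ} {γ : ℂ} {x : ℝ} (hx : 0 < x) (k : Fin 4) (j : ℕ) :
    term ν α (deltaExp k) j (coeffFnA ν k j β γ) x =
      (α : ℂ) ^ j * coeffU ν β γ j x (fIdx k).1 (fIdx k).2 := by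
  have : ((x ^ (ν * j + deltaExp k) : ℝ) : ℂ) ≠ 0 := by
    exact_mod_cast (Real.rpow_pos_of_pos hx _).ne'
  rw [term, coeffFnA]
  push_cast
  field_simp

theorem term_coeffFnB {ν α β : ℝ} {γ : ℂ} {x : ℝ} (hx : 0 < x) (l : Fin 6) (j : ℕ) :
    term ν α (dExp l) j (coeffFnB ν l j β γ) x =
      (1 - (x : ℂ)) * ((α : ℂ) ^ j * coeffU ν β γ j x (gIdx l).1 (gIdx l).2) := by
  have : ((x ^ (ν * j + dExp l) : ℝ) : ℂ) ≠ 0 := by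
    exact_mod_cast (Real.rpow_pos_of_pos hx _).ne'
  rw [term, coeffFnB]
  push_cast
  field_simp

/-! ### Summation of the expansion -/

/-- The sum `η(α)` of the series of coefficients `etaCoeff`. -/
def etaSum (α β : ℝ) (γ : ℂ) : ℂ := ∑' n, (α : ℂ) ^ n * etaCoeff β γ n

/-- The sum of the series of coefficients `vecHat`, an eigenvector of `α N(1) - e₄₄`. -/
def vecSum (α β : ℝ) (γ : ℂ) (i : Fin 5) : ℂ := ∑' n, (α : ℂ) ^ n * vecHat β γ n i

/-- The sum `U(ξ) = ∑ αʲ Uⱼ(ξ)`. -/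
def sumU (ν α β : ℝ) (γ : ℂ) (x : ℝ) : Matrix (Fin 5) (Fin 5) ℂ :=
  of fun i k => ∑' n, (α : ℂ) ^ n * coeffU ν β γ n x i k

/-- The derivative of `sumU`, summed termwise; at `x = 1` too it is the sum of the complex
derivatives. -/
def sumU' (ν α β : ℝ) (γ : ℂ) (x : ℝ) : Matrix (Fin 5) (Fin 5) ℂ :=
  of fun i k => ∑' n, (α : ℂ) ^ n * deriv (fun z => coeffU ν β γ n z i k) x

/-- A Cauchy product of two absolutely convergent power series. -/
theorem hasSum_cauchy {a : ℂ} {f g : ℕ → ℂ} (hf : Summable fun n => ‖a ^ n * f n‖)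
    (hg : Summable fun n => ‖a ^ n * g n‖) :
    HasSum (fun n => a ^ n * ∑ p ∈ antidiagonal n, f p.1 * g p.2)
      ((∑' n, a ^ n * f n) * ∑' n, a ^ n * g n) := by
  rw [tsum_mul_tsum_eq_tsum_sum_antidiagonal_of_summable_norm hf hg]
  have h := (summable_norm_sum_mul_antidiagonal_of_summable_norm hf hg).of_norm.hasSum
  refine h.congr_fun fun n => ?_
  rw [Finset.mul_sum]
  refine Finset.sum_congr rfl fun p hp => ?_
  rw [← Finset.HasAntidiagonal.mem_antidiagonal.1 hp, pow_add]
  ring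

theorem hasSum_succ_of_hasSum {f : ℕ → ℂ} {s : ℂ} (h : HasSum f s) :
    HasSum (fun n => f (n + 1)) (s - f 0) := by
  simpa using (hasSum_nat_add_iff' 1).2 h

/-- The constants are valid for `β`, `γ`, and `α` is so small that the expansion converges
geometrically for `ξ ∈ [θ, 1]`. -/
structure Admissible (ν α β : ℝ) (γ : ℂ) (c A L θ : ℝ) : Prop extends ParamBound ν β γ c A L where
  exp_pos : 0 < ν
  alpha_pos : 0 < α
  mem_Ioo : θ ∈ Ioo (0 : ℝ) 1
  small : α * L * θ ^ (-ν) ≤ 1 / 2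

section

variable {ν α β c A L θ : ℝ} {γ : ℂ}

theorem ParamBound.ratio_nonneg (h : ParamBound ν β γ c A L) : 0 ≤ L := by
  linarith [h.le_ratio, h.nonneg]

theorem ParamBound.const_nonneg (h : ParamBound ν β γ c A L) : 0 ≤ A :=
  (norm_nonneg _).trans (h.wedge_le 0 0)

theorem norm_vecHat_le (h : ParamBound ν β γ c A L) (n : ℕ) (i : Fin 5) :
    ‖vecHat β γ n i‖ ≤ L ^ n := by
  have c0 := h.nonneg
  have L0 := h.ratio_nonneg
  induction n using Nat.strong_induction_on generalizing i with
  | _ n ih =>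
    cases n with
    | zero =>
      rw [vecHat_zero, pow_zero, Pi.single_apply]
      split_ifs <;> simp
    | succ n =>
      rw [vecHat_succ, Pi.neg_apply, norm_neg, Pi.add_apply, Finset.sum_apply]
      have h1 : ‖(opN β γ 1 *ᵥ vecHat β γ n) i‖ ≤ ∑ _k : Fin 5, 2 * c * L ^ n := by
        rw [opN_one, Matrix.mulVec, dotProduct]
        refine norm_sum_le_of_le _ fun k _ => ?_
        rw [norm_mul, Matrix.add_apply]
        have := (norm_add_le (coeffA β γ i k) (coeffB β γ i k)).trans
          (add_le_add (h.coeffA_le i k) (h.coeffB_le i k))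
        exact mul_le_mul (by linarith) (ih n n.lt_succ_self k) (norm_nonneg _) (by linarith)
      have h2 : ‖∑ p ∈ antidiagonal n, (etaCoeff β γ p.1 • vecHat β γ p.2) i‖ ≤
          ∑ p ∈ antidiagonal n, c * ((4 * c) ^ p.1 * L ^ p.2) := by
        refine norm_sum_le_of_le _ fun p hp => ?_
        rw [Pi.smul_apply, smul_eq_mul, norm_mul, ← mul_assoc]
        exact mul_le_mul (norm_etaCoeff_le h.pos h.le _)
          (ih p.2 (Nat.lt_succ_of_le (snd_le_of_mem_antidiagonal hp)) i) (norm_nonneg _)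
          (by positivity)
      rw [← Finset.mul_sum] at h2
      have h3 := mul_le_mul_of_nonneg_left (sum_geometric_le (ρ := 4 * c) (L := L) (by positivity)
        (by linarith [h.le_ratio]) n) c0
      rw [Finset.sum_const, Finset.card_univ, Fintype.card_fin, nsmul_eq_mul] at h1
      push_cast at h1
      have h4 := mul_le_mul_of_nonneg_right h.le_ratio (pow_nonneg L0 n)
      have h5 : 0 ≤ c * L ^ n := by positivity
      refine (norm_add_le _ _).trans ?_
      rw [pow_succ]
      linarith

theorem summable_of_norm_le_geometric {f : ℕ → ℂ} {C : ℝ}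
    (h : ∀ n, ‖f n‖ ≤ C * (1 / 2) ^ n) : Summable fun n => ‖f n‖ :=
  Summable.of_nonneg_of_le (fun _ => norm_nonneg _) h (summable_geometric_two.mul_left C)

theorem mul_ratio_le (hν : 0 < ν) (hα : 0 < α) (hL : 0 ≤ L) (hθ : θ ∈ Ioo (0 : ℝ) 1)
    (hs : α * L * θ ^ (-ν) ≤ 1 / 2) : α * L ≤ 1 / 2 := by
  have : 1 ≤ θ ^ (-ν) := Real.one_le_rpow_of_pos_of_le_one_of_nonpos hθ.1 hθ.2.le (by linarith)
  have h : 0 ≤ α * L := by positivity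
  nlinarith

theorem norm_pow_mul_eta_le (h : ParamBound ν β γ c A L) (hα : 0 < α) (hs : α * L ≤ 1 / 2)
    (n : ℕ) : ‖(α : ℂ) ^ n * etaCoeff β γ n‖ ≤ c * (1 / 2) ^ n := by
  have c0 := h.nonneg
  rw [norm_mul, norm_pow, Complex.norm_real, Real.norm_eq_abs, abs_of_pos hα]
  calc _ ≤ α ^ n * (c * (4 * c) ^ n) := by
        have := norm_etaCoeff_le h.pos h.le n
        gcongr
    _ = c * (α * (4 * c)) ^ n := by rw [mul_pow α]; ring
    _ ≤ _ := by
      have : α * (4 * c) ≤ α * L := mul_le_mul_of_nonneg_left (by linarith [h.le_ratio]) hα.le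
      gcongr
      linarith

theorem summable_eta (h : ParamBound ν β γ c A L) (hα : 0 < α) (hs : α * L ≤ 1 / 2) :
    Summable fun n => ‖(α : ℂ) ^ n * etaCoeff β γ n‖ :=
  summable_of_norm_le_geometric (norm_pow_mul_eta_le h hα hs)

theorem norm_mul_etaSum_le (h : ParamBound ν β γ c A L) (hα : 0 < α) (hs : α * L ≤ 1 / 2) :
    ‖(α : ℂ) * etaSum α β γ‖ ≤ 1 / 16 := by
  have h1 : ‖etaSum α β γ‖ ≤ c * 2 :=
    tsum_of_norm_bounded (hasSum_geometric_two.mul_left c) (norm_pow_mul_eta_le h hα hs)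
  rw [norm_mul, Complex.norm_real, Real.norm_eq_abs, abs_of_pos hα]
  have h2 := mul_le_mul_of_nonneg_left h.le_ratio hα.le
  have h3 := mul_le_mul_of_nonneg_left h1 hα.le
  linarith

/-- The quadratic equation of `η(α)`. -/
theorem etaSum_eq (h : ParamBound ν β γ c A L) (hα : 0 < α) (hs : α * L ≤ 1 / 2) :
    etaSum α β γ = γ + α * (β : ℂ) ^ 2 - α * etaSum α β γ ^ 2 := by
  have s := summable_eta h hα hs
  have h1 := hasSum_succ_of_hasSum s.of_norm.hasSum
  have h2 := (hasSum_cauchy s s).mul_left (α : ℂ)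
  have h3 : HasSum (fun n : ℕ => if n = 0 then (α : ℂ) * (β : ℂ) ^ 2 else 0)
      (α * (β : ℂ) ^ 2) := by
    simpa using hasSum_ite_eq (0 : ℕ) ((α : ℂ) * (β : ℂ) ^ 2)
  have h4 := (h3.sub h2).unique (h1.congr_fun fun n => by
    rw [etaCoeff_succ]
    split_ifs with hn
    · subst hn; ring
    · ring)
  rw [pow_zero, one_mul, etaCoeff_zero] at h4
  simp only [etaSum]
  linear_combination -h4

theorem lambdaMinus_eq (h : ParamBound ν β γ c A L) (hα : 0 < α) (hs : α * L ≤ 1 / 2) :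
    lambdaMinus α β γ = -1 - α * etaSum α β γ := by
  have e := etaSum_eq h hα hs
  have n := (abs_le.1 ((Complex.abs_re_le_norm _).trans (norm_mul_etaSum_le h hα hs))).1
  have sq : (1 / 4 + α * γ + (α : ℂ) ^ 2 * (β : ℂ) ^ 2) = (α * etaSum α β γ + 1 / 2) ^ 2 := by
    linear_combination (-(α : ℂ)) * e
  have pos : 0 < ((α : ℂ) * etaSum α β γ + 1 / 2).re := by
    rw [Complex.add_re]
    norm_num
    norm_num at n
    linarith
  have := Complex.sq_cpow_two_inv pos
  rw [← one_div] at this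
  rw [lambdaMinus, sq, this]
  ring

theorem mu_eq (h : ParamBound ν β γ c A L) (hα : 0 < α) (hs : α * L ≤ 1 / 2) :
    mu α β γ = -β - etaSum α β γ := by
  have e := etaSum_eq h hα hs
  have ne : (-1 - (α : ℂ) * etaSum α β γ) ≠ 0 := by
    intro h0
    have : (α : ℂ) * etaSum α β γ = -1 := by linear_combination -h0
    have n := norm_mul_etaSum_le h hα hs
    rw [this] at n
    norm_num at n
  rw [mu, lambdaMinus_eq h hα hs]
  field_simp
  linear_combination -e

theorem summable_muCoeff (h : ParamBound ν β γ c A L) (hα : 0 < α) (hs : α * L ≤ 1 / 2) :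
    (Summable fun n => ‖(α : ℂ) ^ n * muCoeff β γ n‖) ∧
      ∑' n, (α : ℂ) ^ n * muCoeff β γ n = mu α β γ := by
  have h3 : HasSum (fun n : ℕ => if n = 0 then -(β : ℂ) else 0) (-(β : ℂ)) := by
    simpa using hasSum_ite_eq (0 : ℕ) (-(β : ℂ))
  have h4 : HasSum (fun n => (α : ℂ) ^ n * muCoeff β γ n) (mu α β γ) := by
    rw [mu_eq h hα hs]
    refine (h3.sub (summable_eta h hα hs).of_norm.hasSum).congr_fun fun n => ?_
    rw [muCoeff]
    split_ifs with hn
    · subst hn; ring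
    · ring
  exact ⟨h4.summable.norm, h4.tsum_eq⟩

theorem norm_pow_mul_le (hν : 0 < ν) (hα : 0 < α) (hL : 0 ≤ L) (hA : 0 ≤ A)
    (hθ : θ ∈ Ioo (0 : ℝ) 1) (hs : α * L * θ ^ (-ν) ≤ 1 / 2) {x : ℝ} (hx : x ∈ Icc θ 1) (n : ℕ)
    (i k : Fin 5) {d : ℝ} (hd : 0 ≤ d) {u : ℂ} (hu : ‖u‖ ≤ A * L ^ n * x ^ (-expo ν n i k - d)) :
    ‖(α : ℂ) ^ n * u‖ ≤ A * θ ^ (-2 - d) * (1 / 2) ^ n := by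
  have x0 : 0 < x := hθ.1.trans_le hx.1
  rw [norm_mul, norm_pow, Complex.norm_real, Real.norm_eq_abs, abs_of_pos hα]
  have e0 := expo_nonneg hν n i k
  have w : ∀ i, (wt i : ℝ) ≤ 1 := fun i => by
    have : wt i ≤ 1 := by revert i; decide
    exact_mod_cast this
  have h1 : x ^ (-expo ν n i k - d) ≤ θ ^ (-expo ν n i k - d) :=
    Real.rpow_le_rpow_of_nonpos hθ.1 hx.1 (by linarith)
  have h2 : θ ^ (-expo ν n i k - d) ≤ θ ^ (-2 - d) * (θ ^ (-ν)) ^ n := by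
    rw [← Real.rpow_natCast, ← Real.rpow_mul hθ.1.le, ← Real.rpow_add hθ.1]
    refine Real.rpow_le_rpow_of_exponent_ge hθ.1 hθ.2.le ?_
    unfold expo
    linarith [w i, w k]
  have t0 := Real.rpow_nonneg hθ.1.le (-ν)
  have t1 := Real.rpow_nonneg hθ.1.le (-2 - d)
  calc _ ≤ α ^ n * (A * L ^ n * (θ ^ (-2 - d) * (θ ^ (-ν)) ^ n)) := by
        have := h1.trans h2
        gcongr
        exact hu.trans (by gcongr)
    _ = A * θ ^ (-2 - d) * (α * L * θ ^ (-ν)) ^ n := by rw [mul_pow, mul_pow]; ring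
    _ ≤ _ := by gcongr

theorem Admissible.mul_ratio_le (h : Admissible ν α β γ c A L θ) : α * L ≤ 1 / 2 :=
  KullAnisimov.mul_ratio_le h.exp_pos h.alpha_pos h.ratio_nonneg h.mem_Ioo h.small

theorem norm_pow_mul_coeffU_le (h : Admissible ν α β γ c A L θ)
    {x : ℝ} (hx : x ∈ Icc θ 1) (n : ℕ) (i k : Fin 5) :
    ‖(α : ℂ) ^ n * coeffU ν β γ n x i k‖ ≤ A * θ ^ (-2 - 0 : ℝ) * (1 / 2) ^ n :=
  norm_pow_mul_le h.exp_pos h.alpha_pos h.ratio_nonneg h.const_nonneg h.mem_Ioo h.small hx n i k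
    le_rfl
    (by simpa using (h.isSymbol h.exp_pos n i k).norm_le x ⟨h.mem_Ioo.1.trans_le hx.1, hx.2⟩)

theorem norm_pow_mul_deriv_coeffU_le (h : Admissible ν α β γ c A L θ)
    {x : ℝ} (hx : x ∈ Icc θ 1) (n : ℕ) (i k : Fin 5) :
    ‖(α : ℂ) ^ n * deriv (fun z => coeffU ν β γ n z i k) x‖ ≤
      A * θ ^ (-2 - 1 : ℝ) * (1 / 2) ^ n :=
  norm_pow_mul_le h.exp_pos h.alpha_pos h.ratio_nonneg h.const_nonneg h.mem_Ioo h.small hx n i k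
    zero_le_one
    ((h.isSymbol h.exp_pos n i k).norm_deriv_le x ⟨h.mem_Ioo.1.trans_le hx.1, hx.2⟩)

theorem hasSum_sumU (h : Admissible ν α β γ c A L θ)
    {x : ℝ} (hx : x ∈ Icc θ 1) (i k : Fin 5) :
    HasSum (fun n => (α : ℂ) ^ n * coeffU ν β γ n x i k) (sumU ν α β γ x i k) :=
  (summable_of_norm_le_geometric fun n =>
    norm_pow_mul_coeffU_le h hx n i k).of_norm.hasSum

theorem hasSum_sumU' (h : Admissible ν α β γ c A L θ)
    {x : ℝ} (hx : x ∈ Icc θ 1) (i k : Fin 5) :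
    HasSum (fun n => (α : ℂ) ^ n * deriv (fun z => coeffU ν β γ n z i k) x)
      (sumU' ν α β γ x i k) :=
  (summable_of_norm_le_geometric fun n =>
    norm_pow_mul_deriv_coeffU_le h hx n i k).of_norm.hasSum

theorem hasDerivAt_sumU (h : Admissible ν α β γ c A L θ)
    {x : ℝ} (hx : x ∈ Ioo θ 1) (i k : Fin 5) :
    HasDerivAt (fun x => sumU ν α β γ x i k) (sumU' ν α β γ x i k) x := by
  refine hasDerivAt_tsum_of_isPreconnected (summable_geometric_two.mul_left _) isOpen_Ioo
    isPreconnected_Ioo (fun n y hy => ?_)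
    (fun n y hy => norm_pow_mul_deriv_coeffU_le h ⟨hy.1.le, hy.2.le⟩ n i k) hx
    (hasSum_sumU h ⟨hx.1.le, hx.2.le⟩ i k).summable hx
  exact (((h.isSymbol h.exp_pos n i k).hasDerivAt
    ⟨h.mem_Ioo.1.trans hy.1, hy.2.le⟩).comp_ofReal).const_mul _

theorem continuousOn_sumU (h : Admissible ν α β γ c A L θ) (i k : Fin 5) :
    ContinuousOn (fun x => sumU ν α β γ x i k) (Icc θ 1) := by
  refine continuousOn_tsum (fun n => ?_) (summable_geometric_two.mul_left _)
    (fun n x hx => norm_pow_mul_coeffU_le h hx n i k)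
  refine continuousOn_const.mul fun x hx => ?_
  exact ((h.isSymbol h.exp_pos n i k).hasDerivAt
    ⟨h.mem_Ioo.1.trans_le hx.1, hx.2⟩).comp_ofReal.continuousAt.continuousWithinAt

theorem transpose_sumU (h : Admissible ν α β γ c A L θ)
    {x : ℝ} (hx : x ∈ Icc θ 1) :
    (sumU ν α β γ x)ᵀ = -sumU ν α β γ x := by
  ext i k
  rw [transpose_apply, Matrix.neg_apply]
  refine (hasSum_sumU h hx k i).unique ((hasSum_sumU h hx i k).neg.congr_fun
    fun n => ?_)
  have := congrFun (congrFun (transpose_coeffU (β := β) (γ := γ) h.exp_pos n x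
    (ofReal_mem_unitDisc ⟨h.mem_Ioo.1.trans_le hx.1, hx.2⟩)) i) k
  rw [transpose_apply, Matrix.neg_apply] at this
  rw [this, mul_neg]

/-- The differential equation of `U`. -/
theorem sumU_ode (h : Admissible ν α β γ c A L θ)
    {x : ℝ} (hx : x ∈ Icc θ 1) (i k : Fin 5) :
    ((x ^ (ν + 1) : ℝ) : ℂ) * ((1 - x) * sumU' ν α β γ x i k) =
      α * (derivTwo (opN β γ x) (sumU ν α β γ x) i k - mu α β γ * sumU ν α β γ x i k) +
        if i = 3 ∨ k = 3 then 0 else ((x ^ (ν + 1) : ℝ) : ℂ) * sumU ν α β γ x i k := by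
  have hx' : x ∈ Ioc (0 : ℝ) 1 := ⟨h.mem_Ioo.1.trans_le hx.1, hx.2⟩
  have hs1 := h.mul_ratio_le
  have hU := hasSum_sumU h hx
  obtain ⟨smu, emu⟩ := summable_muCoeff h.toParamBound h.alpha_pos hs1
  have a := hasSum_cauchy smu (hU i k).summable.norm
  rw [emu, (hU i k).tsum_eq] at a
  have b : HasSum (fun n => ∑ j, (opN β γ x i j * ((α : ℂ) ^ n * coeffU ν β γ n x j k) +
      opN β γ x k j * ((α : ℂ) ^ n * coeffU ν β γ n x i j)))
      (derivTwo (opN β γ x) (sumU ν α β γ x) i k) := by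
    have e : derivTwo (opN β γ x) (sumU ν α β γ x) i k = ∑ j, (opN β γ x i j * sumU ν α β γ x j k +
        opN β γ x k j * sumU ν α β γ x i j) := by
      simp only [derivTwo, Matrix.add_apply, Matrix.mul_apply, transpose_apply,
        Finset.sum_add_distrib]
      congr 1
      exact Finset.sum_congr rfl fun j _ => mul_comm _ _
    rw [e]
    exact hasSum_sum fun j _ => ((hU j k).mul_left _).add ((hU i j).mul_left _)
  have n : HasSum (fun n => (α : ℂ) ^ n * numer ν β γ n x i k)
      (derivTwo (opN β γ x) (sumU ν α β γ x) i k - mu α β γ * sumU ν α β γ x i k) := by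
    refine (b.sub a).congr_fun fun n => ?_
    rw [numer_apply, mul_sub, Finset.mul_sum]
    congr 1
    exact Finset.sum_congr rfl fun j _ => by ring
  have g : HasSum (fun n => (α : ℂ) ^ (n + 1) *
      if i = 3 ∨ k = 3 then 0 else ((x ^ (ν + 1) : ℝ) : ℂ) * coeffU ν β γ (n + 1) x i k)
      (if i = 3 ∨ k = 3 then 0 else ((x ^ (ν + 1) : ℝ) : ℂ) * sumU ν α β γ x i k) := by
    split_ifs with hik
    · simp [hasSum_zero]
    · have := (hasSum_succ_of_hasSum (hU i k)).mul_left ((x ^ (ν + 1) : ℝ) : ℂ)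
      have e0 : coeffU ν β γ 0 x i k = 0 := by
        push Not at hik
        rw [coeffU_zero, wedge_apply]
        simp [hik.1, hik.2]
      rw [e0, mul_zero, sub_zero] at this
      exact this.congr_fun fun n => by ring
  have l := ((hasSum_succ_of_hasSum (hasSum_sumU' h hx i k)).mul_left
    (1 - (x : ℂ))).mul_left ((x ^ (ν + 1) : ℝ) : ℂ)
  have d0 : deriv (fun z => coeffU ν β γ 0 z i k) (x : ℂ) = 0 := by
    simp only [coeffU_zero]
    exact deriv_const _ _
  rw [d0, mul_zero, sub_zero] at l
  refine l.unique (((n.mul_left (α : ℂ)).add g).congr_fun fun n => ?_)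
  have o := coeffU_ode (γ := γ) h.exp_pos h.pos n i k hx'
  linear_combination (α : ℂ) ^ (n + 1) * o

end

/-! ### The eigenvector at `ξ = 1` -/

section

variable {ν α β c A L θ : ℝ} {γ : ℂ}

theorem hasSum_vecSum (h : Admissible ν α β γ c A L θ) (i : Fin 5) :
    HasSum (fun n => (α : ℂ) ^ n * vecHat β γ n i) (vecSum α β γ i) := by
  refine (summable_of_norm_le_geometric (C := 1) fun n => ?_).of_norm.hasSum
  have a0 := h.alpha_pos
  have L0 := h.ratio_nonneg
  rw [norm_mul, norm_pow, Complex.norm_real, Real.norm_eq_abs, abs_of_pos a0]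
  calc _ ≤ α ^ n * L ^ n := by
        have := norm_vecHat_le h.toParamBound n i
        gcongr
    _ = (α * L) ^ n := (mul_pow _ _ _).symm
    _ ≤ (1 / 2) ^ n := by
      have := h.mul_ratio_le
      gcongr
    _ = _ := (one_mul _).symm

theorem vecSum_three (h : Admissible ν α β γ c A L θ) : vecSum α β γ 3 = 1 := by
  refine (hasSum_vecSum h 3).unique ((hasSum_ite_eq (0 : ℕ) (1 : ℂ)).congr_fun fun n => ?_)
  rw [(vecHat_three_and_eta h.pos n).1]
  split_ifs with hn
  · subst hn; simp
  · simp

/-- The matrix whose only entry is a `1` at the place `(4, 4)`. -/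
def e44 : Matrix (Fin 5) (Fin 5) ℂ := Matrix.single 3 3 1

theorem e44_mulVec (v : Fin 5 → ℂ) : e44 *ᵥ v = Pi.single 3 (v 3) := by
  ext i
  fin_cases i <;>
    simp [e44, Matrix.mulVec, dotProduct, Matrix.single_apply]

theorem e44_eq : e44 =
    !![0, 0, 0, 0, 0; 0, 0, 0, 0, 0; 0, 0, 0, 0, 0; 0, 0, 0, 1, 0; 0, 0, 0, 0, 0] := by
  ext i k
  fin_cases i <;> fin_cases k <;> simp [e44, Matrix.single]

theorem mulVec_vecSum (h : Admissible ν α β γ c A L θ) :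
    ((α : ℂ) • opN β γ 1 - e44) *ᵥ vecSum α β γ = lambdaMinus α β γ • vecSum α β γ := by
  have s := hasSum_vecSum h
  rw [lambdaMinus_eq h.toParamBound h.alpha_pos h.mul_ratio_le]
  ext i
  have h1 := hasSum_succ_of_hasSum (s i)
  have h2 := hasSum_cauchy (summable_eta h.toParamBound h.alpha_pos h.mul_ratio_le)
    (s i).summable.norm
  rw [(s i).tsum_eq] at h2
  have h3 : HasSum (fun n => ∑ k, opN β γ 1 i k * ((α : ℂ) ^ n * vecHat β γ n k))
      ((opN β γ 1 *ᵥ vecSum α β γ) i) := hasSum_sum fun k _ => (s k).mul_left _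
  have h4 := h1.unique (((h3.add h2).mul_left (-(α : ℂ))).congr_fun fun n => by
    rw [vecHat_succ, Pi.neg_apply, Pi.add_apply, Finset.sum_apply, Matrix.mulVec, dotProduct]
    simp only [Pi.smul_apply, smul_eq_mul]
    have e : ∑ k, opN β γ 1 i k * ((α : ℂ) ^ n * vecHat β γ n k) =
        (α : ℂ) ^ n * ∑ k, opN β γ 1 i k * vecHat β γ n k := by
      rw [Finset.mul_sum]
      exact Finset.sum_congr rfl fun k _ => by ring
    rw [e]
    ring)
  rw [vecHat_zero] at h4
  have e : (Pi.single 3 (vecSum α β γ 3) : Fin 5 → ℂ) = Pi.single 3 1 := by rw [vecSum_three h]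
  rw [sub_mulVec, smul_mulVec, e44_mulVec, e]
  simp only [Pi.sub_apply, Pi.smul_apply, smul_eq_mul, etaSum] at h4 ⊢
  linear_combination h4

theorem sumU_one (h : Admissible ν α β γ c A L θ) :
    sumU ν α β γ 1 = wedge (vecSum α β γ) (vecE β γ) := by
  ext i k
  have s := hasSum_vecSum h
  refine (hasSum_sumU h ⟨h.mem_Ioo.2.le, le_rfl⟩ i k).unique ?_
  rw [wedge_apply]
  refine (((s i).mul_right _).sub ((s k).mul_left _)).congr_fun fun n => ?_
  rw [Complex.ofReal_one, (coeffU_one_and_numer_one h.exp_pos h.pos n).1, wedge_apply]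
  ring

end

/-! ### Matrices of differentiable functions -/

/-- Entrywise derivative of a matrix-valued function. -/
def HasMatDeriv (f : ℝ → Matrix (Fin 5) (Fin 5) ℂ) (f' : Matrix (Fin 5) (Fin 5) ℂ) (s : Set ℝ)
    (y : ℝ) : Prop :=
  ∀ i k, HasDerivWithinAt (fun t => f t i k) (f' i k) s y

namespace HasMatDeriv

variable {f g : ℝ → Matrix (Fin 5) (Fin 5) ℂ} {f' g' : Matrix (Fin 5) (Fin 5) ℂ} {s : Set ℝ} {y : ℝ}

theorem mul (hf : HasMatDeriv f f' s y) (hg : HasMatDeriv g g' s y) :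
    HasMatDeriv (fun t => f t * g t) (f' * g y + f y * g') s y := by
  intro i k
  simp only [Matrix.mul_apply, Matrix.add_apply, ← Finset.sum_add_distrib]
  exact HasDerivWithinAt.fun_sum fun j _ => (hf i j).fun_mul (hg j k)

theorem transpose (hf : HasMatDeriv f f' s y) : HasMatDeriv (fun t => (f t)ᵀ) f'ᵀ s y :=
  fun i k => hf k i

theorem smul {u : ℝ → ℂ} {u' : ℂ} (hu : HasDerivWithinAt u u' s y) (hf : HasMatDeriv f f' s y) :
    HasMatDeriv (fun t => u t • f t) (u' • f y + u y • f') s y :=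
  fun i k => hu.fun_mul (hf i k)

theorem mapTwo (hf : HasMatDeriv f f' s y) (hg : HasMatDeriv g g' s y) :
    HasMatDeriv (fun t => mapTwo (f t) (g t))
      (f' * g y * (f y)ᵀ + f y * g' * (f y)ᵀ + f y * g y * f'ᵀ) s y := by
  have := (hf.mul hg).mul hf.transpose
  rwa [add_mul] at this

end HasMatDeriv

/-! ### The change of coordinates -/

/-- The inverse of `coordQ`: it takes the regular coordinates `Ŷ` to `X`. -/
def coordS (x α β : ℝ) (γ : ℂ) : Matrix (Fin 5) (Fin 5) ℂ :=
  !![1, 0, 0, γ / β, 0;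
     0, 1, 0, 1 / (β : ℂ) ^ 2, 0;
     0, 0, 1, 1 / x, 0;
     0, 0, 0, 1 / (α * β * x), 0;
     0, 0, 0, 0, 1]

/-- The matrix `diag(1, 1, 1, 1 - ξ, 1) T(ξ)` of the regular coordinates. -/
def coordQ (x α β : ℝ) (γ : ℂ) : Matrix (Fin 5) (Fin 5) ℂ :=
  !![1, 0, 0, -(α * γ * x), 0;
     0, 1, 0, -(α / β * x), 0;
     0, 0, 1, -(α * β), 0;
     0, 0, 0, α * β * x, 0;
     0, 0, 0, 0, 1]

/-- The derivative of `coordS` with respect to `ξ`. -/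
def coordS' (x α β : ℝ) : Matrix (Fin 5) (Fin 5) ℂ :=
  !![0, 0, 0, 0, 0;
     0, 0, 0, 0, 0;
     0, 0, 0, -(1 / (x : ℂ) ^ 2), 0;
     0, 0, 0, -(1 / (α * β * (x : ℂ) ^ 2)), 0;
     0, 0, 0, 0, 0]

/-- The derivative of `coordQ` with respect to `ξ`. -/
def coordQ' (α β : ℝ) (γ : ℂ) : Matrix (Fin 5) (Fin 5) ℂ :=
  !![0, 0, 0, -(α * γ), 0;
     0, 0, 0, -(α / β), 0;
     0, 0, 0, 0, 0;
     0, 0, 0, α * β, 0;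
     0, 0, 0, 0, 0]

section

variable {ν α β x : ℝ} {γ : ℂ}

theorem opN_eq {z : ℂ} (hz : z ≠ 0) : opN β γ z =
    !![γ, 0, -(β * z), (γ ^ 2 - β ^ 2) / β, -(γ * z);
       1 / β - γ, 0, β, β / z + (1 / β - γ) * γ / β, -(z / β);
       -(β / z), -β, γ * z, -(γ / z) + (γ - 1 / β), -β;
       -β, 0, 0, -γ, β * z;
       0, 0, -β, 0, 0] := by
  have w0 : wt 0 = 0 := rfl
  have w1 : wt 1 = 1 := rfl
  have w2 : wt 2 = 1 := rfl
  have w3 : wt 3 = 0 := rfl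
  have w4 : wt 4 = 1 := rfl
  ext i k
  fin_cases i <;> fin_cases k <;>
    simp [opN, coeffA, coeffB, w0, w1, w2, w3, w4] <;> field_simp

theorem coordQ_mul_coordS (hx : 0 < x) (hα : 0 < α) (hβ : 0 < β) :
    coordQ x α β γ * coordS x α β γ = 1 := by
  have hx' : (x : ℂ) ≠ 0 := by exact_mod_cast hx.ne'
  have hα' : (α : ℂ) ≠ 0 := by exact_mod_cast hα.ne'
  have hβ' : (β : ℂ) ≠ 0 := by exact_mod_cast hβ.ne'
  ext i k
  fin_cases i <;> fin_cases k <;>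
    simp [coordQ, coordS, Matrix.mul_apply, Fin.sum_univ_succ] <;> field_simp <;> ring

theorem coordQ'_mul_coordS (hx : 0 < x) (hα : 0 < α) (hβ : 0 < β) :
    coordQ' α β γ * coordS x α β γ = -(coordQ x α β γ * coordS' x α β) := by
  have hx' : (x : ℂ) ≠ 0 := by exact_mod_cast hx.ne'
  have hα' : (α : ℂ) ≠ 0 := by exact_mod_cast hα.ne'
  have hβ' : (β : ℂ) ≠ 0 := by exact_mod_cast hβ.ne'
  ext i k
  rw [Matrix.neg_apply, Matrix.mul_apply, Matrix.mul_apply, Fin.sum_univ_five, Fin.sum_univ_five]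
  fin_cases i <;> fin_cases k <;> simp [coordQ', coordQ, coordS, coordS'] <;>
    (field_simp; try ring)

set_option maxHeartbeats 1000000 in
/-- The change of coordinates `X = S Ŷ` turns `X' = -M₀ X` into `Ŷ' = (α N - ξ^(ν+1) e₄₄) Ŷ`, since
`ξ' = ξ^(ν+1) (1 - ξ)`. -/
theorem coordS_intertwining (hx : 0 < x) (hα : 0 < α) (hβ : 0 < β) :
    ((x ^ (ν + 1) * (1 - x) : ℝ) : ℂ) • coordS' x α β = -(M0 ν x α β γ * coordS x α β γ +
      coordS x α β γ * ((α : ℂ) • opN β γ x - ((x ^ (ν + 1) : ℝ) : ℂ) • e44)) := by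
  have hx' : (x : ℂ) ≠ 0 := by exact_mod_cast hx.ne'
  have hα' : (α : ℂ) ≠ 0 := by exact_mod_cast hα.ne'
  have hβ' : (β : ℂ) ≠ 0 := by exact_mod_cast hβ.ne'
  have p1 : x ^ (ν + 1) = x ^ ν * x := Real.rpow_add_one hx.ne' ν
  have p2 : x ^ (ν + 2) = x ^ ν * x ^ 2 := by
    rw [Real.rpow_add hx, Real.rpow_two]
  rw [opN_eq hx', M0, p1, p2, e44_eq]
  push_cast
  generalize ((x ^ ν : ℝ) : ℂ) = r
  ext i k
  rw [Matrix.neg_apply, Matrix.add_apply, Matrix.mul_apply, Matrix.mul_apply, Fin.sum_univ_five,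
    Fin.sum_univ_five, Matrix.smul_apply]
  simp only [Matrix.sub_apply, Matrix.smul_apply]
  fin_cases i <;> fin_cases k <;>
    simp [coordS', coordS] <;> field_simp <;> ring

end

/-- The matrix of the system in the regular coordinates: `Ŷ' = opB Ŷ`. -/
def opB (ν x α β : ℝ) (γ : ℂ) : Matrix (Fin 5) (Fin 5) ℂ :=
  (α : ℂ) • opN β γ x - ((x ^ (ν + 1) : ℝ) : ℂ) • e44

section

variable {ν α β x : ℝ} {γ : ℂ}

theorem coordQ_intertwining (hx : 0 < x) (hα : 0 < α) (hβ : 0 < β) :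
    ((x ^ (ν + 1) * (1 - x) : ℝ) : ℂ) • coordQ' α β γ = coordQ x α β γ * M0 ν x α β γ +
      opB ν x α β γ * coordQ x α β γ := by
  have h1 := coordQ_mul_coordS (γ := γ) hx hα hβ
  have h2 := mul_eq_one_comm.1 h1
  have h3 : coordQ' α β γ = -(coordQ x α β γ * coordS' x α β * coordQ x α β γ) := by
    rw [← Matrix.neg_mul, ← coordQ'_mul_coordS hx hα hβ, Matrix.mul_assoc, h2, Matrix.mul_one]
  rw [h3, smul_neg, ← Matrix.smul_mul, ← Matrix.mul_smul, coordS_intertwining hx hα hβ, ← opB]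
  simp only [Matrix.mul_neg, Matrix.neg_mul, neg_neg, Matrix.mul_add, Matrix.add_mul]
  rw [← Matrix.mul_assoc (coordQ x α β γ) (coordS x α β γ), h1, Matrix.one_mul,
    Matrix.mul_assoc (coordQ x α β γ) (_ * _), Matrix.mul_assoc (M0 ν x α β γ), h2, Matrix.mul_one]

theorem changeT_mul_coordS (hx : x ∈ Ioo (0 : ℝ) 1) (hα : 0 < α) (hβ : 0 < β) :
    changeT x α β γ * coordS x α β γ =
      diagonal ![1, 1, 1, 1 / (1 - (x : ℂ)), 1] := by
  have hx' : (x : ℂ) ≠ 0 := by exact_mod_cast hx.1.ne'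
  have hx1 : (1 - (x : ℂ)) ≠ 0 := by
    rw [sub_ne_zero]
    exact_mod_cast hx.2.ne'
  have hα' : (α : ℂ) ≠ 0 := by exact_mod_cast hα.ne'
  have hβ' : (β : ℂ) ≠ 0 := by exact_mod_cast hβ.ne'
  ext i k
  rw [Matrix.mul_apply, Fin.sum_univ_five]
  fin_cases i <;> fin_cases k <;> simp [changeT, coordS] <;> field_simp <;> ring

theorem derivTwo_e44 {U : Matrix (Fin 5) (Fin 5) ℂ} (hU : Uᵀ = -U) (i k : Fin 5) :
    derivTwo e44 U i k = if i = 3 ∨ k = 3 then U i k else 0 := by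
  have h33 : U 3 3 = 0 := by
    have := congrFun (congrFun hU 3) 3
    rw [transpose_apply, Matrix.neg_apply] at this
    linear_combination this / 2
  rw [derivTwo, Matrix.add_apply, Matrix.mul_apply, Matrix.mul_apply]
  by_cases hi : i = 3 <;> by_cases hk : k = 3
  · subst hi hk; simp [e44, Matrix.single_apply, h33]
  · subst hi; simp [e44, Matrix.single_apply, hk, Ne.symm hk]
  · subst hk; simp [e44, Matrix.single_apply, hi, Ne.symm hi]
  · simp [e44, hi, hk, Ne.symm hi, Ne.symm hk]

end

/-- The system solved by `U`, in matrix form. -/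
theorem sumU_matrix_ode {ν α β c A L θ x : ℝ} {γ : ℂ} (h : Admissible ν α β γ c A L θ)
    (hx : x ∈ Icc θ 1) :
    ((x ^ (ν + 1) * (1 - x) : ℝ) : ℂ) • sumU' ν α β γ x =
      derivTwo (opB ν x α β γ) (sumU ν α β γ x) +
        (((x ^ (ν + 1) : ℝ) : ℂ) - α * mu α β γ) • sumU ν α β γ x := by
  have e : derivTwo (opB ν x α β γ) (sumU ν α β γ x) =
      (α : ℂ) • derivTwo (opN β γ x) (sumU ν α β γ x) -
        ((x ^ (ν + 1) : ℝ) : ℂ) • derivTwo e44 (sumU ν α β γ x) := by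
    simp only [derivTwo, opB, transpose_sub, transpose_smul, Matrix.sub_mul, Matrix.mul_sub,
      Matrix.smul_mul, Matrix.mul_smul]
    module
  rw [e]
  ext i k
  have o := sumU_ode h hx i k
  simp only [Matrix.add_apply, Matrix.sub_apply, Matrix.smul_apply, smul_eq_mul,
    derivTwo_e44 (transpose_sumU h hx)]
  push_cast at o ⊢
  split_ifs at o ⊢ with hik
  · linear_combination o
  · linear_combination o

/-! ### The profile -/

section

variable {ν : ℝ} {ξ : ℝ → ℝ}

theorem IsProfile.monotone (hξ : IsProfile ν ξ) : Monotone ξ := by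
  refine monotone_of_hasDerivAt_nonneg (fun y => hξ.hasDerivAt y) fun y => ?_
  have := hξ.mem_Ioo y
  exact mul_nonneg (Real.rpow_nonneg this.1.le _) (by linarith [this.2])

theorem one_sub_rpow_succ_le (hν : 0 < ν) {x : ℝ} (hx : x ∈ Ioc (0 : ℝ) 1) :
    1 - x ^ (ν + 1) ≤ (ν + 1) * (1 - x) := by
  have := one_sub_rpow_le (p := ν + 1) hx
  rwa [max_eq_right (by linarith)] at this

/-- The limit `C₀` exists, and `1 - ξ` decays exponentially: `(1 - ξ) e^y` is monotone, and it is
bounded because `(1 - ξ) exp (y - Cξ)` decreases for large `C`. -/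
theorem IsProfile.exists_limit (hν : 0 < ν) (hξ : IsProfile ν ξ) :
    ∃ C₀ : ℝ, Tendsto (fun y => (1 - ξ y) * Real.exp y) atTop (𝓝 C₀) ∧
      ∀ y, 1 - ξ y ≤ C₀ * Real.exp (-y) := by
  have d : ∀ y, HasDerivAt (fun y => (1 - ξ y) * Real.exp y)
      ((1 - ξ y) * Real.exp y * (1 - ξ y ^ (ν + 1))) y := fun y =>
    (((hξ.hasDerivAt y).const_sub 1).fun_mul (Real.hasDerivAt_exp y)).congr_deriv (by ring)
  have nn : ∀ y, 0 ≤ 1 - ξ y := fun y => by linarith [(hξ.mem_Ioo y).2]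
  have mono : Monotone fun y => (1 - ξ y) * Real.exp y := by
    refine monotone_of_hasDerivAt_nonneg d fun y => ?_
    have h1 : ξ y ^ (ν + 1) ≤ 1 :=
      Real.rpow_le_one (hξ.mem_Ioo y).1.le (hξ.mem_Ioo y).2.le (by linarith)
    exact mul_nonneg (mul_nonneg (nn y) (Real.exp_nonneg y)) (by linarith)
  have p0 : 0 < ξ 0 ^ (ν + 1) := Real.rpow_pos_of_pos (hξ.mem_Ioo 0).1 _
  set C := (ν + 1) / ξ 0 ^ (ν + 1) with hC
  have C0 : 0 ≤ C := by positivity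
  have anti : AntitoneOn (fun y => (1 - ξ y) * Real.exp y * Real.exp (-(C * ξ y))) (Ici 0) := by
    have d' : ∀ y, HasDerivAt (fun y => (1 - ξ y) * Real.exp y * Real.exp (-(C * ξ y)))
        ((1 - ξ y) * Real.exp y * Real.exp (-(C * ξ y)) *
          (1 - ξ y ^ (ν + 1) - C * (ξ y ^ (ν + 1) * (1 - ξ y)))) y := fun y =>
      ((d y).fun_mul (((hξ.hasDerivAt y).const_mul C).fun_neg.exp)).congr_deriv (by ring)
    refine antitoneOn_of_deriv_nonpos (convex_Ici 0)
      (fun y _ => (d' y).continuousAt.continuousWithinAt)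
      (fun y _ => (d' y).differentiableAt.differentiableWithinAt) fun y hy => ?_
    rw [interior_Ici] at hy
    rw [(d' y).deriv]
    have hm := hξ.mem_Ioo y
    have h1 := one_sub_rpow_succ_le hν ⟨hm.1, hm.2.le⟩
    have h2 : ξ 0 ^ (ν + 1) ≤ ξ y ^ (ν + 1) :=
      Real.rpow_le_rpow (hξ.mem_Ioo 0).1.le (hξ.monotone (le_of_lt hy)) (by linarith)
    have h3 : ν + 1 ≤ C * ξ y ^ (ν + 1) := by
      calc ν + 1 = C * ξ 0 ^ (ν + 1) := by rw [hC]; field_simp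
        _ ≤ _ := by gcongr
    have h4 := mul_le_mul_of_nonneg_right h3 (nn y)
    refine mul_nonpos_of_nonneg_of_nonpos
      (mul_nonneg (mul_nonneg (nn y) (Real.exp_nonneg _)) (Real.exp_nonneg _)) ?_
    linarith
  have bdd : BddAbove (range fun y => (1 - ξ y) * Real.exp y) := by
    refine ⟨(1 - ξ 0) * Real.exp 0 * Real.exp (-(C * ξ 0)) * Real.exp C, ?_⟩
    have key : ∀ y, 0 ≤ y → (1 - ξ y) * Real.exp y ≤
        (1 - ξ 0) * Real.exp 0 * Real.exp (-(C * ξ 0)) * Real.exp C := by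
      intro y hy
      have h1 := anti self_mem_Ici hy hy
      simp only at h1
      have h2 : 1 ≤ Real.exp (-(C * ξ y)) * Real.exp C := by
        rw [← Real.exp_add]
        refine Real.one_le_exp ?_
        nlinarith [(hξ.mem_Ioo y).2]
      calc _ ≤ (1 - ξ y) * Real.exp y * (Real.exp (-(C * ξ y)) * Real.exp C) :=
            le_mul_of_one_le_right (mul_nonneg (nn y) (Real.exp_nonneg _)) h2
        _ = (1 - ξ y) * Real.exp y * Real.exp (-(C * ξ y)) * Real.exp C := by ring
        _ ≤ _ := by gcongr
    rintro _ ⟨y, rfl⟩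
    rcases le_total 0 y with hy | hy
    · exact key y hy
    · exact (mono hy).trans (key 0 le_rfl)
  refine ⟨_, tendsto_atTop_ciSup mono bdd, fun y => ?_⟩
  have h1 := le_ciSup bdd y
  calc 1 - ξ y = (1 - ξ y) * Real.exp y * Real.exp (-y) := by
        rw [mul_assoc, ← Real.exp_add]; simp
    _ ≤ _ := mul_le_mul_of_nonneg_right h1 (Real.exp_nonneg _)

theorem IsProfile.tendsto_one (hν : 0 < ν) (hξ : IsProfile ν ξ) : Tendsto ξ atTop (𝓝 1) := by
  obtain ⟨C₀, -, h⟩ := hξ.exists_limit hν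
  have h1 : Tendsto (fun y => 1 - C₀ * Real.exp (-y)) atTop (𝓝 (1 - C₀ * 0)) :=
    tendsto_const_nhds.sub ((Real.tendsto_exp_atBot.comp tendsto_neg_atTop_atBot).const_mul C₀)
  rw [mul_zero, sub_zero] at h1
  exact tendsto_of_tendsto_of_tendsto_of_le_of_le h1 tendsto_const_nhds
    (fun y => by linarith [h y]) fun y => (hξ.mem_Ioo y).2.le

end

/-! ### The decaying solution -/

/-- The normalized decaying solution. -/
def solW (ν : ℝ) (ξ : ℝ → ℝ) (α β : ℝ) (γ : ℂ) (y : ℝ) : Matrix (Fin 5) (Fin 5) ℂ :=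
  (Complex.exp (α * mu α β γ * y) * (1 - (ξ y : ℂ))) •
    mapTwo (coordS (ξ y) α β γ) (sumU ν α β γ (ξ y))

theorem transpose_mapTwo (S X : Matrix (Fin 5) (Fin 5) ℂ) (hX : Xᵀ = -X) :
    (mapTwo S X)ᵀ = -mapTwo S X := by
  simp only [mapTwo, transpose_mul, transpose_transpose, hX, Matrix.mul_neg, Matrix.neg_mul,
    Matrix.mul_assoc]

section

variable {ν α β c A L θ : ℝ} {γ : ℂ} {ξ : ℝ → ℝ}

theorem hasDerivAt_coordS {x : ℝ} (hx : 0 < x) (hα : 0 < α) (hβ : 0 < β) (i k : Fin 5) :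
    HasDerivAt (fun x : ℝ => coordS x α β γ i k) (coordS' x α β i k) x := by
  have hx' : (x : ℂ) ≠ 0 := by exact_mod_cast hx.ne'
  have hα' : (α : ℂ) ≠ 0 := by exact_mod_cast hα.ne'
  have hβ' : (β : ℂ) ≠ 0 := by exact_mod_cast hβ.ne'
  have d1 : HasDerivAt (fun x : ℝ => 1 / (x : ℂ)) (-(1 / (x : ℂ) ^ 2)) x := by
    simpa using (hasDerivAt_inv hx').comp_ofReal
  have d2 : HasDerivAt (fun x : ℝ => 1 / ((α : ℂ) * β * x)) (-(1 / (α * β * (x : ℂ) ^ 2))) x := by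
    refine ((d1.const_mul (1 / ((α : ℂ) * β))).congr_deriv ?_).congr_of_eventuallyEq
      (Eventually.of_forall fun t => ?_)
    · field_simp
    · simp only [one_div, mul_inv]
  fin_cases i <;> fin_cases k <;> simp only [coordS, coordS'] <;>
    first
    | exact hasDerivAt_const _ _
    | exact d1
    | exact d2

theorem hasDerivAt_coordQ (x : ℝ) (i k : Fin 5) :
    HasDerivAt (fun x : ℝ => coordQ x α β γ i k) (coordQ' α β γ i k) x := by
  have d0 : HasDerivAt (fun x : ℝ => (x : ℂ)) 1 x := (hasDerivAt_id (x : ℂ)).comp_ofReal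
  have d : ∀ u : ℂ, HasDerivAt (fun x : ℝ => u * (x : ℂ)) u x := fun u => by
    simpa using d0.const_mul u
  fin_cases i <;> fin_cases k <;> simp only [coordQ, coordQ'] <;>
    first
    | exact hasDerivAt_const _ _
    | exact d _
    | exact (d _).fun_neg

/-- The chain rule along the profile. -/
theorem hasMatDeriv_comp (hξ : IsProfile ν ξ) {f : ℝ → Matrix (Fin 5) (Fin 5) ℂ}
    {f' : Matrix (Fin 5) (Fin 5) ℂ} {y : ℝ} (s : Set ℝ)
    (hf : ∀ i k, HasDerivAt (fun x => f x i k) (f' i k) (ξ y)) :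
    HasMatDeriv (fun y => f (ξ y)) (((ξ y ^ (ν + 1) * (1 - ξ y) : ℝ) : ℂ) • f') s y := by
  intro i k
  have := (hf i k).scomp y (hξ.hasDerivAt y)
  rw [Matrix.smul_apply, smul_eq_mul, ← Complex.real_smul]
  exact this.hasDerivWithinAt

theorem solW_ode (h : Admissible ν α β γ c A L θ) (hξ : IsProfile ν ξ) {y : ℝ} (hy : θ < ξ y)
    (s : Set ℝ) :
    HasMatDeriv (solW ν ξ α β γ) (-derivTwo (M0 ν (ξ y) α β γ) (solW ν ξ α β γ y)) s y := by
  have hx := hξ.mem_Ioo y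
  have dS := hasMatDeriv_comp hξ s (hasDerivAt_coordS (γ := γ) hx.1 h.alpha_pos h.pos)
  have dU := hasMatDeriv_comp hξ s (hasDerivAt_sumU h ⟨hy, hx.2⟩)
  rw [coordS_intertwining hx.1 h.alpha_pos h.pos, ← opB] at dS
  rw [sumU_matrix_ode h ⟨hy.le, hx.2.le⟩] at dU
  have de : HasDerivAt (fun y : ℝ => Complex.exp (α * mu α β γ * y))
      (Complex.exp (α * mu α β γ * y) * (α * mu α β γ)) y := by
    have := ((hasDerivAt_id (y : ℂ)).const_mul (α * mu α β γ)).cexp.comp_ofReal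
    simpa using this
  have dξ : HasDerivAt (fun y : ℝ => 1 - (ξ y : ℂ))
      (-((ξ y ^ (ν + 1) * (1 - ξ y) : ℝ) : ℂ)) y := (hξ.hasDerivAt y).ofReal_comp.const_sub 1
  have dg := (de.fun_mul dξ).hasDerivWithinAt (s := s)
  have key := HasMatDeriv.smul dg (dS.mapTwo dU)
  refine fun i k => (key i k).congr_deriv ?_
  refine congrFun (congrFun ?_ i) k
  rw [solW]
  generalize coordS (ξ y) α β γ = S
  generalize opB ν (ξ y) α β γ = B
  generalize M0 ν (ξ y) α β γ = M
  generalize sumU ν α β γ (ξ y) = U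
  generalize Complex.exp (α * mu α β γ * y) = E
  simp only [derivTwo, mapTwo, transpose_neg, transpose_add, transpose_mul, Matrix.mul_add,
    Matrix.add_mul, Matrix.mul_neg, Matrix.neg_mul, Matrix.smul_mul, Matrix.mul_smul,
    Matrix.mul_assoc]
  push_cast
  generalize M * (S * (U * Sᵀ)) = X₁
  generalize S * (B * (U * Sᵀ)) = X₂
  generalize S * (U * (Bᵀ * Sᵀ)) = X₃
  generalize S * (U * (Sᵀ * Mᵀ)) = X₄
  generalize S * (U * Sᵀ) = X₅
  ext i k
  simp only [Matrix.add_apply, Matrix.neg_apply, Matrix.smul_apply, smul_eq_mul]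
  ring

theorem exponent_eq (h : Admissible ν α β γ c A L θ) :
    (α : ℂ) * mu α β γ + (α * β - lambdaMinus α β γ) = 1 := by
  rw [lambdaMinus_eq h.toParamBound h.alpha_pos h.mul_ratio_le,
    mu_eq h.toParamBound h.alpha_pos h.mul_ratio_le]
  ring

/-- The eigenvector `F₋(1)`. -/
theorem isVecF_vecSum (h : Admissible ν α β γ c A L θ) :
    IsVecF ν α β γ (((α : ℂ) * β) • (coordS 1 α β γ *ᵥ vecSum α β γ)) := by
  have hα' : (α : ℂ) ≠ 0 := by exact_mod_cast h.alpha_pos.ne'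
  have hβ' : (β : ℂ) ≠ 0 := by exact_mod_cast h.pos.ne'
  constructor
  · have e := coordS_intertwining (ν := ν) (γ := γ) zero_lt_one h.alpha_pos h.pos
    simp only [sub_self, mul_zero, Complex.ofReal_zero, zero_smul, Real.one_rpow,
      Complex.ofReal_one, one_smul] at e
    have e' : -(M0 ν 1 α β γ) * coordS 1 α β γ =
        coordS 1 α β γ * ((α : ℂ) • opN β γ 1 - e44) := by
      rw [Matrix.neg_mul, eq_comm, ← sub_eq_zero]
      rw [zero_eq_neg] at e
      rw [← e]
      abel
    rw [mulVec_smul, mulVec_mulVec, e', ← mulVec_mulVec, mulVec_vecSum h, mulVec_smul, smul_comm]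
  · have h3 := vecSum_three h
    simp [coordS, dotProduct, Fin.sum_univ_succ] at h3 ⊢
    rw [h3]
    field_simp

theorem coordS_mulVec_vecE (x : ℝ) : coordS x α β γ *ᵥ vecE β γ = vecE β γ := by
  ext i
  fin_cases i <;> simp [coordS, vecE, Matrix.mulVec, dotProduct, Fin.sum_univ_succ]

theorem tendsto_mapTwo {f g : ℝ → Matrix (Fin 5) (Fin 5) ℂ} {a b : Matrix (Fin 5) (Fin 5) ℂ}
    {l : Filter ℝ} (hf : ∀ i j, Tendsto (fun y => f y i j) l (𝓝 (a i j)))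
    (hg : ∀ i j, Tendsto (fun y => g y i j) l (𝓝 (b i j))) (i j : Fin 5) :
    Tendsto (fun y => mapTwo (f y) (g y) i j) l (𝓝 (mapTwo a b i j)) := by
  simp only [mapTwo, Matrix.mul_apply, transpose_apply]
  exact tendsto_finsetSum _ fun m _ => (tendsto_finsetSum _ fun n _ =>
    (hf i n).mul (hg n m)).mul (hf j m)

theorem isDecayingSolution_solW (h : Admissible ν α β γ c A L θ) (hξ : IsProfile ν ξ) {ξ₀ : ℝ}
    (h0 : θ < ξ₀) : IsDecayingSolution ν ξ ξ₀ α β γ (solW ν ξ α β γ) where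
  antisymm y hy := by
    have hy' : ξ₀ ≤ ξ y := hy
    rw [solW, transpose_smul, transpose_mapTwo _ _
      (transpose_sumU h ⟨(h0.trans_le hy').le, (hξ.mem_Ioo y).2.le⟩), smul_neg]
  ode y hy i j := solW_ode h hξ (h0.trans_le hy) _ i j
  limit := by
    obtain ⟨C₀, hC, -⟩ := hξ.exists_limit h.exp_pos
    refine ⟨C₀, hC, _, isVecF_vecSum h, fun i j => ?_⟩
    have hα' : (α : ℂ) ≠ 0 := by exact_mod_cast h.alpha_pos.ne'
    have hβ' : (β : ℂ) ≠ 0 := by exact_mod_cast h.pos.ne'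
    have t1 := hξ.tendsto_one h.exp_pos
    have tS : ∀ i j, Tendsto (fun y => coordS (ξ y) α β γ i j) atTop (𝓝 (coordS 1 α β γ i j)) :=
      fun i j => ((hasDerivAt_coordS zero_lt_one h.alpha_pos h.pos i j).continuousAt.tendsto).comp
        t1
    have tU : ∀ i j, Tendsto (fun y => sumU ν α β γ (ξ y) i j) atTop
        (𝓝 (sumU ν α β γ 1 i j)) := fun i j => by
      refine ((continuousOn_sumU h i j) 1 ⟨h.mem_Ioo.2.le, le_rfl⟩).tendsto.comp
        (tendsto_nhdsWithin_iff.2 ⟨t1, ?_⟩)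
      filter_upwards [t1.eventually (lt_mem_nhds h.mem_Ioo.2)] with y hy
      exact ⟨hy.le, (hξ.mem_Ioo y).2.le⟩
    have key := ((Complex.continuous_ofReal.tendsto _).comp hC).mul (tendsto_mapTwo tS tU i j)
    have e : (C₀ : ℂ) / (α * β) * wedge (((α : ℂ) * β) • (coordS 1 α β γ *ᵥ vecSum α β γ))
        (vecE β γ) i j = (C₀ : ℂ) * mapTwo (coordS 1 α β γ) (sumU ν α β γ 1) i j := by
      rw [sumU_one h, mapTwo_wedge, coordS_mulVec_vecE, wedge_apply, wedge_apply]
      simp only [Pi.smul_apply, smul_eq_mul]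
      field_simp
    rw [e]
    refine key.congr fun y => ?_
    have ee := exponent_eq h
    have ex : Complex.exp (α * mu α β γ * y) *
        Complex.exp ((α * β - lambdaMinus α β γ) * y) = Complex.exp y := by
      rw [← Complex.exp_add, ← add_mul, ee, one_mul]
    rw [solW, Matrix.smul_apply, smul_eq_mul]
    simp only [Function.comp_apply]
    push_cast
    rw [← ex]
    ring

end

/-! ### Solutions that tend to `0` of asymptotically autonomous triangular systems -/

/-- A solution of `c' = κ c + h` with `Re κ ≥ 0`, which tends to `0`, is bounded by the integral of
`|h|` to `+∞`. -/
theorem norm_le_of_tendsto_zero {c h : ℝ → ℂ} {κ : ℂ} {Y M : ℝ} (hκ : 0 ≤ κ.re) (hM : 0 ≤ M)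
    (hc : ∀ y ∈ Ici Y, HasDerivWithinAt c (κ * c y + h y) (Ici Y) y)
    (hh : ∀ y ∈ Ici Y, ‖h y‖ ≤ M * Real.exp (-y)) (h0 : Tendsto c atTop (𝓝 0)) :
    ∀ y ∈ Ici Y, ‖c y‖ ≤ M * Real.exp (-y) := by
  intro y hy
  have nexp : ∀ t : ℝ, ‖Complex.exp (-κ * t)‖ = Real.exp (-(κ.re * t)) := fun t => by
    rw [Complex.norm_exp]
    simp
  have step : ∀ T ∈ Ici y, ‖c y‖ ≤ M * Real.exp (-y) + ‖c T‖ := by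
    intro T hT
    have hd : ∀ t ∈ Icc y T, HasDerivWithinAt (fun t : ℝ => Complex.exp (-κ * t) * c t)
        (Complex.exp (-κ * t) * h t) (Ici t) t := by
      intro t ht
      have e : HasDerivAt (fun t : ℝ => Complex.exp (-κ * t)) (Complex.exp (-κ * t) * -κ) t := by
        have := ((hasDerivAt_id (t : ℂ)).const_mul (-κ)).cexp.comp_ofReal
        simpa using this
      have htY : t ∈ Ici Y := le_trans hy ht.1
      have := e.hasDerivWithinAt.fun_mul ((hc t htY).mono (Ici_subset_Ici.2 htY))
      exact this.congr_deriv (by ring)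
    have hcont : ContinuousOn (fun t : ℝ => Complex.exp (-κ * t) * c t) (Icc y T) := by
      refine ContinuousOn.mul (by fun_prop) fun t ht => ?_
      exact (hc t (le_trans hy ht.1)).continuousWithinAt.mono
        (fun s hs => le_trans hy hs.1)
    have key := image_norm_le_of_norm_deriv_right_le_deriv_boundary
      (f := fun t : ℝ => Complex.exp (-κ * t) * c t - Complex.exp (-κ * y) * c y)
      (f' := fun t => Complex.exp (-κ * t) * h t) (a := y) (b := T)
      (B := fun t => Real.exp (-(κ.re * y)) * M * (Real.exp (-y) - Real.exp (-t)))
      (B' := fun t => Real.exp (-(κ.re * y)) * M * Real.exp (-t))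
      (hcont.sub continuousOn_const)
      (fun t ht => (hd t (Ico_subset_Icc_self ht)).sub_const _) (by simp)
      (fun t => by
        have := (((hasDerivAt_neg t).exp).const_sub (Real.exp (-y))).const_mul
          (Real.exp (-(κ.re * y)) * M)
        exact this.congr_deriv (by ring))
      (fun t ht => by
        have a := hh t (le_trans hy ht.1)
        have b : Real.exp (-(κ.re * t)) ≤ Real.exp (-(κ.re * y)) := by
          refine Real.exp_le_exp.2 (neg_le_neg ?_)
          exact mul_le_mul_of_nonneg_left ht.1 hκ
        rw [norm_mul, nexp, mul_assoc]
        gcongr)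
      (x := T) ⟨hT, le_rfl⟩
    have e1 : ‖Complex.exp (-κ * y) * c y‖ ≤
        Real.exp (-(κ.re * y)) * M * (Real.exp (-y) - Real.exp (-T)) +
          ‖Complex.exp (-κ * T) * c T‖ := by
      have := norm_sub_norm_le (Complex.exp (-κ * y) * c y) (Complex.exp (-κ * T) * c T)
      rw [norm_sub_rev] at this
      linarith
    rw [norm_mul, norm_mul, nexp, nexp] at e1
    have p := Real.exp_pos (-(κ.re * y))
    have b : Real.exp (-(κ.re * T)) ≤ Real.exp (-(κ.re * y)) := by
      refine Real.exp_le_exp.2 (neg_le_neg ?_)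
      exact mul_le_mul_of_nonneg_left hT hκ
    have b1 : Real.exp (-(κ.re * T)) * ‖c T‖ ≤ Real.exp (-(κ.re * y)) * ‖c T‖ := by gcongr
    have b2 : 0 ≤ Real.exp (-(κ.re * y)) * M * Real.exp (-T) := by positivity
    refine le_of_mul_le_mul_left ?_ p
    linarith
  have lim : Tendsto (fun T => M * Real.exp (-y) + ‖c T‖) atTop (𝓝 (M * Real.exp (-y) + 0)) :=
    tendsto_const_nhds.add (by simpa using h0.norm)
  rw [add_zero] at lim
  refine ge_of_tendsto lim ?_
  filter_upwards [Ici_mem_atTop y] with T hT using step T hT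

/-- The part of `derivTwo τ` that comes from the diagonal of `τ`, and the rest. -/
theorem derivTwo_lower {τ X : Matrix (Fin 5) (Fin 5) ℂ} (i j : Fin 5) :
    derivTwo τ X i j = (τ i i + τ j j) * X i j +
      (∑ a ∈ Finset.univ.erase i, τ i a * X a j + ∑ a ∈ Finset.univ.erase j, τ j a * X i a) := by
  have e : derivTwo τ X i j = ∑ a, τ i a * X a j + ∑ a, τ j a * X i a := by
    rw [derivTwo, Matrix.add_apply, Matrix.mul_apply, Matrix.mul_apply]
    congr 1
    exact Finset.sum_congr rfl fun a _ => mul_comm _ _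
  rw [e, ← Finset.add_sum_erase _ _ (Finset.mem_univ i),
    ← Finset.add_sum_erase _ (fun a => τ j a * X i a) (Finset.mem_univ j)]
  ring

theorem norm_sum_erase_le {u v : Fin 5 → ℂ} {t b : ℝ} (i : Fin 5) (ht : 0 ≤ t) (hb : 0 ≤ b)
    (h : ∀ a, a ≠ i → ‖u a * v a‖ ≤ t * b) :
    ‖∑ a ∈ Finset.univ.erase i, u a * v a‖ ≤ 5 * (t * b) := by
  refine (norm_sum_le_of_le _ fun a ha => h a (Finset.ne_of_mem_erase ha)).trans ?_
  rw [Finset.sum_const, nsmul_eq_mul]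
  have : ((Finset.univ.erase i).card : ℝ) ≤ 5 := by
    have := Finset.card_erase_le (s := (Finset.univ : Finset (Fin 5))) (a := i)
    simp only [Finset.card_univ, Fintype.card_fin] at this
    exact_mod_cast this
  exact mul_le_mul_of_nonneg_right this (mul_nonneg ht hb)

theorem exists_norm_apply_le (X : Matrix (Fin 5) (Fin 5) ℂ) : ∃ a, 0 ≤ a ∧ ∀ i j, ‖X i j‖ ≤ a :=
  ⟨∑ i, ∑ j, ‖X i j‖, by positivity, fun i j =>
    (Finset.single_le_sum (f := fun j => ‖X i j‖) (fun _ _ => norm_nonneg _)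
      (Finset.mem_univ j)).trans
    (Finset.single_le_sum (f := fun i => ∑ j, ‖X i j‖) (fun _ _ => by positivity)
      (Finset.mem_univ i))⟩

/-- An antisymmetric solution of `Z' = τ Z + Z τᵀ + σ Z + O(e⁻ʸ) Z`, with `τ` lower triangular,
which tends to `0`, vanishes for large `y` if `Re (τᵢᵢ + τⱼⱼ + σ) ≥ 0` for `i ≠ j`: by induction
along the triangular structure, a bound `G` of the solution on `[Y, ∞)` improves to `C G e⁻ʸ`. -/
theorem eventually_eq_zero_of_lower {Z E : ℝ → Matrix (Fin 5) (Fin 5) ℂ}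
    {τ : Matrix (Fin 5) (Fin 5) ℂ} {σ : ℂ} {Y₀ M : ℝ} (hM : 0 ≤ M)
    (hτ : ∀ i a, i < a → τ i a = 0) (hre : ∀ i j, i ≠ j → 0 ≤ (τ i i + τ j j + σ).re)
    (hZ : ∀ y ∈ Ici Y₀, (Z y)ᵀ = -Z y)
    (hd : ∀ y ∈ Ici Y₀, HasMatDeriv Z (derivTwo τ (Z y) + σ • Z y + E y) (Ici Y₀) y)
    (hE : ∀ y ∈ Ici Y₀, ∀ G, (∀ i j, ‖Z y i j‖ ≤ G) → ∀ i j, ‖E y i j‖ ≤ M * G * Real.exp (-y))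
    (h0 : ∀ i j, Tendsto (fun y => Z y i j) atTop (𝓝 0)) :
    ∃ Y, ∀ y ∈ Ici Y, Z y = 0 := by
  obtain ⟨t, ht0, ht⟩ := exists_norm_apply_le τ
  have diag : ∀ y ∈ Ici Y₀, ∀ i, Z y i i = 0 := by
    intro y hy i
    have := congrFun (congrFun (hZ y hy) i) i
    rw [transpose_apply, Matrix.neg_apply] at this
    linear_combination this / 2
  have main : ∀ m : ℕ, ∃ C : ℝ, 0 ≤ C ∧ ∀ i j : Fin 5, (i : ℕ) + j < m → ∀ Y ∈ Ici Y₀, ∀ G : ℝ,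
      0 ≤ G → (∀ y ∈ Ici Y, ∀ i j, ‖Z y i j‖ ≤ G) →
      ∀ y ∈ Ici Y, ‖Z y i j‖ ≤ C * G * Real.exp (-y) := by
    intro m
    induction m with
    | zero => exact ⟨0, le_rfl, fun i j h => absurd h (Nat.not_lt_zero _)⟩
    | succ m ih =>
      obtain ⟨C, hC, ih⟩ := ih
      refine ⟨C + 10 * t * C + M, by positivity, fun i j hij Y hY G hG hb => ?_⟩
      by_cases eij : i = j
      · subst eij
        intro y hy
        rw [diag y (mem_Ici.2 ((mem_Ici.1 hY).trans (mem_Ici.1 hy))) i, norm_zero]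
        positivity
      have hY' : ∀ y ∈ Ici Y, y ∈ Ici Y₀ := fun y hy =>
        mem_Ici.2 ((mem_Ici.1 hY).trans (mem_Ici.1 hy))
      have lower : ∀ y ∈ Ici Y, ‖(∑ a ∈ Finset.univ.erase i, τ i a * Z y a j +
          ∑ a ∈ Finset.univ.erase j, τ j a * Z y i a) + E y i j‖ ≤
          (10 * t * C + M) * G * Real.exp (-y) := by
        intro y hy
        have b0 : 0 ≤ C * G * Real.exp (-y) := by positivity
        have b1 := norm_sum_erase_le (u := τ i) (v := fun a => Z y a j) i ht0 b0 fun a ha => by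
          rcases lt_or_gt_of_ne ha with h | h
          · rw [norm_mul]
            have h' : (a : ℕ) < i := h
            exact mul_le_mul (ht i a) (ih a j (by omega) Y hY G hG hb y hy) (norm_nonneg _) ht0
          · rw [hτ i a h, zero_mul, norm_zero]
            positivity
        have b2 := norm_sum_erase_le (u := τ j) (v := fun a => Z y i a) j ht0 b0 fun a ha => by
          rcases lt_or_gt_of_ne ha with h | h
          · rw [norm_mul]
            have h' : (a : ℕ) < j := h
            exact mul_le_mul (ht j a) (ih i a (by omega) Y hY G hG hb y hy) (norm_nonneg _) ht0
          · rw [hτ j a h, zero_mul, norm_zero]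
            positivity
        have b3 := hE y (hY' y hy) G (hb y hy) i j
        refine (norm_add_le _ _).trans ((add_le_add (norm_add_le _ _) b3).trans ?_)
        linarith
      have key := norm_le_of_tendsto_zero (c := fun y => Z y i j)
        (h := fun y => (∑ a ∈ Finset.univ.erase i, τ i a * Z y a j +
          ∑ a ∈ Finset.univ.erase j, τ j a * Z y i a) + E y i j)
        (κ := τ i i + τ j j + σ) (Y := Y) (M := (10 * t * C + M) * G) (hre i j eij)
        (by positivity) (fun y hy => by
          refine ((hd y (hY' y hy) i j).mono (Ici_subset_Ici.2 hY)).congr_deriv ?_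
          rw [Matrix.add_apply, Matrix.add_apply, derivTwo_lower, Matrix.smul_apply, smul_eq_mul]
          ring) lower (h0 i j)
      intro y hy
      refine (key y hy).trans ?_
      have : 0 ≤ C * G * Real.exp (-y) := by positivity
      linarith
  obtain ⟨C, hC, hmain⟩ := main 9
  have hsum : ∀ i j : Fin 5, (i : ℕ) + j < 9 := fun i j => by omega
  obtain ⟨Y, hY⟩ : ∃ Y, Y₀ ≤ Y ∧ C * Real.exp (-Y) ≤ 1 / 2 ∧
      ∀ y ∈ Ici Y, ∀ i j, ‖Z y i j‖ ≤ 1 := by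
    have l1 : Tendsto (fun y => C * Real.exp (-y)) atTop (𝓝 (C * 0)) :=
      (Real.tendsto_exp_atBot.comp tendsto_neg_atTop_atBot).const_mul C
    rw [mul_zero] at l1
    have l2 : ∀ᶠ y in atTop, ∀ i j, ‖Z y i j‖ ≤ 1 := by
      refine eventually_all.2 fun i => eventually_all.2 fun j => ?_
      have := (h0 i j).norm
      rw [norm_zero] at this
      exact this.eventually (ge_mem_nhds zero_lt_one)
    have l3 : ∀ᶠ Y in atTop, ∀ y ∈ Ici Y, ∀ i j, ‖Z y i j‖ ≤ 1 :=
      eventually_forall_ge_atTop.2 l2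
    exact ((eventually_ge_atTop Y₀).and
      ((l1.eventually (ge_mem_nhds (by norm_num))).and l3)).exists
  obtain ⟨hY0, hYC, hY1⟩ := hY
  have iter : ∀ n : ℕ, ∀ y ∈ Ici Y, ∀ i j, ‖Z y i j‖ ≤ (1 / 2) ^ n := by
    intro n
    induction n with
    | zero => simpa using hY1
    | succ n ih =>
      intro y hy i j
      have h := hmain i j (hsum i j) Y hY0 _ (by positivity) ih y hy
      have e : Real.exp (-y) ≤ Real.exp (-Y) := Real.exp_le_exp.2 (neg_le_neg hy)
      calc _ ≤ C * (1 / 2) ^ n * Real.exp (-y) := h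
        _ ≤ C * (1 / 2) ^ n * Real.exp (-Y) := by gcongr
        _ = (1 / 2) ^ n * (C * Real.exp (-Y)) := by ring
        _ ≤ (1 / 2) ^ n * (1 / 2) := by gcongr
        _ = _ := (pow_succ _ _).symm
  refine ⟨Y, fun y hy => ?_⟩
  ext i j
  have : ‖Z y i j‖ ≤ 0 :=
    ge_of_tendsto' (tendsto_pow_atTop_nhds_zero_of_lt_one (by norm_num)
      (by norm_num : (1 / 2 : ℝ) < 1))
      fun n => iter n y hy i j
  simpa using this

/-! ### Triangular form of the system at `ξ = 1` -/

/-- The coefficient `s = 1 / (l - α γ)` of the inverse of `flagP`. -/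
def flagS (α : ℝ) (γ l : ℂ) : ℂ := (l - α * γ)⁻¹

/-- The rows of this matrix are linear forms, the first `m` of which span a subspace that is
invariant under the transpose of `opB ν 1 α β γ`, for each `m`; here `l = λ₋(1)`. -/
def flagP (α β : ℝ) (γ l : ℂ) : Matrix (Fin 5) (Fin 5) ℂ :=
  !![-(α * β), 0, 0, l - α * γ, α * β;
     1, 0, 0, 0, -1;
     γ - 2 * β, -β, β, 0, 0;
     γ + 2 * β, β, β, 0, 0;
     1, 0, 0, 0, 0]

/-- The inverse of `flagP`. -/
def flagR (α β : ℝ) (γ l : ℂ) : Matrix (Fin 5) (Fin 5) ℂ :=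
  !![0, 0, 0, 0, 1;
     0, 0, -(1 / (2 * β)), 1 / (2 * β), -2;
     0, 0, 1 / (2 * β), 1 / (2 * β), -(γ / β);
     flagS α γ l, α * β * flagS α γ l, 0, 0, 0;
     0, -1, 0, 0, 1]

/-- The lower triangular matrix of `opB ν 1 α β γ` in the coordinates given by `flagP`. -/
def flagT (α β : ℝ) (γ l : ℂ) : Matrix (Fin 5) (Fin 5) ℂ :=
  let s := flagS α γ l
  let r : ℂ := α * (γ ^ 2 - β ^ 2) / β
  let p : ℂ := α * ((γ - 2 * β) * (γ ^ 2 - β ^ 2) / β - β * (β + (1 / β - γ) * γ / β) - 1)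
  let p' : ℂ := α * ((γ + 2 * β) * (γ ^ 2 - β ^ 2) / β + β * (β + (1 / β - γ) * γ / β) - 1)
  !![l, 0, 0, 0, 0;
     r * s, -1 - l, 0, 0, 0;
     p * s, α * ((γ - β) ^ 2 - 1) + p * (α * β) * s, α * β, 0, 0;
     p' * s, α * (γ ^ 2 + 2 * β * γ + 1 + β ^ 2) + p' * (α * β) * s, 0, -(α * β), 0;
     r * s, α * γ + r * (α * β) * s, -(α / 2), -(α / 2), α * γ]

section

variable {ν α β : ℝ} {γ l : ℂ}

theorem flagR_mul_flagP (hβ : 0 < β) (hl : l - α * γ ≠ 0) :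
    flagR α β γ l * flagP α β γ l = 1 := by
  have hβ' : (β : ℂ) ≠ 0 := by exact_mod_cast hβ.ne'
  have hs : flagS α γ l * (l - α * γ) = 1 := inv_mul_cancel₀ hl
  rw [flagR, flagP]
  generalize flagS α γ l = s at hs
  ext i k
  rw [Matrix.mul_apply, Fin.sum_univ_five]
  fin_cases i <;> fin_cases k <;> simp
  all_goals first
    | exact hs
    | ring1
    | (field_simp; done)
    | (field_simp; ring1)

set_option maxHeartbeats 1000000 in
theorem flagP_mul_opB (hβ : 0 < β) (hl : l - α * γ ≠ 0)
    (hq : l ^ 2 + l = α * γ + (α : ℂ) ^ 2 * β ^ 2) :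
    flagP α β γ l * opB ν 1 α β γ = flagT α β γ l * flagP α β γ l := by
  have hβ' : (β : ℂ) ≠ 0 := by exact_mod_cast hβ.ne'
  have hs : flagS α γ l * (l - α * γ) = 1 := inv_mul_cancel₀ hl
  rw [opB, Complex.ofReal_one, opN_eq one_ne_zero, flagP, flagT, e44_eq, Real.one_rpow]
  generalize flagS α γ l = s at hs
  have hr : α * (γ ^ 2 - β ^ 2) / β * s * (α * β) = -(l + 1 + α * γ) := by
    have : α * (γ ^ 2 - β ^ 2) / β * s * (α * β) = s * ((α : ℂ) ^ 2 * (γ ^ 2 - β ^ 2)) := by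
      field_simp
    rw [this]
    linear_combination (-(l + 1 + α * γ)) * hs + s * hq
  ext i k
  rw [Matrix.mul_apply, Matrix.mul_apply, Fin.sum_univ_five, Fin.sum_univ_five]
  fin_cases i <;> fin_cases k <;> simp
  all_goals first
    | done
    | ring1
    | (field_simp; done)
    | (rw [mul_assoc _ s, hs, mul_one]; first | ring1 | (field_simp; ring1))
    | linear_combination hr
    | linear_combination -hr
    | (field_simp; first | ring1 | linear_combination -hq)

end

/-! ### Uniqueness of the decaying solution -/

section

variable {ν α β c A L θ : ℝ} {γ : ℂ} {ξ : ℝ → ℝ}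

theorem Admissible.mul_le (h : Admissible ν α β γ c A L θ) : α * c ≤ 1 / 32 := by
  have := mul_le_mul_of_nonneg_left h.le_ratio h.alpha_pos.le
  linarith [h.mul_ratio_le]

theorem Admissible.mul_beta_le (h : Admissible ν α β γ c A L θ) : α * β ≤ 1 / 32 := by
  have : β ≤ c := by linarith [h.le, norm_nonneg γ]
  exact (mul_le_mul_of_nonneg_left this h.alpha_pos.le).trans h.mul_le

theorem Admissible.norm_mul_gamma_le (h : Admissible ν α β γ c A L θ) :
    ‖(α : ℂ) * γ‖ ≤ 1 / 32 := by
  have : ‖γ‖ ≤ c := by linarith [h.le, h.pos]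
  rw [norm_mul, Complex.norm_real, Real.norm_eq_abs, abs_of_pos h.alpha_pos]
  exact (mul_le_mul_of_nonneg_left this h.alpha_pos.le).trans h.mul_le

theorem lambdaMinus_quadratic (h : Admissible ν α β γ c A L θ) :
    lambdaMinus α β γ ^ 2 + lambdaMinus α β γ = α * γ + (α : ℂ) ^ 2 * β ^ 2 := by
  rw [lambdaMinus_eq h.toParamBound h.alpha_pos h.mul_ratio_le]
  linear_combination (α : ℂ) * etaSum_eq h.toParamBound h.alpha_pos h.mul_ratio_le

theorem norm_lambdaMinus_add_one_le (h : Admissible ν α β γ c A L θ) :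
    ‖lambdaMinus α β γ + 1‖ ≤ 1 / 16 := by
  rw [lambdaMinus_eq h.toParamBound h.alpha_pos h.mul_ratio_le]
  have e : -1 - (α : ℂ) * etaSum α β γ + 1 = -(α * etaSum α β γ) := by ring
  rw [e, norm_neg]
  exact norm_mul_etaSum_le h.toParamBound h.alpha_pos h.mul_ratio_le

theorem le_norm_lambdaMinus (h : Admissible ν α β γ c A L θ) : 15 / 16 ≤ ‖lambdaMinus α β γ‖ := by
  have h1 := norm_lambdaMinus_add_one_le h
  have h2 := norm_sub_le (lambdaMinus α β γ + 1) (lambdaMinus α β γ)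
  rw [add_sub_cancel_left, norm_one] at h2
  linarith

theorem lambdaMinus_sub_ne_zero (h : Admissible ν α β γ c A L θ) :
    lambdaMinus α β γ - α * γ ≠ 0 := by
  intro e
  rw [sub_eq_zero] at e
  have h1 := le_norm_lambdaMinus h
  rw [e] at h1
  linarith [h.norm_mul_gamma_le]

theorem re_lambdaMinus_add_one_le (h : Admissible ν α β γ c A L θ) (hγ : -β < γ.re) :
    (lambdaMinus α β γ + 1).re ≤ α * β := by
  have hb := (Complex.abs_re_le_norm _).trans (norm_lambdaMinus_add_one_le h)
  have hq := congrArg Complex.re (lambdaMinus_quadratic h)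
  generalize lambdaMinus α β γ = l at hb hq
  simp only [Complex.add_re, Complex.one_re, Complex.mul_re, Complex.ofReal_re, Complex.ofReal_im,
    pow_two, zero_mul, sub_zero, mul_zero, Complex.mul_im, add_zero] at hb hq ⊢
  have h2 := h.mul_beta_le
  have h3 := mul_lt_mul_of_pos_left hγ h.alpha_pos
  rw [abs_le] at hb
  by_contra hlt
  push Not at hlt
  -- with `κ = -1 - l`, the quadratic equation gives `(Re κ + α β) (Re κ - α β + 1) > 0`
  have h4 : 0 < (l.re + 1 - α * β) * (1 - (l.re + 1) - α * β) :=
    mul_pos (by linarith) (by linarith)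
  nlinarith [mul_self_nonneg l.im]

theorem flagT_self (l : ℂ) (i : Fin 5) :
    flagT α β γ l i i = ![l, -1 - l, α * β, -(α * β), α * γ] i := by
  fin_cases i <;> simp [flagT]

theorem flagT_of_lt (l : ℂ) {i a : Fin 5} (h : i < a) : flagT α β γ l i a = 0 := by
  revert h
  fin_cases i <;> fin_cases a <;> simp [flagT]

theorem re_flagT_nonneg (h : Admissible ν α β γ c A L θ) (hγ : -β < γ.re) {i j : Fin 5}
    (hij : i ≠ j) :
    0 ≤ (flagT α β γ (lambdaMinus α β γ) i i + flagT α β γ (lambdaMinus α β γ) j j +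
      (α * β - lambdaMinus α β γ)).re := by
  have h1 := re_lambdaMinus_add_one_le h hγ
  have h2 := (abs_le.1 ((Complex.abs_re_le_norm _).trans h.norm_mul_gamma_le))
  have h3 := h.mul_beta_le
  have h4 := mul_pos h.alpha_pos h.pos
  have h5 := mul_lt_mul_of_pos_left hγ h.alpha_pos
  have h6 := (abs_le.1 ((Complex.abs_re_le_norm _).trans (norm_lambdaMinus_add_one_le h)))
  rw [flagT_self, flagT_self]
  generalize lambdaMinus α β γ = l at h1 h6
  simp only [Complex.add_re, Complex.one_re, Complex.mul_re, Complex.ofReal_re, Complex.ofReal_im,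
    zero_mul, sub_zero] at h1 h2 h6
  revert hij
  fin_cases i <;> fin_cases j <;> simp <;> linarith

/-- The eigenvector `F₋(1)` is unique. -/
theorem IsVecF.unique (h : Admissible ν α β γ c A L θ) {F F' : Fin 5 → ℂ}
    (hF : IsVecF ν α β γ F) (hF' : IsVecF ν α β γ F') : F' = F := by
  have e := coordQ_intertwining (ν := ν) (γ := γ) zero_lt_one h.alpha_pos h.pos
  rw [sub_self, mul_zero, Complex.ofReal_zero, zero_smul] at e
  have e1 : coordQ 1 α β γ * -M0 ν 1 α β γ = opB ν 1 α β γ * coordQ 1 α β γ := by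
    rw [Matrix.mul_neg, neg_eq_iff_add_eq_zero, ← e]
  have hd : -M0 ν 1 α β γ *ᵥ (F' - F) = lambdaMinus α β γ • (F' - F) := by
    rw [mulVec_sub, hF.1, hF'.1, smul_sub]
  set G := coordQ 1 α β γ *ᵥ (F' - F) with hG
  have h3 : G 3 = 0 := by
    have := hF'.2.trans hF.2.symm
    simp [hG, coordQ, dotProduct, Fin.sum_univ_succ, this]
  have hBG : (α : ℂ) • (opN β γ 1 *ᵥ G) = lambdaMinus α β γ • G := by
    have : opB ν 1 α β γ *ᵥ G = lambdaMinus α β γ • G := by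
      rw [hG, mulVec_mulVec, ← e1, ← mulVec_mulVec, hd, mulVec_smul]
    rw [← this, opB, sub_mulVec, smul_mulVec, smul_mulVec, e44_mulVec, h3, Pi.single_zero,
      smul_zero, sub_zero, Complex.ofReal_one]
  have c0 := h.nonneg
  have bN : ‖opN β γ 1 *ᵥ G‖ ≤ 10 * c * ‖G‖ := by
    refine (pi_norm_le_iff_of_nonneg (by positivity)).2 fun i => ?_
    have : ‖∑ k, opN β γ 1 i k * G k‖ ≤ ∑ _k : Fin 5, 2 * c * ‖G‖ := by
      refine norm_sum_le_of_le _ fun k _ => ?_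
      rw [norm_mul, opN_one, Matrix.add_apply]
      have := (norm_add_le (coeffA β γ i k) (coeffB β γ i k)).trans
        (add_le_add (h.coeffA_le i k) (h.coeffB_le i k))
      exact mul_le_mul (by linarith) (norm_le_pi_norm G k) (norm_nonneg _) (by linarith)
    refine this.trans (le_of_eq ?_)
    simp only [Finset.sum_const, Finset.card_univ, Fintype.card_fin, nsmul_eq_mul]
    push_cast
    ring
  have hn := congrArg norm hBG
  rw [norm_smul, norm_smul, Complex.norm_real, Real.norm_eq_abs, abs_of_pos h.alpha_pos] at hn
  have G0 : G = 0 := by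
    rw [← norm_eq_zero]
    have h4 := mul_le_mul_of_nonneg_right (le_norm_lambdaMinus h) (norm_nonneg G)
    have h5 := mul_le_mul_of_nonneg_left bN h.alpha_pos.le
    have h6 := mul_le_mul_of_nonneg_right h.mul_le (norm_nonneg G)
    have h7 := norm_nonneg G
    linarith
  have hS := mul_eq_one_comm.1 (coordQ_mul_coordS (γ := γ) zero_lt_one h.alpha_pos h.pos)
  have : F' - F = 0 := by
    rw [← one_mulVec (F' - F), ← hS, ← mulVec_mulVec, ← hG, G0, mulVec_zero]
  exact sub_eq_zero.1 this

theorem exists_norm_opB_sub_le (hν : 0 < ν) (hθ : θ ∈ Ioo (0 : ℝ) 1) (α β : ℝ) (γ : ℂ) :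
    ∃ M, 0 ≤ M ∧ ∀ x ∈ Icc θ 1, ∀ i k, ‖opB ν x α β γ i k - opB ν 1 α β γ i k‖ ≤ M * (1 - x) := by
  have hN : ∀ i k, ∃ C, ∀ x ∈ Icc θ 1, ‖opN β γ x i k - opN β γ (1 : ℝ) i k‖ ≤ C * (1 - x) := by
    intro i k
    have mem : ∀ t ∈ Icc θ 1, (t : ℂ) ∈ unitDisc := fun t ht =>
      ofReal_mem_unitDisc ⟨hθ.1.trans_le ht.1, ht.2⟩
    have cont : ContinuousOn (fun t : ℝ => deriv (fun z => opN β γ z i k) t) (Icc θ 1) :=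
      (diffOn_deriv (diffOn_opN i k)).continuousOn.comp Complex.continuous_ofReal.continuousOn mem
    obtain ⟨C, hC⟩ := isCompact_Icc.exists_bound_of_continuousOn cont
    refine ⟨C, fun x hx => ?_⟩
    refine norm_le_mul_one_sub (F := fun z => opN β γ z i k - opN β γ (1 : ℝ) i k)
      (f := deriv fun z => opN β γ z i k) ⟨hθ.1.trans_le hx.1, hx.2⟩ (fun t ht =>
      (hasDerivAt_of_diffOn (diffOn_opN i k) (ofReal_mem_unitDisc ht)).sub_const _) (by simp)
      fun t ht => hC t ⟨hx.1.trans ht.1, ht.2⟩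
  choose C hC using hN
  refine ⟨|α| * ∑ i, ∑ k, |C i k| + (ν + 1), by positivity, fun x hx i k => ?_⟩
  have hx' : x ∈ Ioc (0 : ℝ) 1 := ⟨hθ.1.trans_le hx.1, hx.2⟩
  have x1 : 0 ≤ 1 - x := by linarith [hx.2]
  have e : opB ν x α β γ i k - opB ν 1 α β γ i k =
      α * (opN β γ x i k - opN β γ (1 : ℝ) i k) + ((1 - x ^ (ν + 1) : ℝ) : ℂ) * e44 i k := by
    simp only [opB, Matrix.sub_apply, Matrix.smul_apply, smul_eq_mul, Real.one_rpow]
    push_cast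
    ring
  have h1 : C i k ≤ ∑ i, ∑ k, |C i k| :=
    (le_abs_self _).trans ((Finset.single_le_sum (f := fun k => |C i k|)
      (fun _ _ => abs_nonneg _) (Finset.mem_univ k)).trans
      (Finset.single_le_sum (f := fun i => ∑ k, |C i k|) (fun _ _ => by positivity)
        (Finset.mem_univ i)))
  have h2 : ‖e44 i k‖ ≤ 1 := by
    rw [e44, Matrix.single_apply]
    split_ifs <;> simp
  have h3 : 0 ≤ 1 - x ^ (ν + 1) := by
    linarith [Real.rpow_le_one hx'.1.le hx'.2 (by linarith : 0 ≤ ν + 1)]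
  rw [e]
  refine (norm_add_le _ _).trans ?_
  rw [norm_mul, norm_mul, Complex.norm_real, Complex.norm_real, Real.norm_eq_abs, Real.norm_eq_abs,
    abs_of_nonneg h3, add_mul, mul_assoc]
  refine add_le_add ?_ ?_
  · exact mul_le_mul_of_nonneg_left ((hC i k x hx).trans (mul_le_mul_of_nonneg_right h1 x1))
      (abs_nonneg _)
  · exact (mul_le_of_le_one_right h3 h2).trans (one_sub_rpow_succ_le hν hx')

theorem norm_mul_apply_le {X Y : Matrix (Fin 5) (Fin 5) ℂ} {a b : ℝ} (ha : ∀ i j, ‖X i j‖ ≤ a)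
    (hb : ∀ i j, ‖Y i j‖ ≤ b) (i j : Fin 5) : ‖(X * Y) i j‖ ≤ 5 * a * b := by
  rw [Matrix.mul_apply]
  have : ‖∑ k, X i k * Y k j‖ ≤ ∑ _k : Fin 5, a * b := by
    refine norm_sum_le_of_le _ fun k _ => ?_
    rw [norm_mul]
    exact mul_le_mul (ha i k) (hb k j) (norm_nonneg _) ((norm_nonneg _).trans (ha i k))
  refine this.trans (le_of_eq ?_)
  simp only [Finset.sum_const, Finset.card_univ, Fintype.card_fin, nsmul_eq_mul]
  push_cast
  ring

theorem norm_mapTwo_apply_le {X Y : Matrix (Fin 5) (Fin 5) ℂ} {a b : ℝ} (ha : ∀ i j, ‖X i j‖ ≤ a)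
    (hb : ∀ i j, ‖Y i j‖ ≤ b) (i j : Fin 5) : ‖mapTwo X Y i j‖ ≤ 25 * a ^ 2 * b := by
  refine (norm_mul_apply_le (norm_mul_apply_le ha hb) (fun i j => ha j i) i j).trans (le_of_eq ?_)
  ring

theorem norm_derivTwo_apply_le {X Y : Matrix (Fin 5) (Fin 5) ℂ} {a b : ℝ}
    (ha : ∀ i j, ‖X i j‖ ≤ a) (hb : ∀ i j, ‖Y i j‖ ≤ b) (i j : Fin 5) :
    ‖derivTwo X Y i j‖ ≤ 10 * a * b := by
  have h1 := norm_mul_apply_le ha hb i j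
  have h2 : ‖(Y * Xᵀ) i j‖ ≤ 5 * b * a := norm_mul_apply_le hb (fun i j => ha j i) i j
  rw [derivTwo, Matrix.add_apply]
  refine (norm_add_le _ _).trans ?_
  linarith

theorem mapTwo_mapTwo (S T X : Matrix (Fin 5) (Fin 5) ℂ) :
    mapTwo S (mapTwo T X) = mapTwo (S * T) X := by
  simp only [mapTwo, transpose_mul, Matrix.mul_assoc]

theorem mapTwo_one (X : Matrix (Fin 5) (Fin 5) ℂ) : mapTwo 1 X = X := by
  simp [mapTwo]

theorem mapTwo_zero (S : Matrix (Fin 5) (Fin 5) ℂ) : mapTwo S 0 = 0 := by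
  simp [mapTwo]

end

/-- Backward uniqueness for the linear system `V' = B V + V Bᵀ + σ V`. -/
theorem eq_zero_of_right_eq_zero {V B : ℝ → Matrix (Fin 5) (Fin 5) ℂ} {σ : ℂ} {a b C : ℝ}
    (hC : 0 ≤ C) (hB : ∀ t ∈ Icc a b, ∀ i j, ‖B t i j‖ ≤ C)
    (hV : ∀ t ∈ Icc a b, HasMatDeriv V (derivTwo (B t) (V t) + σ • V t) (Icc a b) t)
    (hb : V b = 0) : ∀ t ∈ Icc a b, V t = 0 := by
  set v : ℝ → (Fin 5 → Fin 5 → ℂ) → Fin 5 → Fin 5 → ℂ :=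
    fun t X => derivTwo (B t) (of X) + σ • of X with hv
  have hd : ∀ t ∈ Icc a b, HasDerivWithinAt (F := Fin 5 → Fin 5 → ℂ) (fun t => V t)
      (v t (V t)) (Icc a b) t := fun t ht =>
    hasDerivWithinAt_pi.2 fun i => hasDerivWithinAt_pi.2 fun j => hV t ht i j
  have hv0 : ∀ t, v t 0 = 0 := by
    intro t
    ext i j
    simp [hv, derivTwo]
  have key := ODE_solution_unique_of_mem_Icc_left (E := Fin 5 → Fin 5 → ℂ) (v := v)
    (s := fun _ => univ) (K := (10 * C + ‖σ‖).toNNReal) (f := fun t => V t) (g := fun _ => 0)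
    (a := a) (b := b)
    (fun t ht => by
      refine (LipschitzWith.of_dist_le_mul fun X Y => ?_).lipschitzOnWith
      have e : v t X - v t Y = v t (X - Y) := by
        ext i j
        change (derivTwo (B t) (of X) + σ • of X) i j - (derivTwo (B t) (of Y) + σ • of Y) i j =
          (derivTwo (B t) (of (X - Y)) + σ • of (X - Y)) i j
        simp only [derivTwo, Pi.sub_apply, Matrix.add_apply, Matrix.mul_apply,
          of_apply, Matrix.smul_apply, smul_eq_mul, mul_sub, sub_mul, Finset.sum_sub_distrib]
        ring
      rw [dist_eq_norm, dist_eq_norm, e, Real.coe_toNNReal _ (by positivity)]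
      have hn : ∀ i j, ‖(of (X - Y)) i j‖ ≤ ‖X - Y‖ := fun i j =>
        (norm_le_pi_norm _ j).trans (norm_le_pi_norm (X - Y) i)
      refine (pi_norm_le_iff_of_nonneg (by positivity)).2 fun i =>
        (pi_norm_le_iff_of_nonneg (by positivity)).2 fun j => ?_
      have h1 := norm_derivTwo_apply_le (hB t (Ioc_subset_Icc_self ht)) hn i j
      have h2 : ‖(σ • of (X - Y)) i j‖ ≤ ‖σ‖ * ‖X - Y‖ := by
        rw [Matrix.smul_apply, norm_smul]
        exact mul_le_mul_of_nonneg_left (hn i j) (norm_nonneg _)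
      rw [add_mul]
      exact (norm_add_le _ _).trans (add_le_add h1 h2))
    (fun t ht => (hd t ht).continuousWithinAt)
    (fun t ht => (hd t (Ioc_subset_Icc_self ht)).mono_of_mem_nhdsWithin
      (Icc_mem_nhdsLE_of_mem ht))
    (fun _ _ => mem_univ _) continuousOn_const
    (fun t _ => by
      simp only [hv0]
      exact hasDerivWithinAt_const _ _ _)
    (fun _ _ => mem_univ _) hb
  exact fun t ht => key ht

section

variable {ν α β c A L θ ξ₀ : ℝ} {γ : ℂ} {ξ : ℝ → ℝ}

theorem IsProfile.Ici_subset_region (hξ : IsProfile ν ξ) {y : ℝ} (hy : y ∈ region ξ ξ₀) :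
    Ici y ⊆ region ξ ξ₀ := fun _ ht => le_trans (b := ξ y) hy (hξ.monotone ht)

/-- The system in the regular coordinates. -/
theorem hasMatDeriv_regular (hξ : IsProfile ν ξ) (hα : 0 < α) (hβ : 0 < β) (σ : ℂ)
    {D : ℝ → Matrix (Fin 5) (Fin 5) ℂ} {s : Set ℝ} {y : ℝ}
    (hD : HasMatDeriv D (-derivTwo (M0 ν (ξ y) α β γ) (D y)) s y) :
    HasMatDeriv (fun y : ℝ => Complex.exp (σ * y) • mapTwo (coordQ (ξ y) α β γ) (D y))
      (derivTwo (opB ν (ξ y) α β γ) (Complex.exp (σ * y) • mapTwo (coordQ (ξ y) α β γ) (D y)) +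
        σ • (Complex.exp (σ * y) • mapTwo (coordQ (ξ y) α β γ) (D y))) s y := by
  have dQ := hasMatDeriv_comp hξ s (hasDerivAt_coordQ (α := α) (β := β) (γ := γ) (ξ y))
  rw [coordQ_intertwining (hξ.mem_Ioo y).1 hα hβ] at dQ
  have de : HasDerivAt (fun y : ℝ => Complex.exp (σ * y)) (Complex.exp (σ * y) * σ) y := by
    have := ((hasDerivAt_id (y : ℂ)).const_mul σ).cexp.comp_ofReal
    simpa using this
  have key := HasMatDeriv.smul (de.hasDerivWithinAt (s := s)) (dQ.mapTwo hD)
  refine fun i k => (key i k).congr_deriv ?_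
  refine congrFun (congrFun ?_ i) k
  generalize coordQ (ξ y) α β γ = S
  generalize opB ν (ξ y) α β γ = B
  generalize M0 ν (ξ y) α β γ = M
  generalize D y = U
  generalize Complex.exp (σ * y) = E
  simp only [derivTwo, mapTwo, transpose_add, transpose_mul, Matrix.mul_add,
    Matrix.add_mul, Matrix.mul_neg, Matrix.neg_mul, Matrix.smul_mul, Matrix.mul_smul,
    Matrix.mul_assoc, neg_add]
  generalize S * (M * (U * Sᵀ)) = X₁
  generalize B * (S * (U * Sᵀ)) = X₂
  generalize S * (U * (Mᵀ * Sᵀ)) = X₃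
  generalize S * (U * (Sᵀ * Bᵀ)) = X₄
  generalize S * (U * Sᵀ) = X₅
  ext i k
  simp only [Matrix.add_apply, Matrix.neg_apply, Matrix.smul_apply, smul_eq_mul]
  ring

/-- The difference of two normalized decaying solutions, in the regular coordinates, vanishes for
large `y`. -/
theorem eventually_eq_zero_of_tendsto (h : Admissible ν α β γ c A L θ) (hξ : IsProfile ν ξ)
    (hγ : -β < γ.re) {V : ℝ → Matrix (Fin 5) (Fin 5) ℂ} {Y₀ : ℝ} (hY₀ : θ ≤ ξ Y₀)
    (hV : ∀ y ∈ Ici Y₀, (V y)ᵀ = -V y)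
    (hd : ∀ y ∈ Ici Y₀, HasMatDeriv V (derivTwo (opB ν (ξ y) α β γ) (V y) +
      (α * β - lambdaMinus α β γ) • V y) (Ici Y₀) y)
    (h0 : ∀ i j, Tendsto (fun y => V y i j) atTop (𝓝 0)) :
    ∃ Y, ∀ y ∈ Ici Y, V y = 0 := by
  have hl := lambdaMinus_sub_ne_zero h
  have hq := lambdaMinus_quadratic h
  have hT := fun {i j : Fin 5} => re_flagT_nonneg h hγ (i := i) (j := j)
  generalize lambdaMinus α β γ = l at hl hq hT hd
  obtain ⟨M, hM, hB⟩ := exists_norm_opB_sub_le h.exp_pos h.mem_Ioo α β γ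
  obtain ⟨C₀, -, hC₀⟩ := hξ.exists_limit h.exp_pos
  have C₀0 : 0 ≤ C₀ := by
    have := (hξ.mem_Ioo 0).2
    have := hC₀ 0
    rw [neg_zero, Real.exp_zero, mul_one] at this
    linarith
  have hRP := flagR_mul_flagP h.pos hl
  have hPT := flagP_mul_opB (ν := ν) h.pos hl hq
  have dconst : ∀ (P : Matrix (Fin 5) (Fin 5) ℂ) (s : Set ℝ) (y : ℝ),
      HasMatDeriv (fun _ => P) 0 s y := fun P s y i j => hasDerivWithinAt_const _ _ _
  obtain ⟨p, p0, hp⟩ := exists_norm_apply_le (flagP α β γ l)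
  obtain ⟨r, r0, hr⟩ := exists_norm_apply_le (flagR α β γ l)
  generalize flagP α β γ l = P at hRP hPT hp
  generalize flagR α β γ l = R at hRP hr
  have hVZ : ∀ y, V y = mapTwo R (mapTwo P (V y)) := fun y => by
    rw [mapTwo_mapTwo, hRP, mapTwo_one]
  obtain ⟨Y, hY⟩ := eventually_eq_zero_of_lower (Z := fun y => mapTwo P (V y))
    (E := fun y => mapTwo P (derivTwo (opB ν (ξ y) α β γ - opB ν 1 α β γ) (V y)))
    (τ := flagT α β γ l) (σ := α * β - l) (Y₀ := Y₀)
    (M := 25 * p ^ 2 * (10 * (M * C₀) * (25 * r ^ 2))) (by positivity)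
    (fun i a => flagT_of_lt l) (fun i j => hT) (fun y hy => transpose_mapTwo _ _ (hV y hy))
    (fun y hy => by
      refine fun i j => ((dconst P _ _).mapTwo (hd y hy) i j).congr_deriv ?_
      refine congrFun (congrFun ?_ i) j
      have e : opB ν (ξ y) α β γ = (opB ν (ξ y) α β γ - opB ν 1 α β γ) + opB ν 1 α β γ := by abel
      rw [e]
      generalize opB ν (ξ y) α β γ - opB ν 1 α β γ = B'
      generalize opB ν 1 α β γ = B at hPT
      generalize flagT α β γ l = T at hPT
      have hPT' : Bᵀ * Pᵀ = Pᵀ * Tᵀ := by rw [← transpose_mul, hPT, transpose_mul]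
      have e1 : P * (B * (V y * Pᵀ)) = T * (P * (V y * Pᵀ)) := by
        rw [← Matrix.mul_assoc, hPT, Matrix.mul_assoc]
      simp only [derivTwo, mapTwo, Matrix.mul_add, Matrix.add_mul, transpose_add, transpose_zero,
        Matrix.zero_mul, Matrix.mul_zero, Matrix.smul_mul, Matrix.mul_smul, Matrix.mul_assoc,
        hPT', e1, add_sub_cancel_right]
      abel)
    (fun y hy G hG i j => by
      have hm := hξ.mem_Ioo y
      have hx : ξ y ∈ Icc θ 1 := ⟨hY₀.trans (hξ.monotone hy), hm.2.le⟩
      have b1 : ∀ i j, ‖(opB ν (ξ y) α β γ - opB ν 1 α β γ) i j‖ ≤ M * C₀ * Real.exp (-y) := by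
        intro i j
        rw [Matrix.sub_apply, mul_assoc]
        exact (hB _ hx i j).trans (mul_le_mul_of_nonneg_left (hC₀ y) hM)
      have b2 : ∀ i j, ‖V y i j‖ ≤ 25 * r ^ 2 * G := by
        intro i j
        rw [hVZ]
        exact norm_mapTwo_apply_le hr hG i j
      refine (norm_mapTwo_apply_le hp (norm_derivTwo_apply_le b1 b2) i j).trans (le_of_eq ?_)
      ring)
    (fun i j => by
      have := tendsto_mapTwo (f := fun _ => P) (a := P) (b := 0) (g := V)
        (fun i j => tendsto_const_nhds) (by simpa using h0) i j
      rwa [mapTwo_zero] at this)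
  exact ⟨Y, fun y hy => by rw [hVZ, hY y hy, mapTwo_zero]⟩

/-- Uniqueness of the normalized decaying solution. -/
theorem IsDecayingSolution.eqOn (h : Admissible ν α β γ c A L θ) (hξ : IsProfile ν ξ)
    (hγ : -β < γ.re) (h0 : θ < ξ₀) (h1 : ξ₀ < 1) {w w' : ℝ → Matrix (Fin 5) (Fin 5) ℂ}
    (hw : IsDecayingSolution ν ξ ξ₀ α β γ w) (hw' : IsDecayingSolution ν ξ ξ₀ α β γ w') :
    EqOn w' w (region ξ ξ₀) := by
  set σ : ℂ := α * β - lambdaMinus α β γ with hσ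
  set V : ℝ → Matrix (Fin 5) (Fin 5) ℂ :=
    fun y => Complex.exp (σ * y) • mapTwo (coordQ (ξ y) α β γ) (w' y - w y) with hV
  have hVd : ∀ y ∈ region ξ ξ₀, HasMatDeriv V (derivTwo (opB ν (ξ y) α β γ) (V y) + σ • V y)
      (region ξ ξ₀) y := by
    intro y hy
    refine hasMatDeriv_regular hξ h.alpha_pos h.pos σ fun i j => ?_
    refine ((hw'.ode y hy i j).fun_sub (hw.ode y hy i j)).congr_deriv ?_
    simp only [derivTwo, Matrix.mul_sub, Matrix.sub_mul, Matrix.neg_apply, Matrix.add_apply,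
      Matrix.sub_apply]
    ring
  have t1 := hξ.tendsto_one h.exp_pos
  have hV0 : ∀ i j, Tendsto (fun y => V y i j) atTop (𝓝 0) := by
    obtain ⟨C₀, hC, F, hF, hl⟩ := hw.limit
    obtain ⟨C₀', hC', F', hF', hl'⟩ := hw'.limit
    obtain rfl := tendsto_nhds_unique hC hC'
    obtain rfl := IsVecF.unique h hF' hF
    intro i j
    have tQ : ∀ i j, Tendsto (fun y => coordQ (ξ y) α β γ i j) atTop (𝓝 (coordQ 1 α β γ i j)) :=
      fun i j => ((hasDerivAt_coordQ 1 i j).continuousAt.tendsto).comp t1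
    have tD : ∀ i j, Tendsto (fun y : ℝ => (Complex.exp (σ * y) • (w' y - w y)) i j) atTop
        (𝓝 ((0 : Matrix (Fin 5) (Fin 5) ℂ) i j)) := by
      intro i j
      have := (hl' i j).sub (hl i j)
      rw [sub_self] at this
      refine this.congr fun y => ?_
      simp only [Matrix.smul_apply, Matrix.sub_apply, smul_eq_mul, hσ]
      ring
    have := tendsto_mapTwo tQ tD i j
    rw [mapTwo_zero] at this
    refine this.congr fun y => ?_
    rw [hV]
    simp only [mapTwo, Matrix.mul_smul, Matrix.smul_mul]
  obtain ⟨Y₀, hY₀⟩ := (t1.eventually (lt_mem_nhds h1)).exists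
  have hsub := hξ.Ici_subset_region (y := Y₀) (ξ₀ := ξ₀) hY₀.le
  obtain ⟨Y, hY⟩ := eventually_eq_zero_of_tendsto h hξ hγ (h0.trans hY₀).le
    (fun y hy => by
      rw [hV]
      simp only [transpose_smul]
      rw [transpose_mapTwo _ _ ?_, smul_neg]
      rw [transpose_sub, hw.antisymm y (hsub hy), hw'.antisymm y (hsub hy)]
      abel)
    (fun y hy i j => (hVd y (hsub hy) i j).mono hsub) hV0
  obtain ⟨M, hM, hB⟩ := exists_norm_opB_sub_le h.exp_pos h.mem_Ioo α β γ
  obtain ⟨b, b0, hb⟩ := exists_norm_apply_le (opB ν 1 α β γ)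
  intro y hy
  have hVy : V y = 0 := by
    refine eq_zero_of_right_eq_zero (B := fun y => opB ν (ξ y) α β γ) (σ := σ) (a := y)
      (b := max y Y) (C := M + b) (by positivity) (fun t ht i j => ?_) (fun t ht i j => ?_)
      (hY _ (mem_Ici.2 (le_max_right _ _))) y ⟨le_rfl, le_max_left _ _⟩
    · have hm := hξ.mem_Ioo t
      have ht' := hξ.Ici_subset_region hy ht.1
      have := hB (ξ t) ⟨h0.le.trans ht', hm.2.le⟩ i j
      have h2 := norm_add_le (opB ν (ξ t) α β γ i j - opB ν 1 α β γ i j) (opB ν 1 α β γ i j)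
      rw [sub_add_cancel] at h2
      have h3 : M * (1 - ξ t) ≤ M := mul_le_of_le_one_right hM (by linarith [hm.1])
      linarith [hb i j]
    · exact (hVd t (hξ.Ici_subset_region hy ht.1) i j).mono fun s hs =>
        hξ.Ici_subset_region hy hs.1
  have hQ : mapTwo (coordQ (ξ y) α β γ) (w' y - w y) = 0 :=
    (smul_eq_zero.1 hVy).resolve_left (Complex.exp_ne_zero _)
  have hS := mul_eq_one_comm.1
    (coordQ_mul_coordS (γ := γ) (hξ.mem_Ioo y).1 h.alpha_pos h.pos)
  have := congrArg (mapTwo (coordS (ξ y) α β γ)) hQ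
  rw [mapTwo_mapTwo, hS, mapTwo_one, mapTwo_zero] at this
  exact sub_eq_zero.1 this

end

/-! ### The expansion of the decaying solution -/

section

variable {ν α β c A L θ : ℝ} {γ : ℂ} {ξ : ℝ → ℝ}

theorem diagonal_fIdx (u : ℂ) (k : Fin 4) :
    (![1, 1, 1, u, 1] : Fin 5 → ℂ) (fIdx k).1 * (![1, 1, 1, u, 1] : Fin 5 → ℂ) (fIdx k).2 = u := by
  fin_cases k <;> simp [fIdx]

theorem diagonal_gIdx (u : ℂ) (l : Fin 6) :
    (![1, 1, 1, u, 1] : Fin 5 → ℂ) (gIdx l).1 * (![1, 1, 1, u, 1] : Fin 5 → ℂ) (gIdx l).2 = 1 := by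
  fin_cases l <;> simp [gIdx]

theorem scaled_solW (h : Admissible ν α β γ c A L θ) (hξ : IsProfile ν ξ) (y : ℝ) (i k : Fin 5) :
    scaled ξ α β γ (solW ν ξ α β γ) y i k =
      (1 - (ξ y : ℂ)) * ((![1, 1, 1, 1 / (1 - (ξ y : ℂ)), 1] : Fin 5 → ℂ) i *
        (![1, 1, 1, 1 / (1 - (ξ y : ℂ)), 1] : Fin 5 → ℂ) k * sumU ν α β γ (ξ y) i k) := by
  have e : mapTwo (changeT (ξ y) α β γ) (solW ν ξ α β γ y) =
      (Complex.exp (α * mu α β γ * y) * (1 - (ξ y : ℂ))) •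
        mapTwo (diagonal ![1, 1, 1, 1 / (1 - (ξ y : ℂ)), 1]) (sumU ν α β γ (ξ y)) := by
    rw [← changeT_mul_coordS (γ := γ) (hξ.mem_Ioo y) h.alpha_pos h.pos, ← mapTwo_mapTwo]
    simp only [solW, mapTwo, Matrix.mul_smul, Matrix.smul_mul]
  have e' : Complex.exp (-(α * mu α β γ * y)) * Complex.exp (α * mu α β γ * y) = 1 := by
    rw [← Complex.exp_add, neg_add_cancel, Complex.exp_zero]
  rw [scaled, e, smul_smul, ← mul_assoc, e', one_mul, Matrix.smul_apply, smul_eq_mul, mapTwo,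
    diagonal_transpose, mul_diagonal, diagonal_mul]
  ring

theorem zCoord_solW (h : Admissible ν α β γ c A L θ) (hξ : IsProfile ν ξ) (k : Fin 4) (y : ℝ) :
    zCoord ξ α β γ (solW ν ξ α β γ) k y = sumU ν α β γ (ξ y) (fIdx k).1 (fIdx k).2 := by
  have : 1 - (ξ y : ℂ) ≠ 0 := by
    rw [sub_ne_zero]
    exact_mod_cast (hξ.mem_Ioo y).2.ne'
  rw [zCoord, scaled_solW h hξ, diagonal_fIdx]
  field_simp

theorem mCoord_solW (h : Admissible ν α β γ c A L θ) (hξ : IsProfile ν ξ) (l : Fin 6) (y : ℝ) :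
    mCoord ξ α β γ (solW ν ξ α β γ) l y =
      (1 - (ξ y : ℂ)) * sumU ν α β γ (ξ y) (gIdx l).1 (gIdx l).2 := by
  rw [mCoord, scaled_solW h hξ, diagonal_gIdx, one_mul]

theorem hasSum_zCoord (h : Admissible ν α β γ c A L θ) (hξ : IsProfile ν ξ) (k : Fin 4) {y : ℝ}
    (hy : θ ≤ ξ y) :
    HasSum (fun j : ℕ => term ν α (deltaExp k) (j + 1) (coeffFnA ν k (j + 1) β γ) (ξ y))
      (zCoord ξ α β γ (solW ν ξ α β γ) k y - Wplus β γ k) := by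
  have hm := hξ.mem_Ioo y
  have s := hasSum_succ_of_hasSum (hasSum_sumU h ⟨hy, hm.2.le⟩ (fIdx k).1 (fIdx k).2)
  rw [pow_zero, one_mul, coeffU_zero, wedge_vecE_fIdx _ (Pi.single_eq_same _ _)] at s
  rw [zCoord_solW h hξ]
  exact s.congr_fun fun j => term_coeffFnA hm.1 k (j + 1)

theorem hasSum_mCoord (h : Admissible ν α β γ c A L θ) (hξ : IsProfile ν ξ) (l : Fin 6) {y : ℝ}
    (hy : θ ≤ ξ y) :
    HasSum (fun j : ℕ => term ν α (dExp l) (j + 1) (coeffFnB ν l (j + 1) β γ) (ξ y))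
      (mCoord ξ α β γ (solW ν ξ α β γ) l y) := by
  have hm := hξ.mem_Ioo y
  have s := hasSum_succ_of_hasSum (hasSum_sumU h ⟨hy, hm.2.le⟩ (gIdx l).1 (gIdx l).2)
  have h0 : wedge (Pi.single 3 1) (vecE β γ) (gIdx l).1 (gIdx l).2 = 0 := by
    have := gIdx_ne_three l
    rw [not_or] at this
    rw [wedge_apply, Pi.single_eq_of_ne this.1, Pi.single_eq_of_ne this.2]
    ring
  rw [pow_zero, one_mul, coeffU_zero, h0, sub_zero] at s
  rw [mCoord_solW h hξ]
  exact (s.mul_left _).congr_fun fun j => term_coeffFnB hm.1 l (j + 1)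

end

theorem deltaExp_mem (k : Fin 4) : deltaExp k ∈ Icc (0 : ℝ) 2 := by
  fin_cases k <;> norm_num [deltaExp]

theorem dExp_mem (l : Fin 6) : dExp l ∈ Icc (0 : ℝ) 2 := by
  fin_cases l <;> norm_num [dExp]

end KullAnisimov

end

theorem theorem3p1 (ν : ℝ) (hν : 0 < ν) (ξ : ℝ → ℝ) (hξ : KullAnisimov.IsProfile ν ξ) :
    -- the coefficients `a k j β γ x` and `b l j β γ x`, which do not depend on `α`
    ∃ (a : Fin 4 → ℕ → ℝ → ℂ → ℝ → ℂ) (b : Fin 6 → ℕ → ℝ → ℂ → ℝ → ℂ),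
      ∀ K : Set (ℝ × ℂ), IsCompact K → (∀ p ∈ K, 0 < p.1) →
      ∃ R : ℝ, 0 < R ∧
        -- estimates of the coefficients
        (∀ (β : ℝ) (γ : ℂ), (β, γ) ∈ K → ∀ j : ℕ, 1 ≤ j → ∀ x ∈ Set.Ioc (0 : ℝ) 1,
          (∀ k, KullAnisimov.CoeffBound ν R (KullAnisimov.deltaExp k) j (a k j β γ) x) ∧
          (∀ l, KullAnisimov.CoeffBound ν R (KullAnisimov.dExp l) j (b l j β γ) x)) ∧
        ∀ ξ₀ ∈ Set.Ioo (0 : ℝ) 1, ∃ α₁ : ℝ, 0 < α₁ ∧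
          -- normal convergence for `x ∈ [ξ₀, 1]`, uniformly in the parameters
          (∃ u : ℕ → ℝ, Summable u ∧
            ∀ α ∈ Set.Ioo (0 : ℝ) α₁, ∀ (β : ℝ) (γ : ℂ), (β, γ) ∈ K → ∀ j : ℕ, 1 ≤ j →
            ∀ x ∈ Set.Icc ξ₀ 1,
              (∀ k, ‖KullAnisimov.term ν α (KullAnisimov.deltaExp k) j (a k j β γ) x‖ ≤ u j) ∧
              (∀ l, ‖KullAnisimov.term ν α (KullAnisimov.dExp l) j (b l j β γ) x‖ ≤ u j)) ∧
          -- the normalized decaying solution and its expansion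
          ∀ α ∈ Set.Ioo (0 : ℝ) α₁, ∀ (β : ℝ) (γ : ℂ), (β, γ) ∈ K →
            ∃ w : ℝ → Matrix (Fin 5) (Fin 5) ℂ,
              KullAnisimov.IsDecayingSolution ν ξ ξ₀ α β γ w ∧
              (-β < γ.re → ∀ w' : ℝ → Matrix (Fin 5) (Fin 5) ℂ,
                KullAnisimov.IsDecayingSolution ν ξ ξ₀ α β γ w' →
                Set.EqOn w' w (KullAnisimov.region ξ ξ₀)) ∧
              ∀ y ∈ KullAnisimov.region ξ ξ₀,
                (∀ k, HasSum (fun j : ℕ => KullAnisimov.term ν α (KullAnisimov.deltaExp k) (j + 1)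
                    (a k (j + 1) β γ) (ξ y))
                  (KullAnisimov.zCoord ξ α β γ w k y - KullAnisimov.Wplus β γ k)) ∧
                (∀ l, HasSum (fun j : ℕ => KullAnisimov.term ν α (KullAnisimov.dExp l) (j + 1)
                    (b l (j + 1) β γ) (ξ y))
                  (KullAnisimov.mCoord ξ α β γ w l y)) := by

  refine ⟨KullAnisimov.coeffFnA ν, KullAnisimov.coeffFnB ν, fun K hKc hK => ?_⟩
  obtain ⟨c, A, L, hc, hA, hL, hb⟩ := KullAnisimov.exists_paramBound ν hKc hK
  have hR : 0 < 2 * (A + 1) * L := by positivity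
  have hLR : L ≤ 2 * (A + 1) * L := by nlinarith
  refine ⟨2 * (A + 1) * L, hR, fun β γ hp j hj x hx =>
    ⟨fun k => KullAnisimov.coeffBound_coeffFnA (hb β γ hp) hν hL hj hx k,
      fun l => KullAnisimov.coeffBound_coeffFnB (hb β γ hp) hν hL hj hx l⟩, fun ξ₀ h0 => ?_⟩
  -- convergence on `[ξ₀ / 2, 1]` gives the derivative of the sum at `ξ = ξ₀` too
  have hθ : ξ₀ / 2 ∈ Set.Ioo (0 : ℝ) 1 := ⟨by linarith [h0.1], by linarith [h0.2]⟩
  have hp0 : 0 < (ξ₀ / 2) ^ (-ν) := Real.rpow_pos_of_pos hθ.1 _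
  refine ⟨1 / (2 * (2 * (A + 1) * L * (ξ₀ / 2) ^ (-ν))), by positivity, ?_, ?_⟩
  · refine ⟨fun j => ξ₀ ^ (-2 : ℝ) * (1 / 2) ^ j,
      (summable_geometric_of_lt_one (by norm_num) (by norm_num)).mul_left _,
      fun α hα β γ hp j hj x hx => ?_⟩
    have hs : α * (2 * (A + 1) * L) * ξ₀ ^ (-ν) ≤ 1 / 2 := by
      have h1 : ξ₀ ^ (-ν) ≤ (ξ₀ / 2) ^ (-ν) :=
        Real.rpow_le_rpow_of_nonpos hθ.1 (by linarith [h0.1]) (by linarith)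
      have h2 := (lt_div_iff₀ (by positivity)).1 hα.2
      have h3 := mul_le_mul_of_nonneg_left h1 (mul_pos hα.1 hR).le
      linarith
    have hx' : x ∈ Set.Ioc (0 : ℝ) 1 := ⟨h0.1.trans_le hx.1, hx.2⟩
    exact ⟨fun k => KullAnisimov.norm_term_le hν (KullAnisimov.deltaExp_mem k).2
        (KullAnisimov.deltaExp_mem k).1 hR hα.1 h0.1 hx hs
        (KullAnisimov.coeffBound_coeffFnA (hb β γ hp) hν hL hj hx' k).1,
      fun l => KullAnisimov.norm_term_le hν (KullAnisimov.dExp_mem l).2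
        (KullAnisimov.dExp_mem l).1 hR hα.1 h0.1 hx hs
        (KullAnisimov.coeffBound_coeffFnB (hb β γ hp) hν hL hj hx' l).1⟩
  · intro α hα β γ hp
    have h : KullAnisimov.Admissible ν α β γ c A L (ξ₀ / 2) := by
      refine ⟨hb β γ hp, hν, hα.1, hθ, ?_⟩
      have h2 := (lt_div_iff₀ (by positivity)).1 hα.2
      have h3 := mul_le_mul_of_nonneg_right (mul_le_mul_of_nonneg_left hLR hα.1.le) hp0.le
      linarith
    have hlt : ξ₀ / 2 < ξ₀ := by linarith [h0.1]
    have hw := KullAnisimov.isDecayingSolution_solW h hξ hlt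
    exact ⟨KullAnisimov.solW ν ξ α β γ, hw, fun hγ w' hw' => hw.eqOn h hξ hγ hlt h0.2 hw',
      fun y hy => ⟨fun k => KullAnisimov.hasSum_zCoord h hξ k (hlt.le.trans hy),
        fun l => KullAnisimov.hasSum_mCoord h hξ l (hlt.le.trans hy)⟩⟩
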